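/- Let $f:\,]0,\infty[\,\to\mathbb R$ be $C^\infty$, let $F$ satisfy $F'(s)=sf(s)-1$, and assume $f(s)f'(s)F''(s)\neq 0$ for all $s>0$. Let $\epsilon_f\in\{1,-1\}$ be the sign with $\epsilon_fF''>0$, and assume that $$\lim_{s\to0}\epsilon_f sf(s)<1<\lim_{s\to\infty}\epsilon_f sf(s)$$ (limits in $[-\infty,\infty]$); the class of all such $f$ is denoted $\mathcal F^*$. Let $s_f>0$ be the unique solution of $sf(s)=\epsilon_f$. **Curves.** An oriented smooth curve $\mathcal C$ is given by a $C^\infty$ path $c:J\to\mathbb C$ with $|\dot c|=1$ on an open interval $J\ni 0$, up to a shift of the parameter; $[\mathcal C]=c(J)$. Write $\dot c=e^{i\vartheta_c}$ with $\vartheta_c$ smooth. $\mathcal C$ is a *solution* (of $\kappa=f(r)$) if $\dot\vartheta_c(t)=f(|c(t)|)$ whenever $c(t)\ne0$. A solution is *maximal* if $[\mathcal C]\subset[\widehat{\mathcal C}]$ for a solution $\widehat{\mathcal C}$ implies $[\mathcal C]=[\widehat{\mathcal C}]$; *closed* if $[\mathcal C]$ is compact; and a *Jordan solution* if it is maximal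 and $[\mathcal C]$ is homeomorphic to the unit circle. For $0<s\le s_f$ let $\mathcal C_{f,s}$ be a maximal solution with $c(0)=\epsilon_f s$ and $\vartheta_c(0)=\pi/2$ for some parametrization $c$ of it. A closed maximal solution is *oriented counter-clockwise* (*clockwise*) if $c$ extends to a periodic smooth arc-length parametrization of $[\mathcal C]$ on $\mathbb R$ whose rotation index (total turn of the tangent over one period) is positive (negative) and which, if $[\mathcal C]$ is homeomorphic to the circle, traverses $[\mathcal C]$ once per period, with winding number $+1$ ($-1$) about every point of the interior, i.e. every point of a bounded component of $\mathbb C\setminus[\mathcal C]$ (of which there is at least one). **Net winding.** Suppose that the solution $z:\mathbb R\to\mathbb C\setminus\{0\}$ of $\dot z=izf(|z|)-i$, $z(0)=p$ exists and is periodic, with minimal period $T>0$. Then $\omega_f(p)=\pm\frac1{2\pi}\int_0^Tf(|z(t)|)\,dt$, with $+$ if the simple closed path $z$ is oriented counter-clockwise, and $-$ if it is oriented clockwise. Let $$\mathcal O_f=\bigcup_{n\ge2}\{\,0<s<s_f:\ \omega_f(\epsilon_fs)=1/n\,\}.$$ **Theorem.** Let $f\in\mathcal F^*$ and let $\mathcal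 C$ be a closed maximal solution of $\kappa=f(r)$. Then $\mathcal C$ is oriented counter-clockwise if $f>0$, and clockwise if $f<0$. Moreover, the following are equivalent: 1. $\mathcal C$ is a Jordan solution; 2. $[\mathcal C]$ is the circle of radius $s_f$ centered at $0$, or else $[\mathcal C]=e^{i\vartheta}[\mathcal C_{f,s}]$ for some $\vartheta\in\mathbb R$ and a unique $s\in\mathcal O_f$. -/

import Mathlib

open scoped ContDiff

noncomputable section

namespace RadialCurvature

/-! ### The class of curvature functions

A function `f : ℝ⁺ → ℝ` is represented by `f : ℝ → ℝ`; only its values on `]0, ∞[` are used. -/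

/-- With `F` an antiderivative of `s f(s) - 1` on `ℝ⁺`, this is the second derivative `F''(s)`. -/
def secondF (f : ℝ → ℝ) (s : ℝ) : ℝ := deriv (fun u => u * f u - 1) s

/-- The class `𝓕`: `f` is smooth on `ℝ⁺` and `f(s) f'(s) F''(s) ≠ 0` for all `s ∈ ℝ⁺`. -/
structure MemF (f : ℝ → ℝ) : Prop where
  smooth : ContDiffOn ℝ ∞ f (Set.Ioi 0)
  ne_zero : ∀ s : ℝ, 0 < s → f s * deriv f s * secondF f s ≠ 0

open Classical in
/-- The sign `ε_f ∈ {1, -1}` with `ε_f F'' > 0` on `ℝ⁺` (for `f ∈ 𝓕`, `F''` has no zeros,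
so it has a constant sign). -/
def eps (f : ℝ → ℝ) : ℝ := if ∀ s : ℝ, 0 < s → 0 < secondF f s then 1 else -1

/-- The class `𝓕*`: those `f ∈ 𝓕` for which `1` belongs to the open interval whose end-points
are the limits (in the extended reals) of `ε_f s f(s)` as `s → 0` and as `s → ∞`. -/
structure MemFStar (f : ℝ → ℝ) : Prop extends MemF f where
  one_mem : ∃ a b : EReal,
    Filter.Tendsto (fun s : ℝ => ((eps f * (s * f s) : ℝ) : EReal)) (nhdsWithin 0 (Set.Ioi 0))
      (nhds a) ∧
    Filter.Tendsto (fun s : ℝ => ((eps f * (s * f s) : ℝ) : EReal)) Filter.atTop (nhds b) ∧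
    a < 1 ∧ 1 < b

/-- The radius `s_f`: for `f ∈ 𝓕*` the set below has exactly one element. -/
def critRadius (f : ℝ → ℝ) : ℝ := sInf {s : ℝ | 0 < s ∧ s * f s = eps f}

/-! ### Loops and their orientation -/

/-- The winding number about `q` of the loop `γ` restricted to `[0, a]`. -/
def winding (γ : ℝ → ℂ) (a : ℝ) (q : ℂ) : ℂ :=
  (2 * Real.pi * Complex.I)⁻¹ * ∫ t in (0 : ℝ)..a, deriv γ t / (γ t - q)

/-- `q` lies in a bounded component of the complement of the set `S`. -/
def InteriorTo (S : Set ℂ) (q : ℂ) : Prop :=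
  q ∈ Sᶜ ∧ Bornology.IsBounded (connectedComponentIn Sᶜ q)

/-- Counter-clockwise orientation of a simple loop `γ` with period `a`:
there are interior points, and `γ` winds once counter-clockwise about each of them. -/
def LoopCCW (γ : ℝ → ℂ) (a : ℝ) : Prop :=
  (∃ q, InteriorTo (Set.range γ) q) ∧ ∀ q, InteriorTo (Set.range γ) q → winding γ a q = 1

/-- Clockwise orientation of a simple loop `γ` with period `a`. -/
def LoopCW (γ : ℝ → ℂ) (a : ℝ) : Prop :=
  (∃ q, InteriorTo (Set.range γ) q) ∧ ∀ q, InteriorTo (Set.range γ) q → winding γ a q = -1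

/-! ### The planar flow and the net winding -/

/-- `z` is a solution on all of `ℝ` of `ż = i z f(|z|) - i` in the punctured plane. This is the
orbit of `z 0` under the flow `Φ_f`, for every point whose orbit does not contain `0`. -/
def IsFlowLine (f : ℝ → ℝ) (z : ℝ → ℂ) : Prop :=
  ∀ t : ℝ, z t ≠ 0 ∧ HasDerivAt z (Complex.I * z t * (f ‖z t‖ : ℂ) - Complex.I) t

/-- `p` is a periodic (possibly fixed) point of the flow whose orbit does not contain `0`, and its
net winding `± (2π)⁻¹ ∫_0^T f(|Φ_f(t,p)|) dt` equals `w`. Here `T` is the infimum of all `t > 0`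
with `Φ_f(t,p) = p`, and the sign is `+` if the orbit is oriented counter-clockwise, and `-` if it
is oriented clockwise; the net winding of a fixed point (where `T = 0`) is `0`. -/
def HasNetWinding (f : ℝ → ℝ) (p : ℂ) (w : ℝ) : Prop :=
  ∃ (z : ℝ → ℂ) (T : ℝ), IsFlowLine f z ∧ z 0 = p ∧
    {t : ℝ | 0 < t ∧ z t = p}.Nonempty ∧ T = sInf {t : ℝ | 0 < t ∧ z t = p} ∧
    ((T = 0 ∧ w = 0) ∨
     (0 < T ∧ LoopCCW z T ∧ w = (2 * Real.pi)⁻¹ * ∫ t in (0 : ℝ)..T, f ‖z t‖) ∨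
     (0 < T ∧ LoopCW z T ∧ w = -((2 * Real.pi)⁻¹ * ∫ t in (0 : ℝ)..T, f ‖z t‖)))

/-- The set `𝒪_f` of all `0 < s < s_f` for which the net winding of `ε_f s` equals `1/n` for some
integer `n ≥ 2`. -/
def OSet (f : ℝ → ℝ) : Set ℝ :=
  {s : ℝ | 0 < s ∧ s < critRadius f ∧
    ∃ n : ℕ, 2 ≤ n ∧ HasNetWinding f ((eps f * s : ℝ) : ℂ) (1 / (n : ℝ))}

/-! ### Oriented smooth curves -/

/-- `ϑ` is a smooth tangent angle on `J` of the path `c`: `ċ = e^{iϑ}`. -/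
def IsTangentAngle (c : ℝ → ℂ) (J : Set ℝ) (ϑ : ℝ → ℝ) : Prop :=
  ContDiffOn ℝ ∞ ϑ J ∧ ∀ t ∈ J, deriv c t = Complex.exp (Complex.I * (ϑ t : ℂ))

/-- A smooth path parametrized by arc length on an open interval containing `0`. An oriented smooth
curve is given by any of its arc-length parametrizations; everything defined below
does not change under a shift of the parameter (other than the choice of a parametrization with
prescribed value at `0` in `IsFamilyMember`) and does not depend on values outside `J`. -/
structure ArcCurve where
  J : Set ℝ
  isOpen_J : IsOpen J
  ordConnected_J : J.OrdConnected
  zero_mem : (0 : ℝ) ∈ J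
  c : ℝ → ℂ
  smooth : ContDiffOn ℝ ∞ c J
  unit_speed : ∀ t ∈ J, ‖deriv c t‖ = 1

namespace ArcCurve

/-- The set `[𝒞]` of points of the curve. -/
def trace (C : ArcCurve) : Set ℂ := C.c '' C.J

/-- `𝒞` solves `κ = f(r)`: its curvature, the derivative of a tangent angle, is `f(|c(t)|)`
whenever `c(t) ≠ 0`. -/
def IsSolution (f : ℝ → ℝ) (C : ArcCurve) : Prop :=
  ∃ ϑ : ℝ → ℝ, IsTangentAngle C.c C.J ϑ ∧ ∀ t ∈ C.J, C.c t ≠ 0 → deriv ϑ t = f ‖C.c t‖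

/-- A solution is maximal if its set of points cannot be enlarged. -/
def IsMaximalSolution (f : ℝ → ℝ) (C : ArcCurve) : Prop :=
  C.IsSolution f ∧ ∀ D : ArcCurve, D.IsSolution f → C.trace ⊆ D.trace → C.trace = D.trace

/-- A curve is closed if its set of points is compact. -/
def IsClosedCurve (C : ArcCurve) : Prop := IsCompact C.trace

/-- A curve is simple closed if its set of points is homeomorphic to the unit circle. -/
def IsSimpleClosed (C : ArcCurve) : Prop := Nonempty (C.trace ≃ₜ Circle)

/-- A Jordan solution is a maximal solution that is simple closed. -/
def IsJordanSolution (f : ℝ → ℝ) (C : ArcCurve) : Prop :=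
  C.IsMaximalSolution f ∧ C.IsSimpleClosed

/-- `γ` is a smooth arc-length parametrization with period `a` that extends the
given one to all of `ℝ` and runs through the same points. -/
structure IsClosedParam (C : ArcCurve) (γ : ℝ → ℂ) (a : ℝ) : Prop where
  smooth : ContDiff ℝ ∞ γ
  unit_speed : ∀ t, ‖deriv γ t‖ = 1
  pos : 0 < a
  periodic : Function.Periodic γ a
  extends_c : Set.EqOn γ C.c C.J
  range_eq : Set.range γ = C.trace

/-- The closed curve `𝒞` is oriented counter-clockwise: it has a periodic parametrization whose
tangent makes a positive total turn over one period (positive rotation index) and which,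
if `𝒞` is simple closed, traverses `𝒞` once, winding counter-clockwise
about the interior points. -/
def OrientedCCW (C : ArcCurve) : Prop :=
  ∃ (γ : ℝ → ℂ) (a : ℝ) (ϑ : ℝ → ℝ), C.IsClosedParam γ a ∧ IsTangentAngle γ Set.univ ϑ ∧
    ϑ 0 < ϑ a ∧ (C.IsSimpleClosed → Set.InjOn γ (Set.Ico 0 a) ∧ LoopCCW γ a)

/-- The closed curve `𝒞` is oriented clockwise. -/
def OrientedCW (C : ArcCurve) : Prop :=
  ∃ (γ : ℝ → ℂ) (a : ℝ) (ϑ : ℝ → ℝ), C.IsClosedParam γ a ∧ IsTangentAngle γ Set.univ ϑ ∧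
    ϑ a < ϑ 0 ∧ (C.IsSimpleClosed → Set.InjOn γ (Set.Ico 0 a) ∧ LoopCW γ a)

/-- `𝒞` is (parametrized as) the curve `𝒞_{f,s}`: a maximal solution with `c(0) = ε_f s` and
tangent angle `π/2` at parameter `0`. -/
def IsFamilyMember (f : ℝ → ℝ) (s : ℝ) (C : ArcCurve) : Prop :=
  C.IsMaximalSolution f ∧ C.c 0 = ((eps f * s : ℝ) : ℂ) ∧
    ∃ ϑ : ℝ → ℝ, IsTangentAngle C.c C.J ϑ ∧ ϑ 0 = Real.pi / 2

end ArcCurve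

end RadialCurvature

end

/-!
Closed maximal solutions of `κ = f(r)` are studied in coordinates that move with the curve: with a
tangent angle `ϑ` of `c` put `z = -i c̄ e^{iϑ}`. Then `|z| = |c|`, the curve is recovered from `z`
and `ϑ` by the same substitution (`roll`), and the curvature equation becomes the planar flow
`ż = i z f(|z|) - i` together with `ϑ̇ = f(|z|)`.

A rotation by a half-turn with reversal of time exchanges `f` and `-f` and the two orientations
(`ArcCurve.reflect`), so let `f > 0`. Then `s f(s)` is strictly increasing, and the potential
`½ ∫_0^{|z|²} f(√u) du - Re z` is a strictly convex, coercive first integral of the flow. Its orbits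
are therefore the equilibrium at the critical radius `r` with `r f(r) = 1` and convex loops around
it, symmetric about the real axis, which they cross at a point `p < r` and, half a period `S`
later, on the right of `r` (`IsPlanarFlow.eq_const_or_isOrbit`, `IsOrbit`). The radii of a closed
solution are bounded, and if it passes through the origin, its smoothness there bounds `f'` near
`0` (`ArcCurve.bounded_deriv_of_zero`); so `f` may be replaced by a function `φ` with a globally
Lipschitz flow (`Tame`), and by maximality and compactness the curve is parametrized by a
whole orbit (`exists_globalParam`).

Over a period `2S` of `z` the curve is rotated by the angle `α = 2 (ϑ(S) - ϑ(0)) > 0`. If its set of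
points is compact, then `α` is a rational multiple of `2π`, because the points at maximal distance
from the origin are attained at countably many times (`IsOrbit.exists_nat_turn`). Hence the curve is
periodic with positive total turn.

If moreover the set of points is homeomorphic to the circle, then the curve passes through each
point once per period (`periodic_of_homeomorph_circle`). By its symmetry about the real axis it can
meet this axis only at multiples of `S`, and it makes at most half a turn up to the time `S`.
Exactly half a turn is impossible, as the curvature is strictly monotone on `[0, S]` and the curve
would start and end at equal heights (`height_ne_of_half_turn`). For `p ≤ 0` there would be a double
point, so `p > 0`, and the first return to the axis gives `α = 2π / k` with `k ≥ 2`
(`IsOrbit.exists_turn_of_simple`).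

Conversely `p > 0` and `α = 2π / n` give a closed curve of positive
curvature with one full turn: a convex loop with the origin on its left (`isConvexLoop_of_turn`,
`IsConvexLoop.loopCCW`). As `z` itself is a convex loop around the equilibrium, traversed
counter-clockwise, the net winding of `p` is `α / (2π)`, and `p` is determined by the curve as its
distance from the origin.
-/

namespace RadialCurvature

open Set Filter Topology

/-! ### Globally Lipschitz autonomous differential equations -/

section ODE

variable {E : Type*} [NormedAddCommGroup E] [NormedSpace ℝ E]

/-- Two integral curves of a globally Lipschitz field on an open interval that agree at one
point agree throughout. -/
theorem eqOn_of_integralCurves {v : E → E} {K : NNReal} (hv : LipschitzWith K v) {J : Set ℝ}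
    (hJ : IsOpen J) (hJ' : J.OrdConnected) {x y : ℝ → E}
    (hx : ∀ t ∈ J, HasDerivAt x (v (x t)) t) (hy : ∀ t ∈ J, HasDerivAt y (v (y t)) t)
    {t₀ : ℝ} (ht₀ : t₀ ∈ J) (h : x t₀ = y t₀) : EqOn x y J := by
  intro t ht
  obtain ⟨ε, hε, hball⟩ := Metric.isOpen_iff.1 hJ t ht
  obtain ⟨ε', hε', hball'⟩ := Metric.isOpen_iff.1 hJ t₀ ht₀
  rw [Real.ball_eq_Ioo] at hball hball'
  set a := min (t - ε / 2) (t₀ - ε' / 2)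
  set b := max (t + ε / 2) (t₀ + ε' / 2)
  have ha : a ∈ J := by
    rcases min_choice (t - ε / 2) (t₀ - ε' / 2) with h | h
    · rw [show a = _ from h]; exact hball ⟨by linarith, by linarith⟩
    · rw [show a = _ from h]; exact hball' ⟨by linarith, by linarith⟩
  have hb : b ∈ J := by
    rcases max_choice (t + ε / 2) (t₀ + ε' / 2) with h | h
    · rw [show b = _ from h]; exact hball ⟨by linarith, by linarith⟩
    · rw [show b = _ from h]; exact hball' ⟨by linarith, by linarith⟩
  have hsub : Ioo a b ⊆ J := Ioo_subset_Icc_self.trans (hJ'.out ha hb)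
  have h1 : a ≤ t - ε / 2 := min_le_left _ _
  have h2 : a ≤ t₀ - ε' / 2 := min_le_right _ _
  have h3 : t + ε / 2 ≤ b := le_max_left _ _
  have h4 : t₀ + ε' / 2 ≤ b := le_max_right _ _
  refine ODE_solution_unique_of_mem_Ioo (v := fun _ => v) (s := fun _ => univ) (K := K)
    (fun _ _ => hv.lipschitzOnWith) (a := a) (b := b) (t₀ := t₀) ⟨by linarith, by linarith⟩
    (fun u hu => ⟨hx u (hsub hu), mem_univ _⟩) (fun u hu => ⟨hy u (hsub hu), mem_univ _⟩) h
    ⟨by linarith, by linarith⟩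

/-- Global version of `eqOn_of_integralCurves`. -/
theorem eq_of_integralCurves {v : E → E} {K : NNReal} (hv : LipschitzWith K v) {x y : ℝ → E}
    (hx : ∀ t, HasDerivAt x (v (x t)) t) (hy : ∀ t, HasDerivAt y (v (y t)) t)
    {t₀ : ℝ} (h : x t₀ = y t₀) : x = y :=
  funext fun t => eqOn_of_integralCurves hv isOpen_univ ordConnected_univ (fun t _ => hx t)
    (fun t _ => hy t) (mem_univ t₀) h (mem_univ t)

/-- Local solutions of a `K`-Lipschitz equation live at least for the time `1 / (K + 1)`,
whatever the initial point: the ball of radius `‖v x‖` around `x` is not left before. -/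
theorem exists_integralCurve_Icc [CompleteSpace E] {v : E → E} {K : NNReal}
    (hv : LipschitzWith K v) (x : E) :
    ∃ z : ℝ → E, z 0 = x ∧ ∀ t ∈ Ioo (-(1 / ((K : ℝ) + 1))) (1 / ((K : ℝ) + 1)),
      HasDerivAt z (v (z t)) t := by
  set δ : ℝ := 1 / ((K : ℝ) + 1) with hδ
  have hK : (0 : ℝ) ≤ K := K.2
  have hδ0 : 0 < δ := by positivity
  have h0 : (0 : ℝ) ∈ Icc (-δ) δ := ⟨by linarith, hδ0.le⟩
  have hpl : IsPicardLindelof (fun _ => v) (tmin := -δ) (tmax := δ) ⟨0, h0⟩ x ‖v x‖₊ 0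
      ((K + 1) * ‖v x‖₊) K := by
    refine IsPicardLindelof.of_time_independent (fun y hy => ?_) hv.lipschitzOnWith ?_
    · have h1 := hv.dist_le_mul y x
      rw [dist_eq_norm] at h1
      have h2 : ‖v y‖ ≤ ‖v y - v x‖ + ‖v x‖ := by
        simpa using norm_add_le (v y - v x) (v x)
      have h3 : dist y x ≤ ‖v x‖ := by simpa using hy
      have h4 : (K : ℝ) * dist y x ≤ K * ‖v x‖ := by gcongr
      push_cast
      nlinarith
    · push_cast
      simp only [sub_zero, zero_sub, neg_neg, max_self]
      rw [hδ]
      field_simp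
      simp
  obtain ⟨z, hz0, hz⟩ := hpl.exists_eq_forall_mem_Icc_hasDerivWithinAt₀
  refine ⟨z, hz0, fun t ht => (hz t (Ioo_subset_Icc_self ht)).hasDerivAt (Icc_mem_nhds ht.1 ht.2)⟩

/-- Forward solutions exist for all time: the local solutions, which all live on an interval of
the same length `2δ`, are joined at the multiples of `δ / 2`. -/
theorem exists_integralCurve_Ioi [CompleteSpace E] {v : E → E} {K : NNReal}
    (hv : LipschitzWith K v) (x : E) :
    ∃ ε > 0, ∃ z : ℝ → E, z 0 = x ∧ ∀ t ∈ Ioi (-ε), HasDerivAt z (v (z t)) t := by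
  choose γ hγ0 hγ using exists_integralCurve_Icc hv
  set δ : ℝ := 1 / ((K : ℝ) + 1) with hδ
  have hK : (0 : ℝ) ≤ K := K.2
  set η : ℝ := δ / 2 with hη
  have hη0 : 0 < η := by positivity
  have hδη : δ = 2 * η := by rw [hη]; ring
  rw [hδη] at hγ
  set X : ℕ → E := fun n => Nat.rec x (fun _ y => γ y η) n with hX
  have hX1 : ∀ n, X (n + 1) = γ (X n) η := fun n => rfl
  -- consecutive local solutions agree on the overlap of their domains
  have hover : ∀ n : ℕ, ∀ u ∈ Ioo (-η) η, γ (X n) (η + u) = γ (X (n + 1)) u := by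
    intro n u hu
    refine eqOn_of_integralCurves hv isOpen_Ioo ordConnected_Ioo (t₀ := 0)
      (x := fun u => γ (X n) (η + u)) (y := γ (X (n + 1))) (fun t ht => ?_) (fun t ht => ?_)
      ⟨by linarith, hη0⟩ ?_ hu
    · exact (hγ (X n) (η + t) ⟨by linarith [ht.1], by linarith [ht.2]⟩).comp_const_add η t
    · exact hγ _ t ⟨by linarith [ht.1], by linarith [ht.2]⟩
    · simp [hγ0, hX1]
  set z : ℝ → E := fun t => γ (X ⌊t / η⌋₊) (t - ⌊t / η⌋₊ * η) with hz
  -- on the interval between two multiples, extended slightly to both sides, `z` is one solution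
  have hzn : ∀ n : ℕ, ∀ t ∈ Ioo (n * η - η) (n * η + η), z t = γ (X n) (t - n * η) := by
    intro n t ht
    by_cases h : (n : ℝ) * η ≤ t
    · have : ⌊t / η⌋₊ = n := by
        rw [Nat.floor_eq_iff (div_nonneg ((by positivity : (0 : ℝ) ≤ n * η).trans h) hη0.le)]
        exact ⟨(le_div_iff₀ hη0).2 h, (div_lt_iff₀ hη0).2 (by linarith [ht.2])⟩
      simp only [hz, this]
    · push Not at h
      rcases n with _ | m
      · have : ⌊t / η⌋₊ = 0 := by
          apply Nat.floor_of_nonpos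
          apply div_nonpos_of_nonpos_of_nonneg _ hη0.le
          simpa using h.le
        simp only [hz, this]
      · push_cast at ht h
        have : ⌊t / η⌋₊ = m := by
          have h0 : (m : ℝ) * η ≤ t := by linarith [ht.1]
          rw [Nat.floor_eq_iff (div_nonneg ((by positivity : (0 : ℝ) ≤ m * η).trans h0) hη0.le)]
          exact ⟨(le_div_iff₀ hη0).2 h0, (div_lt_iff₀ hη0).2 (by linarith)⟩
        simp only [hz, this]
        rw [← hover m _ ⟨by push_cast; linarith [ht.1], by push_cast; linarith⟩]
        congr 1
        push_cast; ring
  have hderiv : ∀ n : ℕ, ∀ t ∈ Ioo (n * η - η) (n * η + η), HasDerivAt z (v (z t)) t := by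
    intro n t ht
    rw [hzn n t ht]
    have h1 : HasDerivAt (fun t => γ (X n) (t - n * η)) (v (γ (X n) (t - n * η))) t :=
      (hγ (X n) (t - n * η) ⟨by linarith [ht.1], by linarith [ht.2]⟩).comp_sub_const t (n * η)
    exact h1.congr_of_eventuallyEq (by
      filter_upwards [Ioo_mem_nhds ht.1 ht.2] with s hs using hzn n s hs)
  refine ⟨η, hη0, z, ?_, fun t ht => ?_⟩
  · simp [hz, hγ0, hX]
  · have ht' : -η < t := ht
    refine hderiv ⌊t / η⌋₊ t ⟨?_, ?_⟩
    · rcases le_total 0 t with h | h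
      · have := Nat.floor_le (div_nonneg h hη0.le)
        rw [le_div_iff₀ hη0] at this
        linarith
      · rw [Nat.floor_of_nonpos (div_nonpos_of_nonpos_of_nonneg h hη0.le)]
        simpa using ht'
    · have := Nat.lt_floor_add_one (t / η)
      rw [div_lt_iff₀ hη0] at this
      linarith

/-- A globally Lipschitz autonomous equation has a solution on all of `ℝ` through every point. -/
theorem exists_integralCurve [CompleteSpace E] {v : E → E} {K : NNReal}
    (hv : LipschitzWith K v) (x : E) :
    ∃ z : ℝ → E, z 0 = x ∧ ∀ t, HasDerivAt z (v (z t)) t := by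
  obtain ⟨ε, hε, z, hz0, hz⟩ := exists_integralCurve_Ioi hv x
  obtain ⟨ε', hε', w, hw0, hw⟩ := exists_integralCurve_Ioi (v := fun y => -v y) hv.neg x
  have hw' : ∀ t < ε', HasDerivAt (fun t => w (-t)) (v (w (-t))) t := by
    intro t ht
    have := (hw (-t) (by simp only [mem_Ioi]; linarith)).scomp t (hasDerivAt_neg t)
    simpa [Function.comp_def] using this
  have hagree : EqOn z (fun t => w (-t)) (Ioo (-ε) ε') :=
    eqOn_of_integralCurves hv isOpen_Ioo ordConnected_Ioo (t₀ := 0) (fun t ht => hz t ht.1)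
      (fun t ht => hw' t ht.2) ⟨by linarith, hε'⟩ (by simp [hz0, hw0])
  refine ⟨fun t => if -ε < t then z t else w (-t), by simp [hε, hz0], fun t => ?_⟩
  by_cases ht : -ε < t
  · simp only [ht, if_true]
    exact (hz t ht).congr_of_eventuallyEq (by
      filter_upwards [Ioi_mem_nhds ht] with s hs
      simp only [mem_Ioi] at hs
      simp [hs])
  · simp only [ht, if_false]
    refine (hw' t (by linarith)).congr_of_eventuallyEq ?_
    filter_upwards [Iio_mem_nhds (show t < ε' by linarith)] with s hs
    split_ifs with h
    · exact hagree ⟨h, hs⟩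
    · rfl

end ODE

/-! ### Tame curvature functions and their planar fields -/

/-- A curvature function on all of `ℝ` for which the planar equation `ż = i z φ(|z|) - i` is
globally Lipschitz, and to which the results on periodic orbits apply. In applications `φ` agrees
with the given curvature function on the relevant range of radii. The value `φ 0 = 0` is
allowed. -/
structure Tame (φ : ℝ → ℝ) : Prop where
  lipschitz : ∃ K, LipschitzWith K φ
  eventually_const : ∃ b, 0 < b ∧ ∀ s, b ≤ s → φ s = φ b
  pos : ∀ s, 0 < s → 0 < φ s
  strictMonoOn : StrictMonoOn (fun s => s * φ s) (Ici 0)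

/-- The planar vector field `z ↦ i z φ(|z|) - i`. -/
noncomputable def field (φ : ℝ → ℝ) (z : ℂ) : ℂ := Complex.I * z * (φ ‖z‖ : ℂ) - Complex.I

lemma field_re (φ : ℝ → ℝ) (z : ℂ) : (field φ z).re = -(z.im * φ ‖z‖) := by
  simp [field]

lemma field_im (φ : ℝ → ℝ) (z : ℂ) : (field φ z).im = z.re * φ ‖z‖ - 1 := by
  simp [field]

lemma Tame.continuous {φ : ℝ → ℝ} (h : Tame φ) : Continuous φ :=
  h.lipschitz.choose_spec.continuous

lemma Tame.nonneg {φ : ℝ → ℝ} (h : Tame φ) {s : ℝ} (hs : 0 ≤ s) : 0 ≤ φ s := by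
  have : closure (Ioi (0 : ℝ)) ⊆ {s | 0 ≤ φ s} :=
    closure_minimal (fun s hs => (h.pos s hs).le)
      (isClosed_le continuous_const h.continuous)
  rw [closure_Ioi] at this
  exact this hs

lemma Tame.bounded {φ : ℝ → ℝ} (h : Tame φ) : ∃ M, 0 < M ∧ ∀ s, 0 ≤ s → |φ s| ≤ M := by
  obtain ⟨b, hb, hφ⟩ := h.eventually_const
  obtain ⟨M, hM⟩ := isCompact_Icc.exists_bound_of_continuousOn (h.continuous.continuousOn
    (s := Icc 0 b))
  refine ⟨max M 1, by positivity, fun s hs => ?_⟩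
  refine le_trans ?_ (le_max_left _ _)
  rcases le_total s b with hsb | hsb
  · exact hM s ⟨hs, hsb⟩
  · rw [hφ s hsb]
    exact hM b ⟨hb.le, le_rfl⟩

lemma Tame.lipschitz_field {φ : ℝ → ℝ} (h : Tame φ) : ∃ K, LipschitzWith K (field φ) := by
  obtain ⟨b, hb, hφ⟩ := h.eventually_const
  obtain ⟨L, hL⟩ := h.lipschitz
  obtain ⟨M, hM0, hM⟩ := h.bounded
  have key : ∀ z w : ℂ, ‖w‖ ≤ ‖z‖ → dist (field φ z) (field φ w) ≤ (M + b * L) * dist z w := by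
    intro z w hzw
    have e : field φ z - field φ w = Complex.I * ((z - w) * (φ ‖z‖ : ℂ)
        + w * ((φ ‖z‖ - φ ‖w‖ : ℝ) : ℂ)) := by
      simp only [field]; push_cast; ring
    rw [dist_eq_norm, e, norm_mul, Complex.norm_I, one_mul, dist_eq_norm]
    refine (norm_add_le _ _).trans ?_
    rw [norm_mul, norm_mul, Complex.norm_real, Complex.norm_real, add_mul]
    have h1 : ‖φ ‖z‖‖ ≤ M := hM _ (norm_nonneg _)
    have h2 : ‖w‖ * ‖φ ‖z‖ - φ ‖w‖‖ ≤ b * L * ‖z - w‖ := by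
      rcases le_total b ‖w‖ with hw | hw
      · rw [hφ _ hw, hφ _ (hw.trans hzw)]
        simp; positivity
      · have h3 := hL.dist_le_mul ‖z‖ ‖w‖
        rw [dist_eq_norm] at h3
        have h4 : dist ‖z‖ ‖w‖ ≤ ‖z - w‖ := by
          rw [Real.dist_eq]; exact abs_norm_sub_norm_le z w
        calc ‖w‖ * ‖φ ‖z‖ - φ ‖w‖‖ ≤ b * (L * ‖z - w‖) := by
              gcongr
              exact h3.trans (by gcongr)
          _ = b * L * ‖z - w‖ := by ring
    have h5 : ‖z - w‖ * ‖φ ‖z‖‖ ≤ M * ‖z - w‖ := by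
      rw [mul_comm]; gcongr
    linarith
  refine ⟨⟨M + b * L, by positivity⟩, LipschitzWith.of_dist_le_mul fun z w => ?_⟩
  rcases le_total ‖w‖ ‖z‖ with hzw | hzw
  · exact key z w hzw
  · rw [dist_comm, dist_comm z]
    exact key w z hzw

/-- The function `s φ(s)` attains every positive value. -/
lemma Tame.exists_mul_eq {φ : ℝ → ℝ} (h : Tame φ) {v : ℝ} (hv : 0 < v) :
    ∃ s, 0 < s ∧ s * φ s = v := by
  obtain ⟨b, hb, hφ⟩ := h.eventually_const
  have hb' := h.pos b hb
  set B := max b (v / φ b)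
  have hB : v ≤ B * φ B := by
    rw [hφ B (le_max_left _ _)]
    calc v = v / φ b * φ b := by field_simp
      _ ≤ _ := by gcongr; exact le_max_right _ _
  have hB0 : 0 ≤ B := hb.le.trans (le_max_left _ _)
  obtain ⟨s, hs, hsv⟩ := intermediate_value_Icc hB0
    ((continuous_id.mul h.continuous).continuousOn (s := Icc 0 B))
    (show v ∈ Icc _ _ from ⟨by simpa using hv.le, hB⟩)
  simp only [Pi.mul_apply, id] at hsv
  refine ⟨s, lt_of_le_of_ne hs.1 ?_, hsv⟩
  rintro rfl
  simp at hsv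
  linarith

/-- The radius of the fixed point of the planar field. -/
noncomputable def Tame.radius {φ : ℝ → ℝ} (h : Tame φ) : ℝ :=
  (h.exists_mul_eq one_pos).choose

lemma Tame.radius_pos {φ : ℝ → ℝ} (h : Tame φ) : 0 < h.radius :=
  (h.exists_mul_eq one_pos).choose_spec.1

lemma Tame.radius_mul {φ : ℝ → ℝ} (h : Tame φ) : h.radius * φ h.radius = 1 :=
  (h.exists_mul_eq one_pos).choose_spec.2

/-- A curvature function that is Lipschitz on the positive part of `[a, b]` agrees there with a
tame one. For `a = 0` this needs a Lipschitz bound up to the origin. -/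
theorem exists_tame {f : ℝ → ℝ} (hpos : ∀ s, 0 < s → 0 < f s)
    (hmono : StrictMonoOn (fun s => s * f s) (Ioi 0)) {a b : ℝ} (ha : 0 ≤ a) (hab : a < b)
    {K : NNReal} (hK : LipschitzOnWith K f (Icc a b ∩ Ioi 0)) :
    ∃ φ, Tame φ ∧ EqOn φ f (Icc a b ∩ Ioi 0) := by
  obtain ⟨g, hg, hgf⟩ := hK.extend_real
  set cl : ℝ → ℝ := fun s => max a (min s b) with hcl
  have hcl_lip : LipschitzWith 1 cl := (LipschitzWith.id.min_const b).const_max a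
  have hcl_mem : ∀ s, cl s ∈ Icc a b := fun s =>
    ⟨le_max_left _ _, max_le hab.le (min_le_right _ _)⟩
  have hcl_pos : ∀ s, 0 < s → 0 < cl s := fun s hs =>
    lt_of_lt_of_le (lt_min hs (ha.trans_lt hab)) (le_max_right _ _)
  have hval : ∀ s, 0 < s → g (cl s) = f (cl s) := fun s hs =>
    (hgf ⟨hcl_mem s, hcl_pos s hs⟩).symm
  have hp : ∀ s, 0 < s → 0 < g (cl s) := fun s hs => by
    rw [hval s hs]; exact hpos _ (hcl_pos s hs)
  refine ⟨fun s => g (cl s), ⟨⟨_, hg.comp hcl_lip⟩, ⟨b, ha.trans_lt hab, fun s hs => ?_⟩, hp, ?_⟩,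
    ?_⟩
  · simp only [hcl, min_eq_right hs, min_self]
  · intro x hx y hy hxy
    have hx0 : (0 : ℝ) ≤ x := hx
    have hy0 : 0 < y := hx0.trans_lt hxy
    simp only
    rcases hx0.eq_or_lt with rfl | hx0
    · rw [zero_mul]
      exact mul_pos hy0 (hp y hy0)
    have hle : cl x ≤ cl y := max_le_max le_rfl (min_le_min hxy.le le_rfl)
    rcases hle.eq_or_lt with he | hlt
    · rw [he]
      exact mul_lt_mul_of_pos_right hxy (hp y hy0)
    · have h1 : x ≤ cl x := by
        by_contra! hcon
        have h2 : b ≤ cl x := by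
          by_contra! hb
          simp only [hcl] at hb hcon
          rcases le_total x b with h | h
          · rw [min_eq_left h] at hcon
            exact absurd (le_max_right a x) (not_le.2 hcon)
          · rw [min_eq_right h] at hb
            exact absurd (le_max_right a b) (not_le.2 hb)
        linarith [(hcl_mem y).2]
      have h2 : cl y ≤ y := by
        by_contra! hcon
        have h2 : cl y ≤ a := by
          by_contra! hb
          simp only [hcl] at hb hcon
          rcases lt_max_iff.1 hb with h | h
          · exact absurd h (lt_irrefl _)
          · rw [max_eq_right h.le] at hcon
            exact absurd (min_le_left y b) (not_le.2 hcon)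
        linarith [(hcl_mem x).1]
      rw [hval x hx0, hval y hy0]
      have h3 := hmono (hcl_pos x hx0) (hcl_pos y hy0) hlt
      simp only at h3
      have h4 := hpos _ (hcl_pos x hx0)
      have h5 := hpos _ (hcl_pos y hy0)
      nlinarith
  · intro s hs
    have : cl s = s := by simp only [hcl, min_eq_left hs.1.2, max_eq_right hs.1.1]
    simp only [this]
    exact (hgf hs).symm

lemma hasDerivAt_re {z : ℝ → ℂ} {z' : ℂ} {t : ℝ} (h : HasDerivAt z z' t) :
    HasDerivAt (fun t => (z t).re) z'.re t :=
  Complex.reCLM.hasFDerivAt.comp_hasDerivAt t h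

lemma hasDerivAt_im {z : ℝ → ℂ} {z' : ℂ} {t : ℝ} (h : HasDerivAt z z' t) :
    HasDerivAt (fun t => (z t).im) z'.im t :=
  Complex.imCLM.hasFDerivAt.comp_hasDerivAt t h

/-! ### The conserved energy -/

/-- The energy `∫₀^{|z|} s φ(s) ds - Re z`, written with the variable `u = s²` to make its
differentiability at the origin evident. -/
noncomputable def energy (φ : ℝ → ℝ) (z : ℂ) : ℝ :=
  (1 / 2) * (∫ u in (0 : ℝ)..(z.re ^ 2 + z.im ^ 2), φ (√u)) - z.re

/-- The differential of the energy at `z`, applied to `w`. -/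
noncomputable def energyDiff (φ : ℝ → ℝ) (z w : ℂ) : ℝ :=
  (z.re * φ ‖z‖ - 1) * w.re + z.im * φ ‖z‖ * w.im

lemma norm_eq_sqrt_re_im (z : ℂ) : ‖z‖ = √(z.re ^ 2 + z.im ^ 2) := by
  rw [Complex.norm_def, Complex.normSq_apply]; congr 1; ring

lemma norm_sq_re_im (z : ℂ) : ‖z‖ ^ 2 = z.re ^ 2 + z.im ^ 2 := by
  rw [Complex.sq_norm, Complex.normSq_apply]; ring

lemma norm_real_eq (x : ℝ) : ‖(x : ℂ)‖ = |x| := by simp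

lemma hasDerivAt_energy {φ : ℝ → ℝ} (hφ : Continuous φ) {z : ℝ → ℂ} {z' : ℂ} {t : ℝ}
    (h : HasDerivAt z z' t) : HasDerivAt (fun t => energy φ (z t)) (energyDiff φ (z t) z') t := by
  have h1 := hasDerivAt_re h
  have h2 := hasDerivAt_im h
  have h3 : HasDerivAt (fun t => (z t).re ^ 2 + (z t).im ^ 2)
      (2 * (z t).re * z'.re + 2 * (z t).im * z'.im) t := by
    refine ((h1.fun_pow 2).fun_add (h2.fun_pow 2)).congr_deriv ?_
    push_cast; ring
  have hc : Continuous fun u => φ (√u) := hφ.comp Real.continuous_sqrt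
  have h4 := intervalIntegral.integral_hasDerivAt_right
    (hc.intervalIntegrable 0 ((z t).re ^ 2 + (z t).im ^ 2))
    (hc.stronglyMeasurableAtFilter _ _) hc.continuousAt
  refine (((h4.comp t h3).const_mul (1 / 2)).fun_sub h1).congr_deriv ?_
  rw [energyDiff, norm_eq_sqrt_re_im]
  ring

lemma energyDiff_smul (φ : ℝ → ℝ) (z w : ℂ) (r : ℝ) :
    energyDiff φ z (r * w) = r * energyDiff φ z w := by
  simp [energyDiff]; ring

/-- The gradient of the energy is strictly monotone. -/
lemma Tame.energyDiff_lt {φ : ℝ → ℝ} (hφ : Tame φ) {z w : ℂ} (hzw : z ≠ w) :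
    energyDiff φ z (w - z) < energyDiff φ w (w - z) := by
  have hi : energyDiff φ w (w - z) - energyDiff φ z (w - z) =
      ‖z‖ ^ 2 * φ ‖z‖ + ‖w‖ ^ 2 * φ ‖w‖ - (z.re * w.re + z.im * w.im) * (φ ‖z‖ + φ ‖w‖) := by
    rw [norm_sq_re_im, norm_sq_re_im, energyDiff, energyDiff, Complex.sub_re, Complex.sub_im]
    ring
  have hz := hφ.nonneg (norm_nonneg z)
  have hw := hφ.nonneg (norm_nonneg w)
  have hcs : z.re * w.re + z.im * w.im ≤ ‖z‖ * ‖w‖ := by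
    apply le_of_sq_le_sq _ (by positivity)
    rw [mul_pow, norm_sq_re_im, norm_sq_re_im]
    nlinarith [sq_nonneg (z.re * w.im - z.im * w.re)]
  rw [← sub_pos, hi]
  rcases eq_or_ne ‖z‖ ‖w‖ with he | hne
  · have hpos : 0 < ‖w‖ := by
      rw [norm_pos_iff]
      rintro rfl
      simp at he
      exact hzw he
    have h1 := hφ.pos _ hpos
    have h2 : 0 < (z.re - w.re) ^ 2 + (z.im - w.im) ^ 2 := by
      have := norm_sq_re_im (z - w)
      rw [Complex.sub_re, Complex.sub_im] at this
      rw [← this]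
      have := norm_pos_iff.2 (sub_ne_zero.2 hzw)
      positivity
    have h3 := norm_sq_re_im z
    have h4 := norm_sq_re_im w
    rw [he] at h3 ⊢
    have : 0 < ‖w‖ ^ 2 - (z.re * w.re + z.im * w.im) := by nlinarith
    nlinarith
  · have h0 : 0 < (‖z‖ - ‖w‖) * (‖z‖ * φ ‖z‖ - ‖w‖ * φ ‖w‖) := by
      rcases lt_or_gt_of_ne hne with h | h
      · have := hφ.strictMonoOn (mem_Ici.2 (norm_nonneg z)) (mem_Ici.2 (norm_nonneg w)) h
        simp only at this
        nlinarith
      · have := hφ.strictMonoOn (mem_Ici.2 (norm_nonneg w)) (mem_Ici.2 (norm_nonneg z)) h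
        simp only at this
        nlinarith
    nlinarith [mul_le_mul_of_nonneg_right hcs (add_nonneg hz hw)]

/-- Strict convexity of the energy, as the strict gradient inequality. -/
lemma Tame.energyDiff_lt_sub {φ : ℝ → ℝ} (hφ : Tame φ) {z w : ℂ} (hzw : z ≠ w) :
    energyDiff φ z (w - z) < energy φ w - energy φ z := by
  set γ : ℝ → ℂ := fun t => z + t * (w - z) with hγ
  have hγ' : ∀ t : ℝ, HasDerivAt γ (w - z) t := by
    intro t
    have := ((hasDerivAt_id t).ofReal_comp.mul_const (w - z)).const_add z
    simpa [hγ] using this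
  have hE : ∀ t : ℝ, HasDerivAt (fun t => energy φ (γ t)) (energyDiff φ (γ t) (w - z)) t :=
    fun t => hasDerivAt_energy hφ.continuous (hγ' t)
  obtain ⟨ξ, hξ, hmv⟩ := exists_hasDerivAt_eq_slope (fun t => energy φ (γ t)) _ one_pos
    (fun t _ => (hE t).continuousAt.continuousWithinAt) (fun t _ => hE t)
  have h1 : γ 1 = w := by simp [hγ]
  have h0 : γ 0 = z := by simp [hγ]
  simp only [h1, h0, sub_zero, div_one] at hmv
  rw [← hmv]
  have hne : z ≠ γ ξ := by
    intro h
    have : (ξ : ℂ) * (w - z) = 0 := by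
      simpa [hγ] using h
    rcases mul_eq_zero.1 this with h | h
    · exact hξ.1.ne' (by exact_mod_cast h)
    · exact hzw (sub_eq_zero.1 h).symm
  have := hφ.energyDiff_lt hne
  rw [show γ ξ - z = ξ * (w - z) by simp [hγ], energyDiff_smul, energyDiff_smul] at this
  exact lt_of_mul_lt_mul_left this hξ.1.le

lemma Tame.energyDiff_radius {φ : ℝ → ℝ} (hφ : Tame φ) (w : ℂ) :
    energyDiff φ hφ.radius w = 0 := by
  have := hφ.radius_mul
  simp [energyDiff, abs_of_pos hφ.radius_pos, this]

lemma Tame.energy_radius_lt {φ : ℝ → ℝ} (hφ : Tame φ) {z : ℂ} (hz : z ≠ hφ.radius) :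
    energy φ hφ.radius < energy φ z := by
  have := hφ.energyDiff_lt_sub hz.symm
  rw [hφ.energyDiff_radius] at this
  linarith

lemma Tame.energy_radius_le {φ : ℝ → ℝ} (hφ : Tame φ) (z : ℂ) :
    energy φ hφ.radius ≤ energy φ z := by
  by_cases h : z = hφ.radius
  · rw [h]
  · exact (hφ.energy_radius_lt h).le

/-- Along the real axis, the equilibrium separates the points where the energy decreases from
those where it increases. -/
lemma Tame.mul_sub_one_neg {φ : ℝ → ℝ} (hφ : Tame φ) {x : ℝ} (hx : x < hφ.radius) :
    x * φ |x| - 1 < 0 := by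
  rcases le_total x 0 with h | h
  · have := hφ.nonneg (abs_nonneg x)
    nlinarith
  · rw [abs_of_nonneg h]
    have := hφ.strictMonoOn (mem_Ici.2 h) (mem_Ici.2 hφ.radius_pos.le) hx
    simp only [hφ.radius_mul] at this
    linarith

lemma Tame.mul_sub_one_pos {φ : ℝ → ℝ} (hφ : Tame φ) {x : ℝ} (hx : hφ.radius < x) :
    0 < x * φ |x| - 1 := by
  have h := hφ.radius_pos.trans hx
  rw [abs_of_pos h]
  have := hφ.strictMonoOn (mem_Ici.2 hφ.radius_pos.le) (mem_Ici.2 h.le) hx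
  simp only [hφ.radius_mul] at this
  linarith

lemma Tame.energy_real_strictAnti {φ : ℝ → ℝ} (hφ : Tame φ) {x y : ℝ} (hxy : x < y)
    (hy : y ≤ hφ.radius) : energy φ y < energy φ x := by
  have h := hφ.energyDiff_lt_sub (z := (y : ℂ)) (w := (x : ℂ)) (by exact_mod_cast hxy.ne')
  have h2 : y * φ |y| - 1 ≤ 0 := by
    rcases hy.eq_or_lt with rfl | hy
    · rw [abs_of_pos hφ.radius_pos, hφ.radius_mul]; simp
    · exact (hφ.mul_sub_one_neg hy).le
  simp only [energyDiff, norm_real_eq, Complex.ofReal_re, Complex.ofReal_im, Complex.sub_re,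
    Complex.sub_im, sub_zero, mul_zero, add_zero] at h
  nlinarith

lemma Tame.energy_real_strictMono {φ : ℝ → ℝ} (hφ : Tame φ) {x y : ℝ} (hxy : x < y)
    (hx : hφ.radius ≤ x) : energy φ x < energy φ y := by
  have h := hφ.energyDiff_lt_sub (z := (x : ℂ)) (w := (y : ℂ)) (by exact_mod_cast hxy.ne)
  have h2 : 0 ≤ x * φ |x| - 1 := by
    rcases hx.eq_or_lt with rfl | hx
    · rw [abs_of_pos hφ.radius_pos, hφ.radius_mul]; simp
    · exact (hφ.mul_sub_one_pos hx).le
  simp only [energyDiff, norm_real_eq, Complex.ofReal_re, Complex.ofReal_im, Complex.sub_re,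
    Complex.sub_im, sub_zero, mul_zero, add_zero] at h
  nlinarith

/-- Among the points of a circle about the origin, the energy is least on the positive real
axis. -/
lemma energy_norm_le (φ : ℝ → ℝ) (z : ℂ) : energy φ (‖z‖ : ℝ) ≤ energy φ z := by
  have h := norm_sq_re_im z
  have := Complex.re_le_norm z
  simp only [energy, Complex.ofReal_re, Complex.ofReal_im, h]
  norm_num
  linarith

lemma energy_le_neg_norm (φ : ℝ → ℝ) (z : ℂ) : energy φ z ≤ energy φ ((-‖z‖ : ℝ) : ℂ) := by
  have h := norm_sq_re_im z
  have := (abs_le.1 (Complex.abs_re_le_norm z)).1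
  simp only [energy, Complex.ofReal_re, Complex.ofReal_im, neg_sq, h]
  norm_num
  linarith

/-- The energy grows at least linearly: beyond the radius `r` with `r φ(r) = 2` it lies above
its supporting planes on the circle of radius `r`, which have slope at least `1`. -/
lemma Tame.exists_norm_le {φ : ℝ → ℝ} (hφ : Tame φ) :
    ∃ r, ∀ z : ℂ, ‖z‖ ≤ energy φ z - energy φ hφ.radius + r := by
  obtain ⟨r, hr, hr2⟩ := hφ.exists_mul_eq (v := 2) two_pos
  refine ⟨r, fun z => ?_⟩
  have h0 := hφ.energy_radius_le z
  rcases le_or_gt ‖z‖ r with h | h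
  · linarith
  have hr0 : hφ.radius < r := by
    by_contra! hcon
    have := hφ.strictMonoOn.monotoneOn (mem_Ici.2 hr.le) (mem_Ici.2 hφ.radius_pos.le) hcon
    simp only [hφ.radius_mul, hr2] at this
    linarith
  have h1 := hφ.energyDiff_lt_sub (z := (r : ℂ)) (w := (‖z‖ : ℝ)) (by exact_mod_cast h.ne)
  simp only [energyDiff, norm_real_eq, Complex.ofReal_re, Complex.ofReal_im, Complex.sub_re,
    Complex.sub_im, sub_zero, mul_zero, add_zero, abs_of_pos hr, hr2] at h1
  have h2 := energy_norm_le φ z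
  have h3 := hφ.energy_real_strictMono hr0 le_rfl
  linarith

lemma continuous_energy {φ : ℝ → ℝ} (hφ : Continuous φ) : Continuous (energy φ) := by
  have hc : Continuous fun u => φ (√u) := hφ.comp Real.continuous_sqrt
  have h1 : Continuous fun x => ∫ u in (0 : ℝ)..x, φ (√u) :=
    intervalIntegral.continuous_primitive (fun a b => hc.intervalIntegrable a b) 0
  unfold energy
  exact (continuous_const.mul (h1.comp (by fun_prop))).sub Complex.continuous_re

/-- `z` is an integral curve, defined for all time, of the planar field of `φ`. -/
def IsPlanarFlow (φ : ℝ → ℝ) (z : ℝ → ℂ) : Prop := ∀ t, HasDerivAt z (field φ (z t)) t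

lemma energyDiff_field (φ : ℝ → ℝ) (z : ℂ) : energyDiff φ z (field φ z) = 0 := by
  rw [energyDiff, field_re, field_im]; ring

lemma IsPlanarFlow.energy_eq {φ : ℝ → ℝ} (hφ : Tame φ) {z : ℝ → ℂ} (hz : IsPlanarFlow φ z)
    (s t : ℝ) : energy φ (z s) = energy φ (z t) :=
  is_const_of_deriv_eq_zero
    (fun t => (hasDerivAt_energy hφ.continuous (hz t)).differentiableAt)
    (fun t => by rw [(hasDerivAt_energy hφ.continuous (hz t)).deriv, energyDiff_field]) s t

lemma IsPlanarFlow.continuous {φ : ℝ → ℝ} {z : ℝ → ℂ} (hz : IsPlanarFlow φ z) : Continuous z :=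
  continuous_iff_continuousAt.2 fun t => (hz t).continuousAt

lemma IsPlanarFlow.hasDerivAt_re {φ : ℝ → ℝ} {z : ℝ → ℂ} (hz : IsPlanarFlow φ z) (t : ℝ) :
    HasDerivAt (fun t => (z t).re) (-((z t).im * φ ‖z t‖)) t := by
  rw [← field_re]; exact RadialCurvature.hasDerivAt_re (hz t)

lemma IsPlanarFlow.hasDerivAt_im {φ : ℝ → ℝ} {z : ℝ → ℂ} (hz : IsPlanarFlow φ z) (t : ℝ) :
    HasDerivAt (fun t => (z t).im) ((z t).re * φ ‖z t‖ - 1) t := by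
  rw [← field_im]; exact RadialCurvature.hasDerivAt_im (hz t)

/-- A function whose derivative is at least `δ` on `[a, ∞)` grows at least linearly there. -/
lemma linear_growth {g g' : ℝ → ℝ} {a δ : ℝ} (hg : ∀ t, a ≤ t → HasDerivAt g (g' t) t)
    (hδ : ∀ t, a ≤ t → δ ≤ g' t) {t : ℝ} (ht : a ≤ t) : g a + δ * (t - a) ≤ g t := by
  have hd : ∀ t, a ≤ t → HasDerivAt (fun t => g t - δ * t) (g' t - δ) t := fun t ht => by
    simpa using (hg t ht).fun_sub ((hasDerivAt_id t).const_mul δ)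
  have hm : MonotoneOn (fun t => g t - δ * t) (Ici a) := by
    refine monotoneOn_of_hasDerivWithinAt_nonneg (f' := fun t => g' t - δ) (convex_Ici a)
      (fun t ht => (hd t ht).continuousAt.continuousWithinAt)
      (fun t ht => (hd t (interior_subset ht)).hasDerivWithinAt) (fun t ht => ?_)
    linarith [hδ t (interior_subset ht)]
  have := hm (mem_Ici.2 le_rfl) ht ht
  simp only at this
  linarith

/-- An orbit that starts on the real axis to the left of the equilibrium cannot stay in the lower
half-plane: its angular velocity about the equilibrium would force it towards the real axis on
the right of the equilibrium, where the field points upwards. -/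
lemma IsPlanarFlow.exists_im_nonneg {φ : ℝ → ℝ} (hφ : Tame φ) {z : ℝ → ℂ}
    (hz : IsPlanarFlow φ z) {p : ℝ} (hp : p < hφ.radius) (h0 : z 0 = p) :
    ∃ t, 0 < t ∧ 0 ≤ (z t).im := by
  by_contra! hneg
  set s₀ := hφ.radius with hs₀
  have hs₀pos : 0 < s₀ := hφ.radius_pos
  set m := energy φ p - energy φ s₀ with hm
  have hm0 : 0 < m := sub_pos.2 (hφ.energy_radius_lt (by exact_mod_cast hp.ne))
  have hE : ∀ t, energy φ (z t) - energy φ s₀ = m := fun t => by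
    rw [hz.energy_eq hφ t 0, h0]
  obtain ⟨r, hr⟩ := hφ.exists_norm_le
  set R := max (m + r) 1 with hR
  have hR0 : 0 < R := by positivity
  have hzR : ∀ t, ‖z t‖ ≤ R := fun t => by
    have := hr (z t)
    rw [← hs₀, hE t] at this
    exact this.trans (le_max_left _ _)
  obtain ⟨M, hM0, hM⟩ := hφ.bounded
  -- the gradient inequality at `z t`, tested against the equilibrium
  have hgrad : ∀ t, m ≤ ((z t).re * φ ‖z t‖ - 1) * ((z t).re - s₀) +
      (z t).im * φ ‖z t‖ * (z t).im := by
    intro t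
    have hne : z t ≠ s₀ := by
      intro h
      have := hE t
      rw [h] at this
      linarith
    have h1 := hφ.energyDiff_lt_sub hne
    have h2 := hE t
    simp only [energyDiff, Complex.sub_re, Complex.sub_im, Complex.ofReal_re,
      Complex.ofReal_im] at h1
    linarith
  have hy : ∀ t, 1 ≤ t → (z t).im < 0 := fun t ht => hneg t (by linarith)
  set q : ℝ → ℝ := fun t => ((z t).re - s₀) / (-(z t).im) with hq
  set q' : ℝ → ℝ := fun t => (((z t).re * φ ‖z t‖ - 1) * ((z t).re - s₀) +
      (z t).im * φ ‖z t‖ * (z t).im) / (z t).im ^ 2 with hq'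
  have hqd : ∀ t, 1 ≤ t → HasDerivAt q (q' t) t := by
    intro t ht
    have := ((hz.hasDerivAt_re t).sub_const s₀).fun_div (hz.hasDerivAt_im t).fun_neg
      (neg_ne_zero.2 (hy t ht).ne)
    refine this.congr_deriv ?_
    simp only [hq']
    rw [neg_sq]
    congr 1
    ring
  have hyR : ∀ t, (z t).im ^ 2 ≤ R ^ 2 := fun t => by
    have := norm_sq_re_im (z t)
    have h2 : ‖z t‖ ^ 2 ≤ R ^ 2 := pow_le_pow_left₀ (norm_nonneg _) (hzR t) 2
    nlinarith [sq_nonneg (z t).re]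
  have hqδ : ∀ t, 1 ≤ t → m / R ^ 2 ≤ q' t := by
    intro t ht
    have hypos : 0 < (z t).im ^ 2 := by nlinarith [hy t ht]
    calc m / R ^ 2 ≤ m / (z t).im ^ 2 := div_le_div_of_nonneg_left hm0.le hypos (hyR t)
      _ ≤ q' t := by
          simp only [hq']
          gcongr
          exact hgrad t
  -- from some time on `-Im z ≤ η (Re z - s₀)`, with `η` as small as desired
  set A := R + s₀ with hA
  have hA0 : 0 < A := by positivity
  have hxA : ∀ t, |(z t).re - s₀| ≤ A := fun t => by
    have h1 := (Complex.abs_re_le_norm (z t)).trans (hzR t)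
    rw [abs_le] at h1 ⊢
    constructor <;> linarith
  obtain ⟨Q, hQ0, hQ⟩ : ∃ Q : ℝ, 0 < Q ∧ M * (A / Q) ^ 2 ≤ m / 2 := by
    refine ⟨A * (2 * M / m + 1), by positivity, ?_⟩
    have h1 : A / (A * (2 * M / m + 1)) = 1 / (2 * M / m + 1) := by field_simp
    have h2 : 0 < 2 * M / m := by positivity
    rw [h1]
    have h3 : (1 / (2 * M / m + 1)) ^ 2 ≤ 1 / (2 * M / m + 1) := by
      rw [pow_two]
      have : 1 / (2 * M / m + 1) ≤ 1 := by rw [div_le_one (by positivity)]; linarith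
      have h4 : 0 ≤ 1 / (2 * M / m + 1) := by positivity
      nlinarith
    have h4 : 1 / (2 * M / m + 1) ≤ 1 / (2 * M / m) := by gcongr; linarith
    calc M * (1 / (2 * M / m + 1)) ^ 2 ≤ M * (1 / (2 * M / m)) := by gcongr; linarith
      _ = m / 2 := by field_simp
  obtain ⟨t₁, ht₁, hqQ⟩ : ∃ t₁, 1 ≤ t₁ ∧ ∀ t, t₁ ≤ t → Q ≤ q t := by
    have hδ : 0 < m / R ^ 2 := by positivity
    refine ⟨1 + |Q - q 1| / (m / R ^ 2), by simp; positivity, fun t ht => ?_⟩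
    have h1 : 1 ≤ t := le_trans (by simp; positivity) ht
    have := linear_growth hqd hqδ h1
    have h2 : |Q - q 1| ≤ m / R ^ 2 * (t - 1) := by
      rw [mul_comm, ← div_le_iff₀ hδ]; linarith
    linarith [le_abs_self (Q - q 1)]
  have hfinal : ∀ t, t₁ ≤ t → m / (2 * A) ≤ (z t).re * φ ‖z t‖ - 1 := by
    intro t ht
    have hyt := hy t (ht₁.trans ht)
    have h1 := hqQ t ht
    simp only [hq] at h1
    rw [le_div_iff₀ (by linarith)] at h1
    have hx0 : 0 < (z t).re - s₀ := lt_of_lt_of_le (by nlinarith) h1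
    have hxle := (abs_le.1 (hxA t)).2
    have h2 : -(z t).im ≤ A / Q := by
      rw [le_div_iff₀ hQ0]; linarith
    have h3 : (z t).im ^ 2 ≤ (A / Q) ^ 2 := by
      rw [← neg_sq]; exact pow_le_pow_left₀ (by linarith) h2 2
    have h4 : (z t).im * φ ‖z t‖ * (z t).im ≤ m / 2 := by
      have h5 := (abs_le.1 (hM ‖z t‖ (norm_nonneg _))).2
      calc (z t).im * φ ‖z t‖ * (z t).im = φ ‖z t‖ * (z t).im ^ 2 := by ring
        _ ≤ M * (A / Q) ^ 2 := by gcongr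
        _ ≤ _ := hQ
    have h5 : m / 2 ≤ ((z t).re * φ ‖z t‖ - 1) * ((z t).re - s₀) := by
      linarith [hgrad t]
    have h6 : 0 < (z t).re * φ ‖z t‖ - 1 := by
      by_contra! hcon
      nlinarith
    rw [div_le_iff₀ (by positivity)]
    nlinarith
  have hδ : 0 < m / (2 * A) := by positivity
  set t₂ := t₁ + |(z t₁).im| / (m / (2 * A)) with ht₂
  have h12 : t₁ ≤ t₂ := by
    simp only [ht₂]
    linarith [show 0 ≤ |(z t₁).im| / (m / (2 * A)) by positivity]
  have := linear_growth (fun t _ => hz.hasDerivAt_im t) hfinal h12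
  have h3 : m / (2 * A) * (t₂ - t₁) = |(z t₁).im| := by
    simp only [ht₂]; field_simp; ring
  rw [h3] at this
  linarith [neg_abs_le (z t₁).im, hy t₂ (ht₁.trans h12)]

/-! ### Periodic orbits of the planar flow -/

lemma IsPlanarFlow.shift {φ : ℝ → ℝ} {z : ℝ → ℂ} (hz : IsPlanarFlow φ z) (τ : ℝ) :
    IsPlanarFlow φ (fun t => z (t + τ)) :=
  fun t => (hz (t + τ)).comp_add_const t τ

lemma field_conj (φ : ℝ → ℝ) (z : ℂ) :
    field φ ((starRingEnd ℂ) z) = -(starRingEnd ℂ) (field φ z) := by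
  apply Complex.ext <;> simp [field_re, field_im]

lemma hasDerivAt_conj {z : ℝ → ℂ} {z' : ℂ} {t : ℝ} (h : HasDerivAt z z' t) :
    HasDerivAt (fun t => (starRingEnd ℂ) (z t)) ((starRingEnd ℂ) z') t :=
  Complex.conjCLE.toContinuousLinearMap.hasFDerivAt.comp_hasDerivAt t h

/-- The planar flow is reversed by complex conjugation. -/
lemma IsPlanarFlow.reverse {φ : ℝ → ℝ} {z : ℝ → ℂ} (hz : IsPlanarFlow φ z) :
    IsPlanarFlow φ (fun t => (starRingEnd ℂ) (z (-t))) := by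
  intro t
  have h1 : HasDerivAt (fun t => z (-t)) (-field φ (z (-t))) t := by
    simpa [Function.comp_def] using (hz (-t)).scomp t (hasDerivAt_neg t)
  have h2 := hasDerivAt_conj h1
  simp only [field_conj]
  simpa using h2

lemma IsPlanarFlow.eq_of_eq {φ : ℝ → ℝ} (hφ : Tame φ) {z w : ℝ → ℂ} (hz : IsPlanarFlow φ z)
    (hw : IsPlanarFlow φ w) {t : ℝ} (h : z t = w t) : z = w :=
  eq_of_integralCurves hφ.lipschitz_field.choose_spec hz hw h

/-- `z` is the orbit of the planar flow through a real point `p` on the left of the equilibrium,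
and `S` is the first time at which it returns to the real axis. -/
structure IsOrbit (φ : ℝ → ℝ) (z : ℝ → ℂ) (p S : ℝ) : Prop where
  tame : Tame φ
  flow : IsPlanarFlow φ z
  map_zero : z 0 = p
  lt_radius : p < tame.radius
  pos : 0 < S
  im_neg : ∀ t ∈ Ioo 0 S, (z t).im < 0
  im_half : (z S).im = 0
  radius_lt : tame.radius < (z S).re

lemma IsPlanarFlow.isOrbit {φ : ℝ → ℝ} (hφ : Tame φ) {z : ℝ → ℂ}
    (hz : IsPlanarFlow φ z) {p : ℝ} (hp : p < hφ.radius) (h0 : z 0 = p) :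
    ∃ S, IsOrbit φ z p S := by
  obtain ⟨t₁, ht₁, h1⟩ := hz.exists_im_nonneg hφ hp h0
  have hyc : Continuous fun t => (z t).im := Complex.continuous_im.comp hz.continuous
  -- initially the orbit enters the lower half-plane
  have hd0 : HasDerivAt (fun t => (z t).im) (p * φ |p| - 1) 0 := by
    have := hz.hasDerivAt_im 0
    simpa [h0] using this
  obtain ⟨ε, hε, hneg⟩ : ∃ ε > 0, ∀ t ∈ Ioo 0 ε, (z t).im < 0 := by
    have h := hd0.tendsto_slope.eventually_lt_const (hφ.mul_sub_one_neg hp)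
    rw [eventually_nhdsWithin_iff] at h
    obtain ⟨ε, hε, hb⟩ := Metric.eventually_nhds_iff.1 h
    refine ⟨ε, hε, fun t ht => ?_⟩
    have := hb (y := t) (by rw [Real.dist_eq, sub_zero, abs_of_pos ht.1]; exact ht.2) ht.1.ne'
    rw [slope_def_field, h0, Complex.ofReal_im, sub_zero, sub_zero, div_lt_iff₀ ht.1,
      zero_mul] at this
    exact this
  set A : Set ℝ := {t | ε / 2 ≤ t ∧ 0 ≤ (z t).im} with hA
  have hAc : IsClosed A := (isClosed_le continuous_const continuous_id).inter
    (isClosed_le continuous_const hyc)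
  have hεt : ε ≤ t₁ := by
    by_contra! h
    exact absurd h1 (not_le.2 (hneg t₁ ⟨ht₁, h⟩))
  have hAne : A.Nonempty := ⟨t₁, by linarith, h1⟩
  have hAb : BddBelow A := ⟨ε / 2, fun t ht => ht.1⟩
  have hS := hAc.csInf_mem hAne hAb
  set S := sInf A
  have hεS : ε ≤ S := by
    by_contra! h
    exact absurd hS.2 (not_le.2 (hneg S ⟨by linarith [hS.1], h⟩))
  have hS0 : 0 < S := hε.trans_le hεS
  have himneg : ∀ t ∈ Ioo 0 S, (z t).im < 0 := by
    intro t ht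
    rcases lt_or_ge t ε with h | h
    · exact hneg t ⟨ht.1, h⟩
    · by_contra! hcon
      exact absurd (csInf_le hAb (show t ∈ A from ⟨by linarith, hcon⟩)) (not_le.2 ht.2)
  have himS : (z S).im = 0 := by
    refine le_antisymm ?_ hS.2
    have h2 : closure (Ioo 0 S) ⊆ {t | (z t).im ≤ 0} :=
      closure_minimal (fun t ht => (himneg t ht).le) (isClosed_le hyc continuous_const)
    rw [closure_Ioo hS0.ne] at h2
    exact h2 ⟨hS0.le, le_rfl⟩
  refine ⟨S, hφ, hz, h0, hp, hS0, himneg, himS, ?_⟩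
  -- at the return time the field does not point downwards, so the point is not on the left
  by_contra! hle
  have hreal : z S = ((z S).re : ℂ) := by
    apply Complex.ext <;> simp [himS]
  have hlt : (z S).re < hφ.radius := by
    refine lt_of_le_of_ne hle fun h => ?_
    have h3 := hz.energy_eq hφ S 0
    rw [hreal, h, h0] at h3
    exact absurd h3 (hφ.energy_radius_lt (by exact_mod_cast hp.ne)).ne
  have hdS : HasDerivAt (fun t => (z t).im) ((z S).re * φ |(z S).re| - 1) S := by
    have := hz.hasDerivAt_im S
    rwa [hreal, norm_real_eq, Complex.ofReal_re] at this
  have h := hdS.tendsto_slope.eventually_lt_const (hφ.mul_sub_one_neg hlt)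
  rw [eventually_nhdsWithin_iff] at h
  obtain ⟨ε', hε', hb⟩ := Metric.eventually_nhds_iff.1 h
  set t := S - min (ε' / 2) (S / 2) with ht
  have hm1 := min_le_left (ε' / 2) (S / 2)
  have hm2 := min_le_right (ε' / 2) (S / 2)
  have hm3 : 0 < min (ε' / 2) (S / 2) := by positivity
  have htS : t < S := by linarith
  have := hb (y := t) (by rw [Real.dist_eq, abs_lt]; constructor <;> linarith) htS.ne
  rw [slope_def_field, himS, sub_zero, div_lt_iff_of_neg (by linarith), zero_mul] at this
  exact absurd (himneg t ⟨by linarith, htS⟩) (not_lt.2 this.le)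

namespace IsOrbit

variable {φ : ℝ → ℝ} {z : ℝ → ℂ} {p S : ℝ}

lemma map_neg (h : IsOrbit φ z p S) (t : ℝ) : z (-t) = (starRingEnd ℂ) (z t) := by
  have := IsPlanarFlow.eq_of_eq h.tame h.flow.reverse h.flow (t := 0) (by simp [h.map_zero])
  have := congrFun this t
  rw [← this]; simp

lemma map_half (h : IsOrbit φ z p S) : z S = ((z S).re : ℂ) := by
  apply Complex.ext <;> simp [h.im_half]

lemma map_half_add (h : IsOrbit φ z p S) (t : ℝ) :
    z (S + t) = (starRingEnd ℂ) (z (S - t)) := by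
  have h1 : IsPlanarFlow φ (fun t => z (t + S)) := h.flow.shift S
  have := IsPlanarFlow.eq_of_eq h.tame h1.reverse h1 (t := 0) (by
    simp only [neg_zero, zero_add]
    rw [h.map_half, Complex.conj_ofReal])
  have := congrFun this t
  rw [add_comm S t, ← this]; congr 2; ring

lemma periodic (h : IsOrbit φ z p S) : Function.Periodic z (2 * S) := by
  intro t
  have := h.map_half_add (S + t)
  rw [show S + (S + t) = t + 2 * S by ring, show S - (S + t) = -t by ring, h.map_neg] at this
  simpa using this

lemma im_pos (h : IsOrbit φ z p S) {t : ℝ} (ht : t ∈ Ioo S (2 * S)) : 0 < (z t).im := by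
  have h1 := h.map_half_add (t - S)
  have h2 := h.im_neg (S - (t - S)) ⟨by linarith [ht.2], by linarith [ht.1]⟩
  rw [show S + (t - S) = t by ring] at h1
  rw [h1, Complex.conj_im]
  linarith

/-- The orbit is in its initial position only at the multiples of `2 S`. -/
lemma exists_int_of_eq (h : IsOrbit φ z p S) {t : ℝ} (ht : z t = p) : ∃ k : ℤ, t = k * (2 * S) := by
  have hS := h.pos
  obtain ⟨k, hk, -⟩ := existsUnique_sub_zsmul_mem_Ico (show 0 < 2 * S by linarith) t 0
  refine ⟨k, ?_⟩
  rw [zsmul_eq_mul, zero_add] at hk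
  have h1 : z (t - k * (2 * S)) = p := by
    rw [h.periodic.sub_int_mul_eq k]; exact ht
  set u := t - k * (2 * S) with hu
  rcases hk.1.eq_or_lt with h0 | h0
  · linarith
  exfalso
  rcases lt_trichotomy u S with h2 | h2 | h2
  · have := h.im_neg u ⟨h0, h2⟩
    simp [h1] at this
  · have := h.radius_lt
    rw [show z S = p by rw [← h2, h1], Complex.ofReal_re] at this
    linarith [h.lt_radius]
  · have := h.im_pos ⟨h2, hk.2⟩
    simp [h1] at this

lemma exists_int_of_map_eq (h : IsOrbit φ z p S) {s t : ℝ} (hst : z s = z t) :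
    ∃ k : ℤ, t - s = k * (2 * S) := by
  have := IsPlanarFlow.eq_of_eq h.tame (h.flow.shift s) (h.flow.shift t) (t := 0) (by simpa)
  have := congrFun this (-s)
  apply h.exists_int_of_eq
  rw [show t - s = -s + t by ring, ← this]; simp [h.map_zero]

lemma exists_int_of_periodic (h : IsOrbit φ z p S) {T : ℝ} (hT : Function.Periodic z T) :
    ∃ k : ℤ, T = k * (2 * S) := by
  apply h.exists_int_of_eq
  rw [← h.map_zero]; simpa using hT 0

lemma map_int (h : IsOrbit φ z p S) (k : ℤ) (t : ℝ) : z (t + k * (2 * S)) = z t :=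
  h.periodic.int_mul k t

lemma hasDerivAt_normSq (h : IsOrbit φ z p S) (t : ℝ) :
    HasDerivAt (fun t => (z t).re ^ 2 + (z t).im ^ 2) (-2 * (z t).im) t := by
  refine (((h.flow.hasDerivAt_re t).fun_pow 2).fun_add
    ((h.flow.hasDerivAt_im t).fun_pow 2)).congr_deriv ?_
  push_cast; ring

lemma strictMonoOn_norm (h : IsOrbit φ z p S) : StrictMonoOn (fun t => ‖z t‖) (Icc 0 S) := by
  have h1 : StrictMonoOn (fun t => (z t).re ^ 2 + (z t).im ^ 2) (Icc 0 S) := by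
    refine strictMonoOn_of_deriv_pos (convex_Icc 0 S)
      (fun t _ => (h.hasDerivAt_normSq t).continuousAt.continuousWithinAt) (fun t ht => ?_)
    rw [interior_Icc] at ht
    rw [(h.hasDerivAt_normSq t).deriv]
    linarith [h.im_neg t ht]
  intro s hs t ht hst
  simp only [norm_eq_sqrt_re_im]
  exact Real.sqrt_lt_sqrt (by positivity) (h1 hs ht hst)

lemma strictMonoOn_re (h : IsOrbit φ z p S) : StrictMonoOn (fun t => (z t).re) (Icc 0 S) := by
  refine strictMonoOn_of_deriv_pos (convex_Icc 0 S)
      (fun t _ => (h.flow.hasDerivAt_re t).continuousAt.continuousWithinAt) (fun t ht => ?_)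
  rw [interior_Icc] at ht
  rw [(h.flow.hasDerivAt_re t).deriv]
  have h1 := h.im_neg t ht
  have h2 := h.tame.pos ‖z t‖ (norm_pos_iff.2 (by intro h0; simp [h0] at h1))
  nlinarith

/-- Every point of the orbit is, up to conjugation, a point of its first half. -/
lemma exists_mem_half (h : IsOrbit φ z p S) (t : ℝ) :
    ∃ s ∈ Icc 0 S, z t = z s ∨ z t = (starRingEnd ℂ) (z s) := by
  have hS := h.pos
  obtain ⟨k, hk, -⟩ := existsUnique_sub_zsmul_mem_Ico (show 0 < 2 * S by linarith) t 0
  rw [zsmul_eq_mul, zero_add] at hk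
  have h1 : z (t - k * (2 * S)) = z t := h.periodic.sub_int_mul_eq k
  rw [← h1]
  set u := t - k * (2 * S) with hu
  rcases le_total u S with h2 | h2
  · exact ⟨u, ⟨hk.1, h2⟩, Or.inl rfl⟩
  · refine ⟨2 * S - u, ⟨by linarith [hk.2], by linarith⟩, Or.inr ?_⟩
    rw [← h.map_neg, ← h.periodic (-(2 * S - u))]; congr 1; ring

lemma le_re (h : IsOrbit φ z p S) (t : ℝ) : p ≤ (z t).re := by
  obtain ⟨s, hs, hst⟩ := h.exists_mem_half t
  have h1 : (z t).re = (z s).re := by rcases hst with h | h <;> simp [h]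
  have := h.strictMonoOn_re.monotoneOn ⟨le_rfl, h.pos.le⟩ hs hs.1
  simp only [h.map_zero, Complex.ofReal_re] at this
  rwa [h1]

lemma abs_le_norm (h : IsOrbit φ z p S) (t : ℝ) : |p| ≤ ‖z t‖ := by
  obtain ⟨s, hs, hst⟩ := h.exists_mem_half t
  have h1 : ‖z t‖ = ‖z s‖ := by rcases hst with h | h <;> simp [h]
  have := h.strictMonoOn_norm.monotoneOn ⟨le_rfl, h.pos.le⟩ hs hs.1
  simp only [h.map_zero, norm_real_eq] at this
  rwa [h1]

/-- The maximal distance from the origin is attained exactly at the odd multiples of `S`. -/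
lemma exists_int_of_norm_eq (h : IsOrbit φ z p S) {t : ℝ} (ht : ‖z t‖ = ‖z S‖) :
    ∃ k : ℤ, t = S + k * (2 * S) := by
  obtain ⟨s, hs, hst⟩ := h.exists_mem_half t
  have h1 : ‖z t‖ = ‖z s‖ := by rcases hst with h | h <;> simp [h]
  have h2 : s = S := h.strictMonoOn_norm.injOn hs ⟨h.pos.le, le_rfl⟩ (h1.symm.trans ht)
  have h3 : z S = z t := by
    rw [h2] at hst
    rcases hst with h' | h'
    · exact h'.symm
    · rw [h', h.map_half, Complex.conj_ofReal]
  obtain ⟨k, hk⟩ := h.exists_int_of_map_eq h3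
  exact ⟨k, by linarith⟩

lemma map_ne_radius (h : IsOrbit φ z p S) (t : ℝ) : z t ≠ h.tame.radius := by
  intro he
  have h3 := h.flow.energy_eq h.tame t 0
  rw [he, h.map_zero] at h3
  exact absurd h3 (h.tame.energy_radius_lt (by exact_mod_cast h.lt_radius.ne)).ne

end IsOrbit

lemma isPlanarFlow_radius {φ : ℝ → ℝ} (hφ : Tame φ) :
    IsPlanarFlow φ (fun _ => (hφ.radius : ℂ)) := by
  intro t
  have : field φ (hφ.radius : ℂ) = 0 := by
    apply Complex.ext
    · simp [field_re]
    · simp [field_im, abs_of_pos hφ.radius_pos, hφ.radius_mul]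
  rw [this]
  exact hasDerivAt_const _ _

/-- On the real axis to the left of the equilibrium the energy takes every value above its
minimum. -/
lemma Tame.exists_energy_eq {φ : ℝ → ℝ} (hφ : Tame φ) {q : ℂ} (hq : q ≠ hφ.radius) :
    ∃ p : ℝ, p < hφ.radius ∧ energy φ p = energy φ q := by
  obtain ⟨r, hr⟩ := hφ.exists_norm_le
  have hlt := hφ.energy_radius_lt hq
  set B := energy φ q - energy φ hφ.radius + |r| with hB
  have hB0 : 0 < B := by have := abs_nonneg r; linarith
  have h1 := hr ((-B : ℝ) : ℂ)
  rw [norm_real_eq, abs_neg, abs_of_pos hB0] at h1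
  have h2 : energy φ q ≤ energy φ ((-B : ℝ) : ℂ) := by
    linarith [le_abs_self r]
  have hc : Continuous fun x : ℝ => energy φ x :=
    (continuous_energy hφ.continuous).comp Complex.continuous_ofReal
  obtain ⟨p, hp, hpe⟩ := intermediate_value_Icc' (show -B ≤ hφ.radius by
    linarith [hφ.radius_pos]) hc.continuousOn ⟨hlt.le, h2⟩
  refine ⟨p, lt_of_le_of_ne hp.2 ?_, hpe⟩
  rintro rfl
  exact hlt.ne hpe

/-- Every orbit other than the equilibrium passes through a real point on the left of the
equilibrium: the level sets of the energy are single orbits. -/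
theorem IsPlanarFlow.eq_const_or_isOrbit {φ : ℝ → ℝ} (hφ : Tame φ) {z : ℝ → ℂ}
    (hz : IsPlanarFlow φ z) :
    (∀ t, z t = hφ.radius) ∨ ∃ τ p S, IsOrbit φ (fun t => z (t + τ)) p S := by
  by_cases hq : z 0 = hφ.radius
  · left
    intro t
    exact congrFun (hz.eq_of_eq hφ (isPlanarFlow_radius hφ) (t := 0) hq) t
  right
  obtain ⟨p, hp, hE⟩ := hφ.exists_energy_eq hq
  obtain ⟨K, hK⟩ := hφ.lipschitz_field
  obtain ⟨w, hw0, hw⟩ := exists_integralCurve hK (p : ℂ)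
  obtain ⟨S, ho⟩ := IsPlanarFlow.isOrbit hφ hw hp hw0
  set q := z 0
  have hlow : |p| ≤ ‖q‖ := by
    by_contra! hcon
    have h0 := norm_nonneg q
    rcases le_total 0 p with h | h
    · rw [abs_of_nonneg h] at hcon
      have := hφ.energy_real_strictAnti hcon hp.le
      linarith [energy_norm_le φ q]
    · rw [abs_of_nonpos h] at hcon
      have := hφ.energy_real_strictAnti (x := p) (y := -‖q‖) (by linarith)
        (by linarith [hφ.radius_pos])
      linarith [energy_le_neg_norm φ q]
  have hX0 : 0 < (w S).re := hφ.radius_pos.trans ho.radius_lt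
  have hnX : ‖w S‖ = (w S).re := by
    rw [ho.map_half, norm_real_eq, Complex.ofReal_re, abs_of_pos hX0]
  have hup : ‖q‖ ≤ ‖w S‖ := by
    by_contra! hcon
    have h1 := hφ.energy_real_strictMono hcon (by rw [hnX]; exact ho.radius_lt.le)
    have h2 : energy φ (‖w S‖ : ℝ) = energy φ p := by
      rw [hnX, ← ho.map_half, ← hw0]; exact IsPlanarFlow.energy_eq hφ hw S 0
    linarith [energy_norm_le φ q]
  obtain ⟨τ, hτ, hτq⟩ := intermediate_value_Icc ho.pos.le
    ((continuous_norm.comp ho.flow.continuous).continuousOn (s := Icc 0 S))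
    (show ‖q‖ ∈ Icc _ _ from ⟨by simpa [hw0] using hlow, hup⟩)
  simp only [Function.comp] at hτq
  have hsq : (w τ).re ^ 2 + (w τ).im ^ 2 = q.re ^ 2 + q.im ^ 2 := by
    rw [← norm_sq_re_im, ← norm_sq_re_im, hτq]
  have hre : (w τ).re = q.re := by
    have h1 : energy φ (w τ) = energy φ q := by
      rw [← hE, ← hw0]; exact IsPlanarFlow.energy_eq hφ hw τ 0
    simp only [energy, hsq] at h1
    linarith
  have him : (w τ).im = q.im ∨ (w τ).im = -q.im := by
    rw [← sq_eq_sq_iff_eq_or_eq_neg]; rw [hre] at hsq; linarith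
  obtain ⟨τ', hτ'⟩ : ∃ τ', w τ' = q := by
    rcases him with h | h
    · exact ⟨τ, Complex.ext hre h⟩
    · refine ⟨-τ, ?_⟩
      rw [ho.map_neg]
      apply Complex.ext <;> simp [hre, h]
  have heq : z = fun t => w (t + τ') :=
    hz.eq_of_eq hφ (IsPlanarFlow.shift hw τ') (t := 0) (by simp [hτ', q])
  refine ⟨-τ', p, S, ?_⟩
  have : (fun t => z (t + -τ')) = w := by
    rw [heq]; ext t; simp
  rwa [this]

/-! ### Orientation of strictly convex loops -/

/-- A continuously differentiable simple loop that lies strictly to the left of each of its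
tangents. -/
structure IsConvexLoop (γ γ' : ℝ → ℂ) (a : ℝ) : Prop where
  hasDerivAt : ∀ t, HasDerivAt γ (γ' t) t
  continuous_deriv : Continuous γ'
  pos : 0 < a
  periodic : Function.Periodic γ a
  injOn : InjOn γ (Ico 0 a)
  left : ∀ s t, γ s ≠ γ t → 0 < ((starRingEnd ℂ) (γ' s) * (γ t - γ s)).im

namespace IsConvexLoop

variable {γ γ' : ℝ → ℂ} {a : ℝ}

lemma continuous (h : IsConvexLoop γ γ' a) : Continuous γ :=
  continuous_iff_continuousAt.2 fun t => (h.hasDerivAt t).continuousAt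

lemma left_le (h : IsConvexLoop γ γ' a) (s t : ℝ) :
    0 ≤ ((starRingEnd ℂ) (γ' s) * (γ t - γ s)).im := by
  by_cases hst : γ s = γ t
  · simp [hst]
  · exact (h.left s t hst).le

lemma map_period (h : IsConvexLoop γ γ' a) : γ a = γ 0 := by
  simpa using h.periodic 0

/-- About a point `q` to the left of all tangents, the loop has a continuous logarithm whose
imaginary part makes exactly one turn: it increases, and a second turn would put two points of
the loop on one ray from `q`, of which one would then be on the right of the tangent at the
other. -/
lemma exists_log (h : IsConvexLoop γ γ' a) {q : ℂ}
    (hq : ∀ t, 0 < ((starRingEnd ℂ) (γ' t) * (q - γ t)).im) :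
    ∃ L : ℝ → ℂ, Continuous L ∧ L 0 = 0 ∧ (∀ t, γ t - q = (γ 0 - q) * Complex.exp (L t)) ∧
      L a = 2 * Real.pi * Complex.I ∧ winding γ a q = 1 := by
  have ha := h.pos
  have hne : ∀ t, γ t - q ≠ 0 := by
    intro t h0
    have := hq t
    rw [← neg_sub, h0] at this
    simp at this
  have hcont : Continuous fun t => γ' t / (γ t - q) :=
    h.continuous_deriv.div (h.continuous.sub continuous_const) hne
  set L : ℝ → ℂ := fun t => ∫ s in (0 : ℝ)..t, γ' s / (γ s - q) with hL
  have hLd : ∀ t, HasDerivAt L (γ' t / (γ t - q)) t := fun t =>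
    intervalIntegral.integral_hasDerivAt_right (hcont.intervalIntegrable _ _)
      (hcont.stronglyMeasurableAtFilter _ _) hcont.continuousAt
  have hLc : Continuous L := continuous_iff_continuousAt.2 fun t => (hLd t).continuousAt
  have hL0 : L 0 = 0 := by simp [hL]
  have hexp : ∀ t, γ t - q = (γ 0 - q) * Complex.exp (L t) := by
    intro t
    have hd : ∀ t, HasDerivAt (fun t => (γ t - q) * Complex.exp (-L t)) 0 t := by
      intro t
      have h1 := ((h.hasDerivAt t).sub_const q).fun_mul (hLd t).fun_neg.cexp
      refine h1.congr_deriv ?_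
      field_simp [hne t]
      ring
    have := is_const_of_deriv_eq_zero (fun t => (hd t).differentiableAt) (fun t => (hd t).deriv) t 0
    simp only [hL0, neg_zero, Complex.exp_zero, mul_one] at this
    rw [← this, mul_assoc, ← Complex.exp_add]
    simp
  have hmono : StrictMono fun t => (L t).im := by
    refine strictMono_of_deriv_pos fun t => ?_
    rw [(hasDerivAt_im (hLd t)).deriv, Complex.div_im]
    have h1 := hq t
    have h2 := Complex.normSq_pos.2 (hne t)
    rw [← sub_div]
    apply div_pos _ h2
    simp at h1 ⊢
    linarith
  have h1 : Complex.exp (L a) = 1 := by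
    have := hexp a
    rw [h.map_period] at this
    exact (mul_right_eq_self₀.1 this.symm).resolve_right (hne 0)
  obtain ⟨n, hn⟩ := Complex.exp_eq_one_iff.1 h1
  have him : (L a).im = n * (2 * Real.pi) := by
    rw [hn]; simp
  have hpi := Real.pi_pos
  have hn1 : 1 ≤ n := by
    have := hmono ha
    simp only [hL0, Complex.zero_im, him] at this
    have : (0 : ℝ) < n := by
      by_contra! hcon
      nlinarith
    exact_mod_cast this
  have hn2 : n = 1 := by
    by_contra hne1
    have h2 : (2 : ℝ) ≤ n := by
      have : 2 ≤ n := by omega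
      exact_mod_cast this
    obtain ⟨u, hu, hu2⟩ := intermediate_value_Icc ha.le
      ((Complex.continuous_im.comp hLc).continuousOn (s := Icc 0 a))
      (show 2 * Real.pi ∈ Icc _ _ from ⟨by simp [hL0, hpi.le], by
        simp only [Function.comp, him]; nlinarith⟩)
    simp only [Function.comp] at hu2
    have hu0 : 0 < u := by
      refine lt_of_le_of_ne hu.1 ?_
      rintro rfl
      simp [hL0] at hu2
    have hua : u < a := by
      refine lt_of_le_of_ne hu.2 ?_
      rintro rfl
      rw [him] at hu2
      nlinarith
    have hne2 : γ u ≠ γ 0 := fun he =>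
      hu0.ne' (h.injOn ⟨hu0.le, hua⟩ ⟨le_rfl, ha⟩ he)
    set ρ := Real.exp (L u).re with hρ
    have hρ0 : 0 < ρ := Real.exp_pos _
    have hu3 : γ u - q = ρ * (γ 0 - q) := by
      rw [hexp u, mul_comm]
      congr 1
      have : L u = ((L u).re : ℂ) + 2 * Real.pi * Complex.I := by
        apply Complex.ext <;> simp [hu2]
      rw [this, Complex.exp_add, Complex.exp_two_pi_mul_I, mul_one, hρ, Complex.ofReal_exp]
    rcases lt_trichotomy ρ 1 with h3 | h3 | h3
    · have e1 : γ 0 - γ u = ((1 - ρ : ℝ) : ℂ) * (γ 0 - q) := by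
        push_cast; linear_combination -hu3
      have e2 : q - γ u = ((-ρ : ℝ) : ℂ) * (γ 0 - q) := by
        push_cast; linear_combination -hu3
      have h4 := h.left u 0 hne2
      have h5 := hq u
      rw [e1, mul_left_comm, Complex.im_ofReal_mul] at h4
      rw [e2, mul_left_comm, Complex.im_ofReal_mul] at h5
      nlinarith
    · rw [h3, Complex.ofReal_one] at hu3
      apply hne2
      linear_combination hu3
    · have e1 : γ u - γ 0 = ((ρ - 1 : ℝ) : ℂ) * (γ 0 - q) := by
        push_cast; linear_combination hu3
      have e2 : q - γ 0 = ((-1 : ℝ) : ℂ) * (γ 0 - q) := by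
        push_cast; ring
      have h4 := h.left 0 u hne2.symm
      have h5 := hq 0
      rw [e1, mul_left_comm, Complex.im_ofReal_mul] at h4
      rw [e2, mul_left_comm, Complex.im_ofReal_mul] at h5
      nlinarith
  refine ⟨L, hLc, hL0, hexp, by rw [hn, hn2]; simp, ?_⟩
  have hdγ : ∀ t, deriv γ t = γ' t := fun t => (h.hasDerivAt t).deriv
  have h6 : winding γ a q = (2 * Real.pi * Complex.I)⁻¹ * L a := by
    simp only [winding, hL, hdγ]
  rw [h6, hn, hn2, Int.cast_one, one_mul]
  exact inv_mul_cancel₀ Complex.two_pi_I_ne_zero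

/-- Every ray from a point to the left of all tangents meets the loop. -/
lemma exists_mem_ray (h : IsConvexLoop γ γ' a) {q₀ : ℂ}
    (hq₀ : ∀ t, 0 < ((starRingEnd ℂ) (γ' t) * (q₀ - γ t)).im) {q : ℂ} (hq : q ≠ q₀) :
    ∃ (u l : ℝ), 0 < l ∧ γ u - q₀ = l * (q - q₀) := by
  obtain ⟨L, hLc, hL0, hexp, hLa, -⟩ := h.exists_log hq₀
  have hpi := Real.pi_pos
  have hne : γ 0 - q₀ ≠ 0 := by
    intro h0
    have := hq₀ 0
    rw [← neg_sub, h0] at this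
    simp at this
  set w := (q - q₀) / (γ 0 - q₀) with hw
  have hw0 : w ≠ 0 := div_ne_zero (sub_ne_zero.2 hq) hne
  obtain ⟨β, hβ, hβw⟩ : ∃ β ∈ Icc 0 (2 * Real.pi), w = ‖w‖ * Complex.exp (β * Complex.I) := by
    have h1 := Complex.norm_mul_exp_arg_mul_I w
    rcases le_total 0 w.arg with h2 | h2
    · exact ⟨w.arg, ⟨h2, by linarith [Complex.arg_le_pi w]⟩, h1.symm⟩
    · refine ⟨w.arg + 2 * Real.pi, ⟨by linarith [Complex.neg_pi_lt_arg w], by linarith⟩, ?_⟩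
      push_cast
      rw [add_mul, Complex.exp_add, Complex.exp_two_pi_mul_I, mul_one, h1]
  obtain ⟨u, hu, hu2⟩ := intermediate_value_Icc h.pos.le
    ((Complex.continuous_im.comp hLc).continuousOn (s := Icc 0 a))
    (show β ∈ Icc _ _ from by simpa [hL0, hLa] using hβ)
  simp only [Function.comp] at hu2
  have hwn : 0 < ‖w‖ := norm_pos_iff.2 hw0
  refine ⟨u, Real.exp (L u).re / ‖w‖, by positivity, ?_⟩
  have h3 : q - q₀ = w * (γ 0 - q₀) := by rw [hw]; field_simp
  have h4 : Complex.exp (L u) = Real.exp (L u).re * Complex.exp (β * Complex.I) := by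
    rw [Complex.ofReal_exp, ← Complex.exp_add]
    congr 1
    apply Complex.ext <;> simp [hu2]
  rw [h3, hexp u, h4]
  nth_rewrite 2 [hβw]
  have : (‖w‖ : ℂ) ≠ 0 := by exact_mod_cast hwn.ne'
  push_cast
  field_simp

/-- A point off the loop is either strictly to the left of all tangents or strictly to the right
of one of them. -/
lemma left_or_right (h : IsConvexLoop γ γ' a) {q₀ : ℂ}
    (hq₀ : ∀ t, 0 < ((starRingEnd ℂ) (γ' t) * (q₀ - γ t)).im) {q : ℂ} (hq : q ∉ range γ) :
    ((∀ t, 0 < ((starRingEnd ℂ) (γ' t) * (q - γ t)).im) ∧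
        ∃ u, ‖q - q₀‖ ≤ ‖γ u - q₀‖) ∨
      ∃ t, ((starRingEnd ℂ) (γ' t) * (q - γ t)).im < 0 := by
  by_cases hqq : q = q₀
  · left
    rw [hqq]
    exact ⟨hq₀, 0, by simp⟩
  obtain ⟨u, l, hl, hu⟩ := h.exists_mem_ray hq₀ hqq
  have key : ∀ t, ((starRingEnd ℂ) (γ' t) * (γ u - γ t)).im =
      l * ((starRingEnd ℂ) (γ' t) * (q - γ t)).im +
        (1 - l) * ((starRingEnd ℂ) (γ' t) * (q₀ - γ t)).im := by
    intro t
    rw [← Complex.im_ofReal_mul, ← Complex.im_ofReal_mul, ← Complex.add_im]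
    congr 1
    push_cast
    linear_combination (starRingEnd ℂ) (γ' t) * hu
  rcases lt_trichotomy l 1 with h1 | h1 | h1
  · right
    refine ⟨u, ?_⟩
    have h2 := key u
    rw [sub_self, mul_zero, Complex.zero_im] at h2
    have := hq₀ u
    by_contra! hcon
    nlinarith
  · exfalso
    apply hq
    refine ⟨u, ?_⟩
    rw [h1, Complex.ofReal_one] at hu
    linear_combination hu
  · left
    constructor
    · intro t
      have h2 := key t
      have h3 := h.left_le t u
      have := hq₀ t
      by_contra! hcon
      nlinarith
    · refine ⟨u, ?_⟩
      rw [hu, norm_mul, Complex.norm_real, Real.norm_of_nonneg hl.le]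
      nlinarith [norm_nonneg (q - q₀)]

/-- A point strictly to the right of a tangent can be joined to infinity off the loop. -/
lemma not_interiorTo (h : IsConvexLoop γ γ' a) {q : ℂ} {t : ℝ}
    (hq : ((starRingEnd ℂ) (γ' t) * (q - γ t)).im < 0) : ¬ InteriorTo (range γ) q := by
  rintro ⟨-, hb⟩
  set ray : ℝ → ℂ := fun s => q + s * (-Complex.I * γ' t) with hray
  have hside : ∀ s : ℝ, 0 ≤ s → ray s ∈ (range γ)ᶜ := by
    rintro s hs ⟨u, hu⟩
    have h1 := h.left_le t u
    rw [hu] at h1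
    have e : ((starRingEnd ℂ) (γ' t) * (ray s - γ t)).im =
        ((starRingEnd ℂ) (γ' t) * (q - γ t)).im - s * ((γ' t).re ^ 2 + (γ' t).im ^ 2) := by
      simp [hray]; ring
    rw [e] at h1
    nlinarith [mul_nonneg hs (add_nonneg (sq_nonneg (γ' t).re) (sq_nonneg (γ' t).im))]
  have hconn : IsPreconnected (ray '' Ici 0) :=
    isPreconnected_Ici.image _ (by simp only [hray]; fun_prop)
  have hsub : ray '' Ici 0 ⊆ connectedComponentIn (range γ)ᶜ q := by
    apply hconn.subset_connectedComponentIn ⟨0, mem_Ici.2 le_rfl, by simp [hray]⟩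
    rintro _ ⟨s, hs, rfl⟩
    exact hside s hs
  obtain ⟨M, hM⟩ := (hb.subset hsub).exists_norm_le
  have hγ' : 0 < ‖γ' t‖ := by
    rw [norm_pos_iff]
    intro h0
    simp [h0] at hq
  set s := (|M| + ‖q‖ + 1) / ‖γ' t‖
  have hs : 0 ≤ s := by positivity
  have h1 := hM _ ⟨s, hs, rfl⟩
  have h2 : ‖(s : ℂ) * (-Complex.I * γ' t)‖ = |M| + ‖q‖ + 1 := by
    rw [norm_mul, norm_mul, norm_neg, Complex.norm_I, one_mul, Complex.norm_real,
      Real.norm_of_nonneg hs]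
    simp only [s]
    field_simp
  have h3 : ‖(s : ℂ) * (-Complex.I * γ' t)‖ ≤ ‖ray s‖ + ‖q‖ := by
    have := norm_sub_le (ray s) q
    simpa [hray] using this
  linarith [le_abs_self M]

/-- A strictly convex loop with a point to the left of all its tangents is oriented
counter-clockwise. -/
theorem loopCCW (h : IsConvexLoop γ γ' a) {q₀ : ℂ}
    (hq₀ : ∀ t, 0 < ((starRingEnd ℂ) (γ' t) * (q₀ - γ t)).im) : LoopCCW γ a := by
  have hq₀S : q₀ ∉ range γ := by
    rintro ⟨t, ht⟩
    have := hq₀ t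
    simp [ht] at this
  constructor
  · refine ⟨q₀, hq₀S, ?_⟩
    -- the points on the right of some tangent form an open set, and so do those on the left of
    -- all tangents, as the tangents are parametrized by a compact interval
    set A : Set ℂ := {q | ∀ t ∈ Icc 0 a, 0 < ((starRingEnd ℂ) (γ' t) * (q - γ t)).im} with hA
    set B : Set ℂ := ⋃ t, {q | ((starRingEnd ℂ) (γ' t) * (q - γ t)).im < 0} with hB
    have hcont : Continuous fun x : ℝ × ℂ => ((starRingEnd ℂ) (γ' x.1) * (x.2 - γ x.1)).im := by
      have h1 := h.continuous
      have h2 := h.continuous_deriv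
      exact Complex.continuous_im.comp ((Complex.continuous_conj.comp (h2.comp continuous_fst)).mul
        (continuous_snd.sub (h1.comp continuous_fst)))
    have hAo : IsOpen A := by
      rw [isOpen_iff_mem_nhds]
      intro q hq
      have := isCompact_Icc.eventually_forall_of_forall_eventually (x₀ := q) (K := Icc 0 a)
        (P := fun q t => 0 < ((starRingEnd ℂ) (γ' t) * (q - γ t)).im) (fun t ht => by
          have h3 : Continuous fun x : ℂ × ℝ =>
            ((starRingEnd ℂ) (γ' x.2) * (x.1 - γ x.2)).im := hcont.comp continuous_swap
          exact h3.continuousAt.eventually_const_lt (hq t ht))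
      exact this
    have hBo : IsOpen B := isOpen_iUnion fun t =>
      isOpen_lt (hcont.comp (Continuous.prodMk_right t)) continuous_const
    have hcover : (range γ)ᶜ ⊆ A ∪ B := by
      intro q hq
      rcases h.left_or_right hq₀ hq with h1 | ⟨t, ht⟩
      · exact Or.inl fun t _ => h1.1 t
      · exact Or.inr (mem_iUnion.2 ⟨t, ht⟩)
    set Q := connectedComponentIn (range γ)ᶜ q₀ with hQ
    have hQsub : Q ⊆ (range γ)ᶜ := connectedComponentIn_subset _ _
    have hdisj : Q ∩ (A ∩ B) = ∅ := by
      rw [eq_empty_iff_forall_notMem]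
      rintro q ⟨hqQ, hqA, hqB⟩
      obtain ⟨t, ht⟩ := mem_iUnion.1 hqB
      have ht' : ((starRingEnd ℂ) (γ' t) * (q - γ t)).im < 0 := ht
      rcases h.left_or_right hq₀ (hQsub hqQ) with h1 | ⟨u, hu⟩
      · exact absurd (h1.1 t) (not_lt.2 ht'.le)
      · -- transport the parameter into `[0, a)` by periodicity
        obtain ⟨k, hk, -⟩ := existsUnique_sub_zsmul_mem_Ico h.pos t 0
        rw [zsmul_eq_mul, zero_add] at hk
        have h3 := hqA _ ⟨hk.1, hk.2.le⟩
        have h4 : γ (t - k * a) = γ t := h.periodic.sub_int_mul_eq k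
        have h5 : γ' (t - k * a) = γ' t := by
          have h6 : HasDerivAt γ (γ' t) (t - k * a) := by
            have h7 : HasDerivAt (fun s => γ (s + k * a)) (γ' t) (t - k * a) := by
              apply HasDerivAt.comp_add_const
              rw [sub_add_cancel]
              exact h.hasDerivAt t
            have h8 : (fun s => γ (s + k * a)) = γ := funext fun s => h.periodic.int_mul k s
            rwa [h8] at h7
          exact (h.hasDerivAt _).unique h6
        rw [h4, h5] at h3
        linarith
    have hQA : Q ⊆ A := by
      rcases isPreconnected_iff_subset_of_disjoint.1 isPreconnected_connectedComponentIn A B hAo hBo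
        (hQsub.trans hcover) hdisj with h1 | h1
      · exact h1
      · exfalso
        obtain ⟨t, ht⟩ := mem_iUnion.1 (h1 (mem_connectedComponentIn hq₀S))
        have ht' : ((starRingEnd ℂ) (γ' t) * (q₀ - γ t)).im < 0 := ht
        exact absurd (hq₀ t) (not_lt.2 ht'.le)
    obtain ⟨M, hM⟩ := isCompact_Icc.exists_bound_of_continuousOn
      ((h.continuous.sub continuous_const).continuousOn (s := Icc 0 a) (f := fun t => γ t - q₀))
    refine (Metric.isBounded_closedBall (x := q₀) (r := M)).subset fun q hq => ?_
    rw [Metric.mem_closedBall, dist_eq_norm]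
    rcases h.left_or_right hq₀ (hQsub hq) with ⟨-, u, hu⟩ | ⟨t, ht⟩
    · obtain ⟨k, hk, -⟩ := existsUnique_sub_zsmul_mem_Ico h.pos u 0
      rw [zsmul_eq_mul, zero_add] at hk
      have := hM _ ⟨hk.1, hk.2.le⟩
      rw [h.periodic.sub_int_mul_eq k] at this
      exact hu.trans this
    · exfalso
      have : q ∈ Q ∩ (A ∩ B) := ⟨hq, hQA hq, mem_iUnion.2 ⟨t, ht⟩⟩
      rw [hdisj] at this
      exact this
  · intro q hq
    rcases h.left_or_right hq₀ hq.1 with h1 | ⟨t, ht⟩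
    · obtain ⟨-, -, -, -, -, hw⟩ := h.exists_log h1.1
      exact hw
    · exact absurd hq (h.not_interiorTo ht)

end IsConvexLoop

/-! ### Periodic curves whose set of points is a topological circle -/

/-- A path of unit speed is locally injective. -/
lemma exists_injOn_ball {γ γ' : ℝ → ℂ} (hγ : ∀ t, HasDerivAt γ (γ' t) t) (hc : Continuous γ')
    (hu : ∀ t, ‖γ' t‖ = 1) (t : ℝ) : ∃ ε > 0, InjOn γ (Metric.ball t ε) := by
  obtain ⟨ε, hε, hb⟩ := Metric.continuousAt_iff.1 (hc.continuousAt (x := t)) (1 / 2) (by norm_num)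
  refine ⟨ε, hε, fun x hx y hy hxy => ?_⟩
  have h1 : ∀ s ∈ Metric.ball t ε, HasDerivWithinAt (fun s : ℝ => γ s - (s : ℂ) * γ' t)
      (γ' s - γ' t) (Metric.ball t ε) s := fun s _ => by
    simpa using ((hγ s).fun_sub ((hasDerivAt_id s).ofReal_comp.mul_const (γ' t))).hasDerivWithinAt
  have h2 := (convex_ball t ε).norm_image_sub_le_of_norm_hasDerivWithin_le h1
    (fun s hs => by rw [← dist_eq_norm]; exact (hb hs).le) hx hy
  rw [hxy] at h2
  have h3 : γ y - ↑y * γ' t - (γ y - ↑x * γ' t) = ((x - y : ℝ) : ℂ) * γ' t := by push_cast; ring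
  rw [h3, norm_mul, hu, mul_one, Complex.norm_real, norm_sub_rev] at h2
  by_contra hne
  have : 0 < ‖y - x‖ := norm_pos_iff.2 (sub_ne_zero.2 (Ne.symm hne))
  linarith

/-- A continuous locally injective real function of a real variable is injective, as it has no
local extrema. -/
lemma injective_of_locally_injective {g : ℝ → ℝ} (hg : Continuous g)
    (h : ∀ t, ∃ ε > 0, InjOn g (Metric.ball t ε)) : Function.Injective g := by
  have key : ∀ x y, x < y → g x ≠ g y := by
    intro x y hxy he
    obtain ⟨c, hc, hext⟩ := exists_Ioo_extr_on_Icc hxy hg.continuousOn he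
    obtain ⟨ε, hε, hinj⟩ := h c
    set δ := min (ε / 2) (min (c - x) (y - c)) with hδ
    have hδ0 : 0 < δ := by
      have := hc.1
      have := hc.2
      simp only [hδ, lt_min_iff]
      refine ⟨by linarith, by linarith, by linarith⟩
    have h1 : δ ≤ ε / 2 := min_le_left _ _
    have h2 : δ ≤ c - x := (min_le_right _ _).trans (min_le_left _ _)
    have h3 : δ ≤ y - c := (min_le_right _ _).trans (min_le_right _ _)
    have hinj' : InjOn g (Icc (c - δ) (c + δ)) := hinj.mono fun s hs => by
      rw [Metric.mem_ball, Real.dist_eq, abs_lt]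
      constructor <;> linarith [hs.1, hs.2]
    have hl : c - δ ∈ Icc (c - δ) (c + δ) := ⟨le_rfl, by linarith⟩
    have hm : c ∈ Icc (c - δ) (c + δ) := ⟨by linarith, by linarith⟩
    have hr : c + δ ∈ Icc (c - δ) (c + δ) := ⟨by linarith, le_rfl⟩
    have hl' : c - δ ∈ Icc x y := ⟨by linarith, by linarith⟩
    have hr' : c + δ ∈ Icc x y := ⟨by linarith, by linarith⟩
    rcases hg.continuousOn.strictMonoOn_of_injOn_Icc' (by linarith) hinj' with hm' | hm' <;>
    rcases hext with he' | he'
    · exact absurd (he' hl') (not_le.2 (hm' hl hm (by linarith)))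
    · exact absurd (he' hr') (not_le.2 (hm' hm hr (by linarith)))
    · exact absurd (he' hr') (not_le.2 (hm' hm hr (by linarith)))
    · exact absurd (he' hl') (not_le.2 (hm' hl hm (by linarith)))
  intro x y hxy
  rcases lt_trichotomy x y with h1 | h1 | h1
  · exact absurd hxy (key x y h1)
  · exact h1
  · exact absurd hxy.symm (key y x h1)

/-- The angle coordinate of a topological circle lifts to a strictly increasing function of the
parameter. -/
lemma exists_strictMono_lift {γ γ' : ℝ → ℂ} (hγ : ∀ t, HasDerivAt γ (γ' t) t)
    (hc : Continuous γ') (hu : ∀ t, ‖γ' t‖ = 1) (e : range γ ≃ₜ Circle) :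
    ∃ g : ℝ → ℝ, Continuous g ∧ StrictMono g ∧
      ∀ s t, γ s = γ t ↔ ∃ k : ℤ, g s = g t + k * (2 * Real.pi) := by
  have hγc : Continuous γ := continuous_iff_continuousAt.2 fun t => (hγ t).continuousAt
  let u : C(ℝ, Circle) := ⟨fun t => e ⟨γ t, mem_range_self t⟩,
    e.continuous.comp (hγc.subtype_mk _)⟩
  obtain ⟨G, ⟨-, hG⟩, -⟩ := Circle.isCoveringMap_exp.existsUnique_continuousMap_lifts u 0
    (Complex.arg (u 0)) (Circle.exp_arg _)
  have hGu : ∀ t, Circle.exp (G t) = u t := fun t => congrFun hG t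
  have hiff : ∀ s t, γ s = γ t ↔ ∃ k : ℤ, G s = G t + k * (2 * Real.pi) := by
    intro s t
    rw [← Circle.exp_eq_exp, hGu, hGu]
    simp [u, Subtype.ext_iff]
  have hinj : Function.Injective G := by
    refine injective_of_locally_injective G.continuous fun t => ?_
    obtain ⟨ε, hε, hi⟩ := exists_injOn_ball hγ hc hu t
    exact ⟨ε, hε, fun x hx y hy hxy => hi hx hy ((hiff x y).2 ⟨0, by simpa using hxy⟩)⟩
  rcases G.continuous.strictMono_of_inj hinj with hm | hm
  · exact ⟨G, G.continuous, hm, hiff⟩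
  · refine ⟨fun t => -G t, G.continuous.neg, fun x y hxy => neg_lt_neg (hm hxy), fun s t => ?_⟩
    rw [hiff]
    constructor
    · rintro ⟨k, hk⟩; exact ⟨-k, by push_cast; linarith⟩
    · rintro ⟨k, hk⟩; exact ⟨-k, by push_cast; linarith⟩

/-- If the set of points of a periodic path of unit speed is a topological circle, then any two
parameters of one point differ by a period: the deck transformations of the circle act on the
parameter by maps that preserve arc length, hence by translations. -/
theorem periodic_of_homeomorph_circle {γ γ' : ℝ → ℂ} (hγ : ∀ t, HasDerivAt γ (γ' t) t)
    (hc : Continuous γ') (hu : ∀ t, ‖γ' t‖ = 1) {a : ℝ} (ha : 0 < a)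
    (hper : Function.Periodic γ a) (e : range γ ≃ₜ Circle) {s t : ℝ} (hst : γ s = γ t) :
    Function.Periodic γ (t - s) := by
  obtain ⟨g, hgc, hg, hiff⟩ := exists_strictMono_lift hγ hc hu e
  have hpi := Real.pi_pos
  have hstep : ∀ t, g t + 2 * Real.pi ≤ g (t + a) := by
    intro t
    obtain ⟨k, hk⟩ := (hiff (t + a) t).1 (hper t)
    have h1 : g t < g (t + a) := hg (by linarith)
    have hk0 : (0 : ℝ) < k := by
      by_contra! hcon
      nlinarith
    have hk1 : (1 : ℝ) ≤ k := by
      have : 0 < k := by exact_mod_cast hk0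
      exact_mod_cast this
    rw [hk]
    nlinarith
  have hup : ∀ n : ℕ, g 0 + n * (2 * Real.pi) ≤ g (n * a) := by
    intro n
    induction n with
    | zero => simp
    | succ n ih =>
      have := hstep (n * a)
      push_cast
      rw [add_mul (n : ℝ) 1 a, one_mul]
      linarith
  have hdown : ∀ n : ℕ, g (-(n * a)) ≤ g 0 - n * (2 * Real.pi) := by
    intro n
    induction n with
    | zero => simp
    | succ n ih =>
      have := hstep (-((n + 1 : ℕ) * a))
      rw [show -(((n + 1 : ℕ) : ℝ) * a) + a = -(n * a) by push_cast; ring] at this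
      push_cast at this ⊢
      linarith
  have hsurj : Function.Surjective g := by
    intro y
    obtain ⟨n, hn⟩ := exists_nat_ge (|y - g 0| / (2 * Real.pi))
    rw [div_le_iff₀ (by positivity)] at hn
    have h1 := abs_le.1 hn
    have h2 : -((n : ℝ) * a) ≤ n * a := by
      have : 0 ≤ (n : ℝ) * a := by positivity
      linarith
    obtain ⟨x, -, hx⟩ := intermediate_value_Icc h2 hgc.continuousOn
      (show y ∈ Icc _ _ from ⟨by linarith [hdown n], by linarith [hup n]⟩)
    exact ⟨x, hx⟩
  let o := hg.orderIsoOfSurjective g hsurj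
  have ho : ∀ x, o x = g x := fun x => rfl
  obtain ⟨k, hk⟩ := (hiff t s).1 hst.symm
  -- the deck transformation that takes `s` to `t`
  set τ : ℝ → ℝ := fun x => o.symm (g x + k * (2 * Real.pi)) with hτ
  have hgτ : ∀ x, g (τ x) = g x + k * (2 * Real.pi) := fun x => o.apply_symm_apply _
  have hτc : Continuous τ := o.symm.continuous.comp (hgc.add continuous_const)
  have hτm : StrictMono τ := fun x y hxy => o.symm.strictMono (by linarith [hg hxy])
  have hγτ : ∀ x, γ (τ x) = γ x := fun x => (hiff _ _).2 ⟨k, hgτ x⟩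
  have hτs : τ s = t := hg.injective (by rw [hgτ, hk])
  -- difference quotients of `γ` at `x` and at `τ x` have the same chords and tend to norm `1`
  have hτd : ∀ x, HasDerivAt τ 1 x := by
    intro x
    rw [hasDerivAt_iff_tendsto_slope]
    have h1 : Tendsto (fun y => ‖slope γ x y‖) (𝓝[≠] x) (𝓝 1) := by
      have := (hasDerivAt_iff_tendsto_slope.1 (hγ x)).norm
      rwa [hu] at this
    have h2 : Tendsto τ (𝓝[≠] x) (𝓝[≠] (τ x)) :=
      tendsto_nhdsWithin_of_tendsto_nhds_of_eventually_within _
        (hτc.continuousAt.tendsto.mono_left nhdsWithin_le_nhds)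
        (by filter_upwards [self_mem_nhdsWithin] with y hy using fun h => hy (hτm.injective h))
    have h3 : Tendsto (fun y => ‖slope γ (τ x) (τ y)‖) (𝓝[≠] x) (𝓝 1) := by
      have := ((hasDerivAt_iff_tendsto_slope.1 (hγ (τ x))).norm).comp h2
      rwa [hu] at this
    have h4 := h1.div h3 one_ne_zero
    rw [div_one] at h4
    refine h4.congr' ?_
    filter_upwards [self_mem_nhdsWithin, h3.eventually_ne one_ne_zero] with y hy hy3
    have hyx : y - x ≠ 0 := sub_ne_zero.2 hy
    have hτyx : τ y - τ x ≠ 0 := sub_ne_zero.2 fun h => hy (hτm.injective h)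
    have hpos : 0 < (τ y - τ x) / (y - x) := by
      rcases lt_or_gt_of_ne (show y ≠ x from hy) with h | h
      · exact div_pos_of_neg_of_neg (by linarith [hτm h]) (by linarith)
      · exact div_pos (by linarith [hτm h]) (by linarith)
    have e1 : ‖slope γ (τ x) (τ y)‖ * |τ y - τ x| = ‖γ y - γ x‖ := by
      rw [slope_def_module, hγτ, hγτ, norm_smul, norm_inv, Real.norm_eq_abs]
      field_simp
    have e2 : ‖slope γ x y‖ * |y - x| = ‖γ y - γ x‖ := by
      rw [slope_def_module, norm_smul, norm_inv, Real.norm_eq_abs]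
      field_simp
    rw [Pi.div_apply, div_eq_iff hy3, slope_def_field, ← abs_of_pos hpos, abs_div]
    have : |y - x| ≠ 0 := abs_ne_zero.2 hyx
    field_simp
    rw [e2, ← e1]; ring
  have hconst := is_const_of_deriv_eq_zero (f := fun x => τ x - x)
    (fun x => ((hτd x).sub (hasDerivAt_id x)).differentiableAt)
    (fun x => by
      have := ((hτd x).fun_sub (hasDerivAt_id x)).deriv
      simpa using this)
  intro x
  have h5 := hconst x s
  simp only [hτs] at h5
  rw [← hγτ x]; congr 1; linarith

/-- The set of points of a simple loop is a topological circle. -/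
theorem nonempty_homeomorph_circle {γ : ℝ → ℂ} (hc : Continuous γ) {a : ℝ} (ha : 0 < a)
    (hper : Function.Periodic γ a) (hinj : InjOn γ (Ico 0 a)) :
    Nonempty (range γ ≃ₜ Circle) := by
  have : Fact (0 < a) := ⟨ha⟩
  have hlc : Continuous hper.lift := continuous_coinduced_dom.2 hc
  have hli : Function.Injective hper.lift := by
    intro x y hxy
    obtain ⟨s, hs, rfl⟩ := (AddCircle.coe_image_Ico_eq a 0).symm ▸ mem_univ x
    obtain ⟨t, ht, rfl⟩ := (AddCircle.coe_image_Ico_eq a 0).symm ▸ mem_univ y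
    rw [zero_add] at hs ht
    rw [hper.lift_coe, hper.lift_coe] at hxy
    rw [hinj hs ht hxy]
  have hemb : IsEmbedding hper.lift := (hlc.isClosedEmbedding hli).isEmbedding
  have hr : range hper.lift = range γ := by
    ext w
    constructor
    · rintro ⟨x, rfl⟩
      obtain ⟨t, rfl⟩ := QuotientAddGroup.mk_surjective x
      exact ⟨t, rfl⟩
    · rintro ⟨t, rfl⟩
      exact ⟨(t : AddCircle a), rfl⟩
  exact ⟨(Homeomorph.setCongr hr.symm).trans
    (hemb.toHomeomorph.symm.trans (AddCircle.homeomorphCircle ha.ne'))⟩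

/-! ### Curves in terms of the planar flow -/

/-- The curve with tangent angle `ϑ` whose position relative to its tangent is given by `z`: the
inverse of the substitution `z = -i c̄ e^{iϑ}` that turns the curvature equation into the planar
flow. -/
noncomputable def roll (z : ℝ → ℂ) (ϑ : ℝ → ℝ) (t : ℝ) : ℂ :=
  -Complex.I * (starRingEnd ℂ) (z t) * Complex.exp (Complex.I * ϑ t)

lemma norm_exp_I_mul (x : ℝ) : ‖Complex.exp (Complex.I * x)‖ = 1 := by
  rw [mul_comm]; exact Complex.norm_exp_ofReal_mul_I x

lemma exp_I_mul_im (x : ℝ) : (Complex.exp (Complex.I * x)).im = Real.sin x := by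
  rw [mul_comm, Complex.exp_ofReal_mul_I_im]

lemma conj_exp_I_mul (x : ℝ) :
    (starRingEnd ℂ) (Complex.exp (Complex.I * x)) = Complex.exp (-(Complex.I * x)) := by
  rw [← Complex.exp_conj]; simp

lemma conj_exp_mul_exp (x y : ℝ) :
    (starRingEnd ℂ) (Complex.exp (Complex.I * x)) * Complex.exp (Complex.I * y) =
      Complex.exp (Complex.I * ((y - x : ℝ) : ℂ)) := by
  rw [conj_exp_I_mul, ← Complex.exp_add]; congr 1; push_cast; ring

lemma norm_roll (z : ℝ → ℂ) (ϑ : ℝ → ℝ) (t : ℝ) : ‖roll z ϑ t‖ = ‖z t‖ := by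
  simp [roll]

lemma roll_add_const (z : ℝ → ℂ) (ϑ : ℝ → ℝ) (β t : ℝ) :
    roll z (fun t => ϑ t + β) t = Complex.exp (Complex.I * β) * roll z ϑ t := by
  simp only [roll]; push_cast; rw [mul_add, Complex.exp_add]; ring

/-- The planar coordinate is recovered from the curve and its tangent. -/
lemma conj_roll_mul_exp (z : ℝ → ℂ) (ϑ : ℝ → ℝ) (t : ℝ) :
    -Complex.I * (starRingEnd ℂ) (roll z ϑ t) * Complex.exp (Complex.I * ϑ t) = z t := by
  have h : (starRingEnd ℂ) (Complex.exp (Complex.I * ϑ t)) * Complex.exp (Complex.I * ϑ t) = 1 := by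
    rw [conj_exp_mul_exp]; simp
  simp only [roll, map_mul, map_neg, Complex.conj_I, Complex.conj_conj]
  linear_combination (-Complex.I * Complex.I * z t) * h - z t * Complex.I_mul_I

lemma exp_I_mul_pi_div_two_add (x : ℝ) :
    Complex.exp (Complex.I * ((Real.pi / 2 + x : ℝ) : ℂ)) =
      Complex.I * Complex.exp (Complex.I * x) := by
  push_cast
  rw [mul_add, Complex.exp_add, mul_comm Complex.I ((Real.pi : ℂ) / 2),
    Complex.exp_pi_div_two_mul_I]

lemma hasDerivAt_exp_I_mul {ϑ : ℝ → ℝ} {k t : ℝ} (hϑ : HasDerivAt ϑ k t) :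
    HasDerivAt (fun t => Complex.exp (Complex.I * ϑ t))
      (Complex.exp (Complex.I * ϑ t) * (Complex.I * k)) t :=
  (hϑ.ofReal_comp.const_mul Complex.I).cexp

lemma hasDerivAt_roll {z : ℝ → ℂ} {ϑ : ℝ → ℝ} {k t : ℝ}
    (hz : HasDerivAt z (Complex.I * z t * k - Complex.I) t) (hϑ : HasDerivAt ϑ k t) :
    HasDerivAt (roll z ϑ) (Complex.exp (Complex.I * ϑ t)) t := by
  have h := ((hasDerivAt_conj hz).const_mul (-Complex.I)).fun_mul (hasDerivAt_exp_I_mul hϑ)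
  refine h.congr_deriv ?_
  simp only [map_sub, map_mul, Complex.conj_I, Complex.conj_ofReal]
  linear_combination (-Complex.exp (Complex.I * ϑ t)) * Complex.I_mul_I

/-! ### Locally convex curves of total turn `2π` -/

/-- A closed curve with increasing tangent angle of total turn `2π` is simple and convex: the
height over the tangent at a point increases for half a turn and then decreases. -/
theorem isConvexLoop_of_turn {c : ℝ → ℂ} {ϑ : ℝ → ℝ} {a : ℝ}
    (hc : ∀ t, HasDerivAt c (Complex.exp (Complex.I * ϑ t)) t) (hϑc : Continuous ϑ)
    (hϑ : StrictMono ϑ) (ha : 0 < a) (hturn : ∀ t, ϑ (t + a) = ϑ t + 2 * Real.pi)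
    (hper : Function.Periodic c a) :
    IsConvexLoop c (fun t => Complex.exp (Complex.I * ϑ t)) a := by
  have hpi := Real.pi_pos
  have key : ∀ s, ∀ u ∈ Ioo s (s + a),
      0 < ((starRingEnd ℂ) (Complex.exp (Complex.I * ϑ s)) * (c u - c s)).im := by
    intro s u hu
    set g : ℝ → ℝ := fun v =>
      ((starRingEnd ℂ) (Complex.exp (Complex.I * ϑ s)) * (c v - c s)).im with hg
    have hgd : ∀ v, HasDerivAt g (Real.sin (ϑ v - ϑ s)) v := by
      intro v
      have := hasDerivAt_im (((hc v).sub_const (c s)).const_mul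
        ((starRingEnd ℂ) (Complex.exp (Complex.I * ϑ s))))
      rwa [conj_exp_mul_exp, exp_I_mul_im] at this
    obtain ⟨m, hm, hmϑ⟩ := intermediate_value_Icc (show s ≤ s + a by linarith)
      hϑc.continuousOn (show ϑ s + Real.pi ∈ Icc _ _ from
        ⟨by linarith, by rw [hturn]; linarith⟩)
    have hg0 : g s = 0 := by simp [hg]
    have hga : g (s + a) = 0 := by simp [hg, hper s]
    rcases le_total u m with hum | hum
    · have h1 : StrictMonoOn g (Icc s m) := by
        refine strictMonoOn_of_deriv_pos (convex_Icc s m)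
          (fun v _ => (hgd v).continuousAt.continuousWithinAt) fun v hv => ?_
        rw [interior_Icc] at hv
        rw [(hgd v).deriv]
        exact Real.sin_pos_of_pos_of_lt_pi (by linarith [hϑ hv.1]) (by linarith [hϑ hv.2])
      have := h1 ⟨le_rfl, hm.1⟩ ⟨hu.1.le, hum⟩ hu.1
      rwa [hg0] at this
    · have h1 : StrictAntiOn g (Icc m (s + a)) := by
        refine strictAntiOn_of_deriv_neg (convex_Icc m (s + a))
          (fun v _ => (hgd v).continuousAt.continuousWithinAt) fun v hv => ?_
        rw [interior_Icc] at hv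
        rw [(hgd v).deriv, ← Real.sin_sub_two_pi]
        have := hturn s
        exact Real.sin_neg_of_neg_of_neg_pi_lt (by linarith [hϑ hv.2]) (by linarith [hϑ hv.1])
      have := h1 ⟨hum, hu.2.le⟩ ⟨hm.2, le_rfl⟩ hu.2
      rwa [hga] at this
  refine ⟨hc, ?_, ha, hper, ?_, ?_⟩
  · exact Complex.continuous_exp.comp
      (continuous_const.mul (Complex.continuous_ofReal.comp hϑc))
  · have h1 : ∀ s ∈ Ico 0 a, ∀ t ∈ Ico 0 a, s < t → c s ≠ c t := by
      intro s hs t ht hst he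
      have := key s t ⟨hst, by linarith [hs.1, ht.2]⟩
      simp [he] at this
    intro s hs t ht hst
    rcases lt_trichotomy s t with h | h | h
    · exact absurd hst (h1 s hs t ht h)
    · exact h
    · exact absurd hst.symm (h1 t ht s hs h)
  · intro s t hst
    obtain ⟨k, hk, -⟩ := existsUnique_sub_zsmul_mem_Ico ha t s
    rw [zsmul_eq_mul] at hk
    have h1 : c (t - k * a) = c t := hper.sub_int_mul_eq k
    rw [← h1] at hst ⊢
    refine key s _ ⟨lt_of_le_of_ne hk.1 ?_, hk.2⟩
    intro he
    exact hst (by rw [← he])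

/-! ### The tangent angle along a periodic orbit -/

/-- A weak form of the four vertex theorem: an arc that makes half a turn, starting and ending
perpendicularly to a line, and along which the curvature is strictly monotone, does not begin
and end on the same such line. With `τ` the middle of the turn, `cos ϑ + k(τ) y` is strictly
monotone, as its derivative `(k(τ) - k) sin ϑ` does not change sign. -/
lemma height_ne_of_half_turn {ϑ k y : ℝ → ℝ} {S : ℝ} (hS : 0 < S)
    (hϑ : ∀ t, HasDerivAt ϑ (k t) t) (hy : ∀ t, HasDerivAt y (Real.sin (ϑ t)) t)
    (h0 : ϑ 0 = Real.pi / 2) (h1 : ϑ S = 3 * Real.pi / 2)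
    (hpos : ∀ t ∈ Ioo 0 S, 0 < k t)
    (hk : StrictMonoOn k (Ioo 0 S) ∨ StrictAntiOn k (Ioo 0 S)) : y 0 ≠ y S := by
  have hpi := Real.pi_pos
  have hϑc : Continuous ϑ := continuous_iff_continuousAt.2 fun t => (hϑ t).continuousAt
  have hϑm : StrictMonoOn ϑ (Icc 0 S) := by
    refine strictMonoOn_of_deriv_pos (convex_Icc 0 S) hϑc.continuousOn fun t ht => ?_
    rw [interior_Icc] at ht
    rw [(hϑ t).deriv]
    exact hpos t ht
  obtain ⟨m, hm, hmϑ⟩ := intermediate_value_Icc hS.le hϑc.continuousOn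
    (show Real.pi ∈ Icc _ _ from ⟨by linarith, by linarith⟩)
  have hm0 : 0 < m := by
    refine lt_of_le_of_ne hm.1 ?_
    rintro rfl
    linarith
  have hmS : m < S := by
    refine lt_of_le_of_ne hm.2 ?_
    rintro rfl
    linarith
  have hmI : m ∈ Ioo 0 S := ⟨hm0, hmS⟩
  set W : ℝ → ℝ := fun t => Real.cos (ϑ t) + k m * y t with hW
  have hWd : ∀ t, HasDerivAt W ((k m - k t) * Real.sin (ϑ t)) t := fun t =>
    ((hϑ t).cos.fun_add ((hy t).const_mul (k m))).congr_deriv (by ring)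
  have hWc : Continuous W := continuous_iff_continuousAt.2 fun t => (hWd t).continuousAt
  have hs1 : ∀ t ∈ Ioo 0 m, 0 < Real.sin (ϑ t) := fun t ht =>
    Real.sin_pos_of_pos_of_lt_pi
      (by linarith [hϑm ⟨le_rfl, hS.le⟩ ⟨ht.1.le, by linarith [ht.2]⟩ ht.1])
      (by linarith [hϑm ⟨ht.1.le, by linarith [ht.2]⟩ hm ht.2])
  have hs2 : ∀ t ∈ Ioo m S, Real.sin (ϑ t) < 0 := fun t ht => by
    rw [← Real.sin_sub_two_pi]
    exact Real.sin_neg_of_neg_of_neg_pi_lt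
      (by linarith [hϑm ⟨by linarith [ht.1], ht.2.le⟩ ⟨hS.le, le_rfl⟩ ht.2])
      (by linarith [hϑm hm ⟨by linarith [ht.1], ht.2.le⟩ ht.1])
  intro he
  have hW0 : W 0 = W S := by
    have e1 : Real.cos (Real.pi / 2) = 0 := Real.cos_pi_div_two
    have e2 : Real.cos (3 * Real.pi / 2) = 0 := by
      rw [show 3 * Real.pi / 2 = Real.pi / 2 + Real.pi by ring, Real.cos_add_pi, e1, neg_zero]
    simp only [hW, h0, h1, e1, e2, he]
  rcases hk with hk | hk
  · have a1 : StrictMonoOn W (Icc 0 m) := by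
      refine strictMonoOn_of_deriv_pos (convex_Icc 0 m) hWc.continuousOn fun t ht => ?_
      rw [interior_Icc] at ht
      rw [(hWd t).deriv]
      exact mul_pos (sub_pos.2 (hk ⟨ht.1, ht.2.trans hmS⟩ hmI ht.2)) (hs1 t ht)
    have a2 : StrictMonoOn W (Icc m S) := by
      refine strictMonoOn_of_deriv_pos (convex_Icc m S) hWc.continuousOn fun t ht => ?_
      rw [interior_Icc] at ht
      rw [(hWd t).deriv]
      exact mul_pos_of_neg_of_neg (sub_neg.2 (hk hmI ⟨hm0.trans ht.1, ht.2⟩ ht.1)) (hs2 t ht)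
    linarith [a1 ⟨le_rfl, hm0.le⟩ ⟨hm0.le, le_rfl⟩ hm0, a2 ⟨le_rfl, hmS.le⟩ ⟨hmS.le, le_rfl⟩ hmS]
  · have a1 : StrictAntiOn W (Icc 0 m) := by
      refine strictAntiOn_of_deriv_neg (convex_Icc 0 m) hWc.continuousOn fun t ht => ?_
      rw [interior_Icc] at ht
      rw [(hWd t).deriv]
      exact mul_neg_of_neg_of_pos (sub_neg.2 (hk ⟨ht.1, ht.2.trans hmS⟩ hmI ht.2)) (hs1 t ht)
    have a2 : StrictAntiOn W (Icc m S) := by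
      refine strictAntiOn_of_deriv_neg (convex_Icc m S) hWc.continuousOn fun t ht => ?_
      rw [interior_Icc] at ht
      rw [(hWd t).deriv]
      exact mul_neg_of_pos_of_neg (sub_pos.2 (hk hmI ⟨hm0.trans ht.1, ht.2⟩ ht.1)) (hs2 t ht)
    linarith [a1 ⟨le_rfl, hm0.le⟩ ⟨hm0.le, le_rfl⟩ hm0, a2 ⟨le_rfl, hmS.le⟩ ⟨hmS.le, le_rfl⟩ hmS]

namespace IsOrbit

variable {φ : ℝ → ℝ} {z : ℝ → ℂ} {p S : ℝ} {ϑ : ℝ → ℝ}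

lemma angle_neg (h : IsOrbit φ z p S) (hϑ : ∀ t, HasDerivAt ϑ (φ ‖z t‖) t) (t : ℝ) :
    ϑ (-t) = 2 * ϑ 0 - ϑ t := by
  have hd : ∀ t, HasDerivAt (fun t => ϑ t + ϑ (-t)) 0 t := by
    intro t
    have h1 : HasDerivAt (fun t => ϑ (-t)) (-(φ ‖z (-t)‖)) t := by
      simpa [Function.comp_def] using (hϑ (-t)).scomp t (hasDerivAt_neg t)
    refine ((hϑ t).fun_add h1).congr_deriv ?_
    rw [h.map_neg, Complex.norm_conj]; ring
  have := is_const_of_deriv_eq_zero (fun t => (hd t).differentiableAt) (fun t => (hd t).deriv) t 0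
  simp only [neg_zero] at this
  linarith

lemma angle_add_period (h : IsOrbit φ z p S) (hϑ : ∀ t, HasDerivAt ϑ (φ ‖z t‖) t) (t : ℝ) :
    ϑ (t + 2 * S) = ϑ t + 2 * (ϑ S - ϑ 0) := by
  have hd : ∀ t, HasDerivAt (fun t => ϑ (t + 2 * S) - ϑ t) 0 t := by
    intro t
    refine (((hϑ (t + 2 * S)).comp_add_const t (2 * S)).fun_sub (hϑ t)).congr_deriv ?_
    rw [h.periodic]; ring
  have := is_const_of_deriv_eq_zero (fun t => (hd t).differentiableAt) (fun t => (hd t).deriv)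
    t (-S)
  simp only [h.angle_neg hϑ S] at this
  rw [show -S + 2 * S = S by ring] at this
  linarith

lemma angle_add_int (h : IsOrbit φ z p S) (hϑ : ∀ t, HasDerivAt ϑ (φ ‖z t‖) t) (k : ℤ) (t : ℝ) :
    ϑ (t + k * (2 * S)) = ϑ t + k * (2 * (ϑ S - ϑ 0)) := by
  induction k using Int.induction_on with
  | zero => simp
  | succ n ih =>
    have := h.angle_add_period hϑ (t + n * (2 * S))
    push_cast at ih ⊢
    rw [show t + ((n : ℝ) + 1) * (2 * S) = t + n * (2 * S) + 2 * S by ring, this, ih]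
    ring
  | pred n ih =>
    have := h.angle_add_period hϑ (t + (-(n : ℝ) - 1) * (2 * S))
    push_cast at ih ⊢
    rw [show t + (-(n : ℝ) - 1) * (2 * S) + 2 * S = t + -(n : ℝ) * (2 * S) by ring, ih] at this
    linarith

lemma roll_add_int (h : IsOrbit φ z p S) (hϑ : ∀ t, HasDerivAt ϑ (φ ‖z t‖) t) (k : ℤ) (t : ℝ) :
    roll z ϑ (t + k * (2 * S)) =
      Complex.exp (Complex.I * ((k * (2 * (ϑ S - ϑ 0)) : ℝ) : ℂ)) * roll z ϑ t := by
  rw [roll, h.map_int, h.angle_add_int hϑ, roll]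
  push_cast
  rw [mul_add, Complex.exp_add]; ring

lemma pos_norm (h : IsOrbit φ z p S) {t : ℝ} (ht : t ∈ Ioo 0 S) : 0 < ‖z t‖ := by
  have := h.im_neg t ht
  rw [norm_pos_iff]
  intro h0
  simp [h0] at this

lemma angle_strictMonoOn (h : IsOrbit φ z p S) (hϑ : ∀ t, HasDerivAt ϑ (φ ‖z t‖) t) :
    StrictMonoOn ϑ (Icc 0 S) := by
  refine strictMonoOn_of_deriv_pos (convex_Icc 0 S)
    (fun t _ => (hϑ t).continuousAt.continuousWithinAt) fun t ht => ?_
  rw [interior_Icc] at ht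
  rw [(hϑ t).deriv]
  exact h.tame.pos _ (h.pos_norm ht)

lemma angle_lt (h : IsOrbit φ z p S) (hϑ : ∀ t, HasDerivAt ϑ (φ ‖z t‖) t) : ϑ 0 < ϑ S :=
  h.angle_strictMonoOn hϑ ⟨le_rfl, h.pos.le⟩ ⟨h.pos.le, le_rfl⟩ h.pos

lemma hasDerivAt_roll (h : IsOrbit φ z p S) (hϑ : ∀ t, HasDerivAt ϑ (φ ‖z t‖) t) (t : ℝ) :
    HasDerivAt (roll z ϑ) (Complex.exp (Complex.I * ϑ t)) t :=
  RadialCurvature.hasDerivAt_roll (h.flow t) (hϑ t)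

/-- A period of the curve is a period of its direction. -/
lemma exp_of_periodic_roll (h : IsOrbit φ z p S) (hϑ : ∀ t, HasDerivAt ϑ (φ ‖z t‖) t) {T : ℝ}
    (hT : Function.Periodic (roll z ϑ) T) (t : ℝ) :
    Complex.exp (Complex.I * ϑ (t + T)) = Complex.exp (Complex.I * ϑ t) := by
  have h1 := (h.hasDerivAt_roll hϑ (t + T)).comp_add_const t T
  have h2 : (fun s => roll z ϑ (s + T)) = roll z ϑ := funext hT
  rw [h2] at h1
  exact h1.unique (h.hasDerivAt_roll hϑ t)

lemma exists_int_of_periodic_roll (h : IsOrbit φ z p S) (hϑ : ∀ t, HasDerivAt ϑ (φ ‖z t‖) t)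
    {T : ℝ} (hT : Function.Periodic (roll z ϑ) T) : ∃ k : ℤ, T = k * (2 * S) := by
  apply h.exists_int_of_periodic
  intro t
  rw [← conj_roll_mul_exp z ϑ, ← conj_roll_mul_exp z ϑ t, hT t, h.exp_of_periodic_roll hϑ hT]

/-- With vertical initial tangent the curve is symmetric about the real axis. -/
lemma roll_neg (h : IsOrbit φ z p S) (hϑ : ∀ t, HasDerivAt ϑ (φ ‖z t‖) t)
    (h0 : ϑ 0 = Real.pi / 2) (t : ℝ) : roll z ϑ (-t) = (starRingEnd ℂ) (roll z ϑ t) := by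
  have h1 : ϑ (-t) = Real.pi - ϑ t := by rw [h.angle_neg hϑ, h0]; ring
  have h2 : (starRingEnd ℂ) (-Complex.I) = Complex.I := by simp
  simp only [roll, h.map_neg, h1, map_mul, h2, Complex.conj_conj, conj_exp_I_mul]
  push_cast
  rw [mul_sub, sub_eq_add_neg, Complex.exp_add, mul_comm Complex.I (Real.pi : ℂ),
    Complex.exp_pi_mul_I]
  ring

lemma angle_half_mul (h : IsOrbit φ z p S) (hϑ : ∀ t, HasDerivAt ϑ (φ ‖z t‖) t) (hp : 0 < p)
    (n : ℕ) : ∃ r : ℝ, 0 < r ∧ z (n * S) = r ∧ ϑ (n * S) = ϑ 0 + n * (ϑ S - ϑ 0) := by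
  rcases Nat.even_or_odd' n with ⟨m, hm | hm⟩
  · refine ⟨p, hp, ?_, ?_⟩
    · have := h.map_int m 0
      rw [h.map_zero] at this
      rw [← this, hm]; congr 1; push_cast; ring
    · have := h.angle_add_int hϑ m 0
      rw [zero_add] at this
      rw [hm, show ((2 * m : ℕ) : ℝ) * S = ((m : ℤ) : ℝ) * (2 * S) by push_cast; ring, this]
      push_cast; ring
  · refine ⟨(z S).re, h.tame.radius_pos.trans h.radius_lt, ?_, ?_⟩
    · have := h.map_int m S
      rw [← h.map_half, ← this, hm]; congr 1; push_cast; ring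
    · have := h.angle_add_int hϑ m S
      rw [hm, show ((2 * m + 1 : ℕ) : ℝ) * S = S + ((m : ℤ) : ℝ) * (2 * S) by push_cast; ring, this]
      push_cast; ring

/-- Near a zero where its derivative is `1`, a function changes its sign from minus to plus. -/
lemma exists_sign_change {y : ℝ → ℝ} {t₀ : ℝ} (hy : HasDerivAt y 1 t₀) (h0 : y t₀ = 0) :
    ∃ ε > 0, (∀ t ∈ Ioo t₀ (t₀ + ε), 0 < y t) ∧ ∀ t ∈ Ioo (t₀ - ε) t₀, y t < 0 := by
  have h := hy.tendsto_slope.eventually_const_lt one_pos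
  rw [eventually_nhdsWithin_iff] at h
  obtain ⟨ε, hε, hb⟩ := Metric.eventually_nhds_iff.1 h
  refine ⟨ε, hε, fun t ht => ?_, fun t ht => ?_⟩
  · have := hb (y := t) (by rw [Real.dist_eq, abs_lt]; constructor <;> linarith [ht.1, ht.2])
      ht.1.ne'
    rw [slope_def_field, h0, sub_zero, div_pos_iff_of_pos_right (by linarith [ht.1])] at this
    exact this
  · have := hb (y := t) (by rw [Real.dist_eq, abs_lt]; constructor <;> linarith [ht.1, ht.2])
      ht.2.ne
    rw [slope_def_field, h0, sub_zero] at this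
    by_contra! hcon
    exact absurd this (not_lt.2 (div_nonpos_of_nonneg_of_nonpos hcon (by linarith [ht.2])))

/-- The turn of a simple curve over a period of the flow. The symmetry about the real axis turns
every further zero of the height `y = Im c` into a double point, so that `y` vanishes only at
multiples of `S`. Where the tangent points downwards `y = Im z < 0`, so the curve makes at most
half a turn up to the time `S`, and less than that by `height_ne_of_half_turn`. For `p < 0` the
symmetry about the line through the origin and `c(S)` then produces a double point, and for `p = 0`
the curve returns to the origin in a different direction; for `p > 0` the first zero of `y` occurs
after half a turn. -/
theorem exists_turn_of_simple (h : IsOrbit φ z p S) (hϑ : ∀ t, HasDerivAt ϑ (φ ‖z t‖) t)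
    (h0 : ϑ 0 = Real.pi / 2)
    (hk : StrictMonoOn (fun t => φ ‖z t‖) (Ioo 0 S) ∨ StrictAntiOn (fun t => φ ‖z t‖) (Ioo 0 S))
    (hs : ∀ s t, roll z ϑ s = roll z ϑ t → Function.Periodic (roll z ϑ) (t - s)) :
    0 < p ∧ ∃ k : ℕ, 2 ≤ k ∧ ϑ S - ϑ 0 = Real.pi / k := by
  have hpi := Real.pi_pos
  have hS := h.pos
  have hϑc : Continuous ϑ := continuous_iff_continuousAt.2 fun t => (hϑ t).continuousAt
  set c := roll z ϑ with hc
  set y : ℝ → ℝ := fun t => (c t).im with hy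
  have hyd : ∀ t, HasDerivAt y (Real.sin (ϑ t)) t := fun t => by
    have := hasDerivAt_im (h.hasDerivAt_roll hϑ t)
    rwa [exp_I_mul_im] at this
  have hyc : Continuous y := continuous_iff_continuousAt.2 fun t => (hyd t).continuousAt
  have hexp0 : Complex.exp (Complex.I * ((Real.pi / 2 : ℝ) : ℂ)) = Complex.I := by
    push_cast; rw [mul_comm]; exact Complex.exp_pi_div_two_mul_I
  have hexp1 : Complex.exp (Complex.I * ((3 * Real.pi / 2 : ℝ) : ℂ)) = -Complex.I := by
    rw [show Complex.I * ((3 * Real.pi / 2 : ℝ) : ℂ) =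
      Complex.I * ((Real.pi / 2 : ℝ) : ℂ) + Real.pi * Complex.I by push_cast; ring,
      Complex.exp_add, hexp0, Complex.exp_pi_mul_I]; ring
  have hc0 : c 0 = p := by
    rw [hc, roll, h.map_zero, h0, hexp0, Complex.conj_ofReal]
    linear_combination (-(p : ℂ)) * Complex.I_mul_I
  have hy0 : y 0 = 0 := by simp [hy, hc0]
  have hzero : ∀ t, y t = 0 → ∃ k : ℤ, t = k * S := by
    intro t ht
    have h1 : c (-t) = c t := by
      rw [hc, h.roll_neg hϑ h0, Complex.conj_eq_iff_im]; exact ht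
    obtain ⟨k, hk⟩ := h.exists_int_of_periodic_roll hϑ (hs _ _ h1)
    exact ⟨k, by linarith⟩
  have hnz : ∀ t ∈ Ioo 0 S, y t ≠ 0 := by
    intro t ht h1
    obtain ⟨k, hk⟩ := hzero t h1
    have h2 : (0 : ℝ) < k := by
      by_contra! hcon
      nlinarith [ht.1]
    have h3 : (k : ℝ) < 1 := by
      by_contra! hcon
      nlinarith [ht.2]
    have h4 : (0 : ℤ) < k := by exact_mod_cast h2
    have h5 : (k : ℤ) < 1 := by exact_mod_cast h3
    omega
  have hypos : ∀ t ∈ Ioo 0 S, 0 < y t := by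
    obtain ⟨ε, hε, hpos, -⟩ := exists_sign_change (y := y) (t₀ := 0)
      (by have := hyd 0; rwa [h0, Real.sin_pi_div_two] at this) hy0
    intro t ht
    by_contra! hcon
    set s := min (ε / 2) (t / 2) with hsdef
    have h1 := min_le_left (ε / 2) (t / 2)
    have h2 := min_le_right (ε / 2) (t / 2)
    have h3 : 0 < s := lt_min (by linarith) (by linarith [ht.1])
    have h4 := hpos s ⟨h3, by linarith⟩
    obtain ⟨u, hu, hu0⟩ := intermediate_value_Icc' (show s ≤ t by linarith [ht.1])
      hyc.continuousOn (show (0 : ℝ) ∈ Icc _ _ from ⟨hcon, h4.le⟩)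
    exact hnz u ⟨by linarith [hu.1], by linarith [hu.2, ht.2]⟩ hu0
  -- when the tangent points downwards the height is `Im z`, which is negative
  have hϑS : ϑ S ≤ 3 * Real.pi / 2 := by
    by_contra! hcon
    obtain ⟨t, ht, htϑ⟩ := intermediate_value_Icc hS.le hϑc.continuousOn
      (show 3 * Real.pi / 2 ∈ Icc _ _ from ⟨by linarith, hcon.le⟩)
    have ht' : t ∈ Ioo 0 S := by
      refine ⟨lt_of_le_of_ne ht.1 ?_, lt_of_le_of_ne ht.2 ?_⟩
      · rintro rfl; linarith
      · rintro rfl; linarith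
    have h1 := hypos t ht'
    have h2 := h.im_neg t ht'
    have h3 : y t = (z t).im := by
      simp only [hy, hc, roll, htϑ, hexp1]
      simp
    linarith
  have hcS : c S = ((z S).re : ℂ) * Complex.exp (Complex.I * ((ϑ S - ϑ 0 : ℝ) : ℂ)) := by
    have e : Complex.exp (Complex.I * ϑ S) =
        Complex.I * Complex.exp (Complex.I * ((ϑ S - ϑ 0 : ℝ) : ℂ)) := by
      rw [← exp_I_mul_pi_div_two_add, h0]; congr 3; ring
    rw [hc, roll, h.map_half, Complex.conj_ofReal, e, Complex.ofReal_re]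
    linear_combination (-((z S).re : ℂ) * Complex.exp (Complex.I * ((ϑ S - ϑ 0 : ℝ) : ℂ))) *
      Complex.I_mul_I
  have hϑS' : ϑ S < 3 * Real.pi / 2 := by
    refine lt_of_le_of_ne hϑS fun he => ?_
    refine height_ne_of_half_turn hS hϑ hyd h0 he
      (fun t ht => h.tame.pos _ (h.pos_norm ht)) hk ?_
    rw [hy0]
    simp only [hy]
    rw [hcS, Complex.im_ofReal_mul, exp_I_mul_im, he, h0,
      show 3 * Real.pi / 2 - Real.pi / 2 = Real.pi by ring, Real.sin_pi, mul_zero]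
  have hlt := h.angle_lt hϑ
  set A := ϑ S - ϑ 0 with hA
  have hA0 : 0 < A := by linarith
  have hAπ : A < Real.pi := by linarith
  have hX0 : 0 < (z S).re := h.tame.radius_pos.trans h.radius_lt
  rcases lt_trichotomy p 0 with hp | hp | hp
  · -- symmetry about the line through the origin and the point `c S`
    exfalso
    set v : ℝ → ℝ := fun t => (Complex.exp (-(Complex.I * (A : ℂ))) * c t).im with hv
    have hvd : ∀ t, HasDerivAt v (Real.sin (ϑ t - A)) t := fun t => by
      have h1 := hasDerivAt_im ((h.hasDerivAt_roll hϑ t).const_mul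
        (Complex.exp (-(Complex.I * (A : ℂ)))))
      rwa [← conj_exp_I_mul, conj_exp_mul_exp, exp_I_mul_im, conj_exp_I_mul] at h1
    have hvc : Continuous v := continuous_iff_continuousAt.2 fun t => (hvd t).continuousAt
    have hvS : v S = 0 := by
      simp only [hv]
      rw [hcS, mul_left_comm, ← Complex.exp_add, neg_add_cancel, Complex.exp_zero, mul_one,
        Complex.ofReal_im]
    have hv0 : 0 < v 0 := by
      simp only [hv]
      rw [hc0, mul_comm, Complex.im_ofReal_mul, ← conj_exp_I_mul, Complex.conj_im, exp_I_mul_im]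
      have := Real.sin_pos_of_pos_of_lt_pi hA0 hAπ
      nlinarith
    obtain ⟨ε, hε, -, hneg⟩ := exists_sign_change (y := v) (t₀ := S)
      (by
        have := hvd S
        rwa [show ϑ S - A = Real.pi / 2 by rw [hA, h0]; ring, Real.sin_pi_div_two] at this) hvS
    set s := S - min (ε / 2) (S / 2) with hsdef
    have h1 := min_le_left (ε / 2) (S / 2)
    have h2 := min_le_right (ε / 2) (S / 2)
    have h3 : 0 < min (ε / 2) (S / 2) := lt_min (by linarith) (by linarith)
    have h4 := hneg s ⟨by linarith, by linarith⟩
    obtain ⟨u, hu, hu0⟩ := intermediate_value_Icc' (show 0 ≤ s by linarith)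
      hvc.continuousOn (show (0 : ℝ) ∈ Icc _ _ from ⟨h4.le, hv0.le⟩)
    have hu1 : 0 < u := by
      refine lt_of_le_of_ne hu.1 ?_
      rintro rfl
      linarith
    have hu2 : u < S := by linarith [hu.2]
    have h5 : c (2 * S - u) = Complex.exp (Complex.I * ((2 * A : ℝ) : ℂ)) *
        (starRingEnd ℂ) (c u) := by
      have := h.roll_add_int hϑ 1 (-u)
      rw [h.roll_neg hϑ h0] at this
      simp only [Int.cast_one, one_mul] at this
      rw [hc, ← this]; congr 1; ring
    have h6 : (starRingEnd ℂ) (Complex.exp (-(Complex.I * (A : ℂ))) * c u) =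
        Complex.exp (-(Complex.I * (A : ℂ))) * c u := Complex.conj_eq_iff_im.2 hu0
    rw [map_mul, ← conj_exp_I_mul, Complex.conj_conj, conj_exp_I_mul] at h6
    have h7 : c u = c (2 * S - u) := by
      rw [h5]
      have e1 : Complex.exp (Complex.I * ((2 * A : ℝ) : ℂ)) =
          Complex.exp (Complex.I * (A : ℂ)) * Complex.exp (Complex.I * (A : ℂ)) := by
        rw [← Complex.exp_add]; congr 1; push_cast; ring
      rw [e1, mul_assoc, h6, ← mul_assoc, ← Complex.exp_add, add_neg_cancel, Complex.exp_zero,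
        one_mul]
    obtain ⟨k, hk⟩ := h.exists_int_of_periodic_roll hϑ (hs _ _ h7)
    have h8 : (0 : ℝ) < k := by
      by_contra! hcon
      nlinarith
    have h9 : (k : ℝ) < 1 := by
      by_contra! hcon
      nlinarith
    have h10 : (0 : ℤ) < k := by exact_mod_cast h8
    have h11 : (k : ℤ) < 1 := by exact_mod_cast h9
    omega
  · -- the curve passes through the origin at both ends of a period
    exfalso
    have h1 : c 0 = c (2 * S) := by
      have := h.roll_add_int hϑ 1 0
      simp only [Int.cast_one, one_mul, zero_add] at this
      rw [hc, this, ← hc, hc0, hp]; simp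
    have h2 := h.exp_of_periodic_roll hϑ (hs _ _ h1) 0
    rw [sub_zero, h.angle_add_period hϑ] at h2
    obtain ⟨n, hn⟩ := Complex.exp_eq_exp_iff_exists_int.1 h2
    have h3 : ϑ 0 + 2 * A = ϑ 0 + n * (2 * Real.pi) := by
      have := congrArg Complex.im hn
      simpa using this
    have h4 : (0 : ℝ) < n := by
      by_contra! hcon
      nlinarith
    have h5 : (n : ℝ) < 1 := by
      by_contra! hcon
      nlinarith
    have h6 : (0 : ℤ) < n := by exact_mod_cast h4
    have h7 : (n : ℤ) < 1 := by exact_mod_cast h5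
    omega
  · refine ⟨hp, ?_⟩
    -- at the multiples of `S` the curve has the direction of `e^{inA}` from the origin
    have hyn : ∀ n : ℕ, ∃ r : ℝ, 0 < r ∧ y (n * S) = r * Real.sin (n * A) := by
      intro n
      obtain ⟨r, hr, hzr, hϑr⟩ := h.angle_half_mul hϑ hp n
      refine ⟨r, hr, ?_⟩
      simp only [hy, hc, roll]
      rw [hzr, hϑr, ← hA, h0, Complex.conj_ofReal, mul_comm (-Complex.I), mul_assoc,
        Complex.im_ofReal_mul]
      congr 1
      have e : -Complex.I * Complex.exp (Complex.I * ((Real.pi / 2 + n * A : ℝ) : ℂ)) =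
          Complex.exp (Complex.I * ((n * A : ℝ) : ℂ)) := by
        rw [exp_I_mul_pi_div_two_add]
        linear_combination (-Complex.exp (Complex.I * ((n * A : ℝ) : ℂ))) * Complex.I_mul_I
      rw [← exp_I_mul_im, ← e]
    -- the first multiple of `S` at which this direction has turned by at least `π`
    set j := ⌈Real.pi / A⌉₊ with hj
    have hj1 : Real.pi ≤ j * A := by
      rw [← div_le_iff₀ hA0]; exact Nat.le_ceil _
    have hj2 : j * A < 2 * Real.pi := by
      have := Nat.ceil_lt_add_one (show 0 ≤ Real.pi / A by positivity)
      have h1 : (j : ℝ) * A < (Real.pi / A + 1) * A := by gcongr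
      rw [add_mul, div_mul_cancel₀ _ hA0.ne'] at h1
      linarith
    have hj3 : (1 : ℝ) < j := by
      by_contra! hcon
      nlinarith
    have hyj : y (j * S) ≤ 0 := by
      obtain ⟨r, hr, hyr⟩ := hyn j
      rw [hyr]
      have : Real.sin (j * A) ≤ 0 := by
        rw [← Real.sin_sub_two_pi]
        exact Real.sin_nonpos_of_nonpos_of_neg_pi_le (by linarith) (by linarith)
      nlinarith
    have hyS : 0 < y (S / 2) := hypos _ ⟨by linarith, by linarith⟩
    obtain ⟨u, hu, hu0⟩ := intermediate_value_Icc' (show S / 2 ≤ j * S by nlinarith)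
      hyc.continuousOn (show (0 : ℝ) ∈ Icc _ _ from ⟨hyj, hyS.le⟩)
    obtain ⟨k, hk⟩ := hzero u hu0
    have hk0 : (0 : ℝ) < k := by
      by_contra! hcon
      nlinarith [hu.1]
    have hkj : (k : ℝ) ≤ j := by
      by_contra! hcon
      nlinarith [hu.2]
    lift k to ℕ using (by
      have : (0 : ℤ) < k := by exact_mod_cast hk0
      exact this.le)
    simp only [Int.cast_natCast] at hk hk0 hkj
    obtain ⟨r, hr, hyr⟩ := hyn k
    rw [← hk, hu0] at hyr
    have hsin : Real.sin (k * A) = 0 := by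
      rcases mul_eq_zero.1 hyr.symm with h1 | h1
      · exact absurd h1 hr.ne'
      · exact h1
    have hkA : k * A = Real.pi := by
      have h1 : 0 < k * A := by positivity
      have h2 : k * A < 2 * Real.pi := lt_of_le_of_lt (by gcongr) hj2
      have h3 := (Real.sin_eq_zero_iff_of_lt_of_lt (x := k * A - Real.pi)
        (by linarith) (by linarith)).1 (by rw [Real.sin_sub_pi, hsin, neg_zero])
      linarith
    refine ⟨k, ?_, ?_⟩
    · have h1 : (1 : ℝ) < k := by
        by_contra! hcon
        nlinarith
      have : 1 < k := by exact_mod_cast h1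
      omega
    · rw [← hkA]; field_simp

/-- If the turn over a period is `2π / n`, the curve closes up after `n` periods as a convex
loop around the origin. -/
theorem isConvexLoop_roll (h : IsOrbit φ z p S) (hϑ : ∀ t, HasDerivAt ϑ (φ ‖z t‖) t) (hp : 0 < p)
    {n : ℕ} (hn : 0 < n) (hA : ϑ S - ϑ 0 = Real.pi / n) :
    IsConvexLoop (roll z ϑ) (fun t => Complex.exp (Complex.I * ϑ t)) (n * (2 * S)) := by
  have hn' : (0 : ℝ) < n := by exact_mod_cast hn
  have hS := h.pos
  have hnA : (n : ℝ) * (2 * (ϑ S - ϑ 0)) = 2 * Real.pi := by rw [hA]; field_simp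
  refine isConvexLoop_of_turn (h.hasDerivAt_roll hϑ)
    (continuous_iff_continuousAt.2 fun t => (hϑ t).continuousAt) ?_ (by positivity) ?_ ?_
  · refine strictMono_of_deriv_pos fun t => ?_
    rw [(hϑ t).deriv]
    exact h.tame.pos _ (lt_of_lt_of_le (abs_pos.2 hp.ne') (h.abs_le_norm t))
  · intro t
    have := h.angle_add_int hϑ n t
    simp only [Int.cast_natCast] at this
    rw [this, hnA]
  · intro t
    have := h.roll_add_int hϑ n t
    simp only [Int.cast_natCast] at this
    rw [this, hnA, show Complex.I * ((2 * Real.pi : ℝ) : ℂ) = 2 * Real.pi * Complex.I by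
      push_cast; ring, Complex.exp_two_pi_mul_I, one_mul]

/-- The orbit of the planar flow itself is a convex loop, being a level set of a strictly convex
function. -/
theorem isConvexLoop (h : IsOrbit φ z p S) :
    IsConvexLoop z (fun t => field φ (z t)) (2 * S) where
  hasDerivAt := h.flow
  continuous_deriv := h.tame.lipschitz_field.choose_spec.continuous.comp h.flow.continuous
  pos := by linarith [h.pos]
  periodic := h.periodic
  injOn := by
    intro s hs t ht hst
    obtain ⟨k, hk⟩ := h.exists_int_of_map_eq hst
    have hS := h.pos
    have h1 : (k : ℝ) < 1 := by
      by_contra! hcon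
      nlinarith [hs.1, hs.2, ht.1, ht.2]
    have h2 : (-1 : ℝ) < k := by
      by_contra! hcon
      nlinarith [hs.1, hs.2, ht.1, ht.2]
    have h3 : k < 1 := by exact_mod_cast h1
    have h4 : -1 < k := by exact_mod_cast h2
    have h5 : k = 0 := by omega
    rw [h5] at hk
    simp at hk
    linarith
  left := by
    intro s t hst
    have h1 := h.tame.energyDiff_lt_sub hst
    rw [h.flow.energy_eq h.tame t s, sub_self] at h1
    simp only [energyDiff] at h1
    rw [Complex.mul_im, Complex.conj_re, Complex.conj_im, field_re, field_im]
    linarith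

theorem loopCCW (h : IsOrbit φ z p S) : LoopCCW z (2 * S) := by
  refine h.isConvexLoop.loopCCW (q₀ := h.tame.radius) fun t => ?_
  have h1 := h.tame.energyDiff_lt_sub (h.map_ne_radius t)
  have h2 := h.tame.energy_radius_lt (h.map_ne_radius t)
  simp only [energyDiff] at h1
  rw [Complex.mul_im, Complex.conj_re, Complex.conj_im, field_re, field_im]
  linarith

end IsOrbit

/-- The origin lies to the left of the tangents of the curve where `Re z > 0`. -/
lemma roll_left (z : ℝ → ℂ) (ϑ : ℝ → ℝ) (t : ℝ) :
    ((starRingEnd ℂ) (Complex.exp (Complex.I * ϑ t)) * (0 - roll z ϑ t)).im = (z t).re := by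
  have h : (starRingEnd ℂ) (Complex.exp (Complex.I * ϑ t)) * Complex.exp (Complex.I * ϑ t) = 1 := by
    rw [conj_exp_mul_exp]; simp
  have : (starRingEnd ℂ) (Complex.exp (Complex.I * ϑ t)) * (0 - roll z ϑ t) =
      Complex.I * (starRingEnd ℂ) (z t) := by
    rw [roll]; linear_combination (Complex.I * (starRingEnd ℂ) (z t)) * h
  rw [this]; simp

/-! ### Global parametrization of closed maximal solutions -/

/-- The members of `𝓕` with `f > 0` and `F'' > 0`, described by monotonicity. -/
structure PosCurv (f : ℝ → ℝ) : Prop where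
  smooth : ContDiffOn ℝ ∞ f (Ioi 0)
  pos : ∀ s, 0 < s → 0 < f s
  strictMonoOn_mul : StrictMonoOn (fun s => s * f s) (Ioi 0)
  strict : StrictMonoOn f (Ioi 0) ∨ StrictAntiOn f (Ioi 0)

lemma PosCurv.differentiableAt {f : ℝ → ℝ} (hf : PosCurv f) {s : ℝ} (hs : 0 < s) :
    DifferentiableAt ℝ f s :=
  (hf.smooth.contDiffAt (Ioi_mem_nhds hs)).differentiableAt (by simp)

lemma PosCurv.exists_lipschitz {f : ℝ → ℝ} (hf : PosCurv f) {a b : ℝ}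
    (h : 0 < a ∨ ∃ ε > 0, ∃ K, ∀ s ∈ Ioo 0 ε, |deriv f s| ≤ K) :
    ∃ K : NNReal, LipschitzOnWith K f (Icc a b ∩ Ioi 0) := by
  have hdc : ContinuousOn (deriv f) (Ioi 0) :=
    hf.smooth.continuousOn_deriv_of_isOpen isOpen_Ioi (by simp)
  obtain ⟨K, hK⟩ : ∃ K, ∀ s ∈ Icc a b ∩ Ioi 0, |deriv f s| ≤ K := by
    rcases h with h | ⟨ε, hε, K, hK⟩
    · obtain ⟨K, hK⟩ := isCompact_Icc.exists_bound_of_continuousOn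
        (hdc.mono (fun s hs => h.trans_le hs.1) : ContinuousOn (deriv f) (Icc a b))
      exact ⟨K, fun s hs => hK s hs.1⟩
    · obtain ⟨K', hK'⟩ := isCompact_Icc.exists_bound_of_continuousOn
        (hdc.mono (fun s hs => (half_pos hε).trans_le hs.1) :
          ContinuousOn (deriv f) (Icc (ε / 2) b))
      refine ⟨max K K', fun s hs => ?_⟩
      rcases lt_or_ge s ε with h1 | h1
      · exact (hK s ⟨hs.2, h1⟩).trans (le_max_left _ _)
      · exact (hK' s ⟨by linarith, hs.1.2⟩).trans (le_max_right _ _)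
  refine ⟨K.toNNReal, Convex.lipschitzOnWith_of_nnnorm_deriv_le
    (fun s hs => hf.differentiableAt hs.2) (fun s hs => ?_)
    ((convex_Icc a b).inter (convex_Ioi 0))⟩
  rw [← NNReal.coe_le_coe, coe_nnnorm, Real.norm_eq_abs]
  exact (hK s hs).trans (Real.le_coe_toNNReal K)

namespace ArcCurve

lemma hasDerivAt_c {C : ArcCurve} {ϑ : ℝ → ℝ} (hϑ : IsTangentAngle C.c C.J ϑ) {t : ℝ}
    (ht : t ∈ C.J) : HasDerivAt C.c (Complex.exp (Complex.I * ϑ t)) t := by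
  rw [← hϑ.2 t ht]
  exact ((C.smooth.contDiffAt (C.isOpen_J.mem_nhds ht)).differentiableAt (by simp)).hasDerivAt

lemma hasDerivAt_angle {C : ArcCurve} {ϑ : ℝ → ℝ} (hϑ : IsTangentAngle C.c C.J ϑ) {t : ℝ}
    (ht : t ∈ C.J) : HasDerivAt ϑ (deriv ϑ t) t :=
  ((hϑ.1.contDiffAt (C.isOpen_J.mem_nhds ht)).differentiableAt (by simp)).hasDerivAt

/-- The planar coordinate `-i c̄ e^{iϑ}` of a curve with tangent angle `ϑ`. -/
noncomputable def planar (C : ArcCurve) (ϑ : ℝ → ℝ) (t : ℝ) : ℂ :=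
  -Complex.I * (starRingEnd ℂ) (C.c t) * Complex.exp (Complex.I * ϑ t)

lemma norm_planar (C : ArcCurve) (ϑ : ℝ → ℝ) (t : ℝ) : ‖C.planar ϑ t‖ = ‖C.c t‖ := by
  simp [planar]

/-- The planar coordinate and the curve are related by the same involution in both
directions. -/
lemma roll_planar (C : ArcCurve) (ϑ : ℝ → ℝ) (t : ℝ) : roll (C.planar ϑ) ϑ t = C.c t :=
  conj_roll_mul_exp C.c ϑ t

lemma hasDerivAt_planar {C : ArcCurve} {ϑ : ℝ → ℝ} (hϑ : IsTangentAngle C.c C.J ϑ) {t : ℝ}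
    (ht : t ∈ C.J) : HasDerivAt (C.planar ϑ)
      (Complex.I * C.planar ϑ t * ((deriv ϑ t : ℝ) : ℂ) - Complex.I) t := by
  have h := ((hasDerivAt_conj (hasDerivAt_c hϑ ht)).const_mul (-Complex.I)).fun_mul
    (hasDerivAt_exp_I_mul (hasDerivAt_angle hϑ ht))
  refine h.congr_deriv ?_
  have h1 : (starRingEnd ℂ) (Complex.exp (Complex.I * ϑ t)) *
      Complex.exp (Complex.I * ϑ t) = 1 := by
    rw [conj_exp_mul_exp]; simp
  simp only [planar]
  linear_combination (-Complex.I) * h1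

/-- The planar coordinate follows the planar flow; at a passage through the origin this holds
whatever the curvature. -/
lemma hasDerivAt_planar_field {f φ : ℝ → ℝ} {C : ArcCurve} {ϑ : ℝ → ℝ}
    (hϑ : IsTangentAngle C.c C.J ϑ) (hsol : ∀ t ∈ C.J, C.c t ≠ 0 → deriv ϑ t = f ‖C.c t‖)
    (hφ : ∀ t ∈ C.J, C.c t ≠ 0 → φ ‖C.c t‖ = f ‖C.c t‖) {t : ℝ} (ht : t ∈ C.J) :
    HasDerivAt (C.planar ϑ) (field φ (C.planar ϑ t)) t := by
  have h := hasDerivAt_planar hϑ ht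
  by_cases h0 : C.c t = 0
  · have h1 : C.planar ϑ t = 0 := by simp [planar, h0]
    rw [h1] at h ⊢
    simpa [field] using h
  · rw [hsol t ht h0, ← hφ t ht h0, ← C.norm_planar ϑ] at h
    exact h

/-- A solution that passes smoothly through the origin forces `f'` to be bounded near `0`: along
the curve the curvature has a bounded derivative, and the distance from the origin grows at least
at the rate `1 / 2`. -/
lemma bounded_deriv_of_zero {f : ℝ → ℝ} (hf : PosCurv f) {C : ArcCurve} {ϑ : ℝ → ℝ}
    (hϑ : IsTangentAngle C.c C.J ϑ) (hsol : ∀ t ∈ C.J, C.c t ≠ 0 → deriv ϑ t = f ‖C.c t‖)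
    {t₀ : ℝ} (ht₀ : t₀ ∈ C.J) (h0 : C.c t₀ = 0) :
    ∃ ε > 0, ∃ K, ∀ s ∈ Ioo 0 ε, |deriv f s| ≤ K := by
  set v : ℝ → ℂ := fun t => Complex.exp (Complex.I * ϑ t) with hv
  have hvc : ContinuousAt v t₀ := by
    have h1 := (hasDerivAt_angle hϑ ht₀).continuousAt
    exact Complex.continuous_exp.continuousAt.comp
      (continuousAt_const.mul (Complex.continuous_ofReal.continuousAt.comp h1))
  have hv1 : ∀ t, ‖v t‖ = 1 := fun t => norm_exp_I_mul (ϑ t)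
  have hk : ContDiffOn ℝ ∞ (deriv ϑ) C.J := hϑ.1.deriv_of_isOpen C.isOpen_J (by simp)
  have hk2 : ContinuousOn (deriv (deriv ϑ)) C.J :=
    hk.continuousOn_deriv_of_isOpen C.isOpen_J (by simp)
  have hk2b : ∀ᶠ t in 𝓝 t₀, |deriv (deriv ϑ) t| < |deriv (deriv ϑ) t₀| + 1 :=
    ((hk2.continuousAt (C.isOpen_J.mem_nhds ht₀)).abs).eventually_lt_const (by linarith)
  have hvb : ∀ᶠ t in 𝓝 t₀, dist (v t) (v t₀) < 1 / 8 :=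
    hvc.eventually (Metric.ball_mem_nhds _ (by norm_num))
  have hJev : ∀ᶠ t in 𝓝 t₀, t ∈ C.J := C.isOpen_J.mem_nhds ht₀
  obtain ⟨δ, hδ, hb⟩ := Metric.eventually_nhds_iff_ball.1 (hJev.and (hk2b.and hvb))
  -- near `t₀` the curve is close to a line
  have hlin : ∀ t ∈ Metric.ball t₀ δ, ‖C.c t - ((t - t₀ : ℝ) : ℂ) * v t‖ ≤ 1 / 4 * |t - t₀| := by
    intro t ht
    have h1 : ∀ s ∈ Metric.ball t₀ δ, HasDerivWithinAt (fun s : ℝ => C.c s - (s : ℂ) * v t)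
        (v s - v t) (Metric.ball t₀ δ) s := fun s hs => by
      simpa using ((hasDerivAt_c hϑ (hb s hs).1).fun_sub
        ((hasDerivAt_id s).ofReal_comp.mul_const (v t))).hasDerivWithinAt
    have h2 := (convex_ball t₀ δ).norm_image_sub_le_of_norm_hasDerivWithin_le (C := 1 / 4) h1
      (fun s hs => by
        have h3 := (hb s hs).2.2
        have h4 := (hb t ht).2.2
        rw [← dist_eq_norm]
        have := dist_triangle_right (v s) (v t) (v t₀)
        linarith) (Metric.mem_ball_self hδ) ht
    rw [h0, Real.norm_eq_abs] at h2
    have h5 : C.c t - (t : ℂ) * v t - (0 - (t₀ : ℂ) * v t) = C.c t - ((t - t₀ : ℝ) : ℂ) * v t := by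
      push_cast; ring
    rwa [h5] at h2
  set r : ℝ → ℝ := fun t => ‖C.c t‖ with hr
  set t₁ := t₀ + δ / 2 with ht₁
  have hmem : ∀ t ∈ Ioc t₀ t₁, t ∈ Metric.ball t₀ δ := fun t ht => by
    rw [Metric.mem_ball, Real.dist_eq, abs_lt]
    constructor <;> linarith [ht.1, ht.2]
  have hlow : ∀ t ∈ Ioc t₀ t₁, 3 / 4 * (t - t₀) ≤ r t := by
    intro t ht
    have h1 := hlin t (hmem t ht)
    have h2 : ‖((t - t₀ : ℝ) : ℂ) * v t‖ = t - t₀ := by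
      rw [norm_mul, hv1, mul_one, Complex.norm_real, Real.norm_of_nonneg (by linarith [ht.1])]
    rw [abs_of_pos (by linarith [ht.1]), norm_sub_rev] at h1
    have h3 := norm_sub_norm_le (((t - t₀ : ℝ) : ℂ) * v t) (C.c t)
    simp only [hr]
    linarith
  have hup : ∀ t ∈ Ioc t₀ t₁, r t ≤ 5 / 4 * (t - t₀) := by
    intro t ht
    have h1 := hlin t (hmem t ht)
    have h2 : ‖((t - t₀ : ℝ) : ℂ) * v t‖ = t - t₀ := by
      rw [norm_mul, hv1, mul_one, Complex.norm_real, Real.norm_of_nonneg (by linarith [ht.1])]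
    rw [abs_of_pos (by linarith [ht.1])] at h1
    have h3 := norm_sub_norm_le (C.c t) (((t - t₀ : ℝ) : ℂ) * v t)
    simp only [hr]
    linarith
  have hrd : ∀ t ∈ Ioc t₀ t₁, ∃ d, 1 / 2 ≤ d ∧ HasDerivAt r d t := by
    intro t ht
    have hpos : 0 < r t := lt_of_lt_of_le (by linarith [ht.1]) (hlow t ht)
    have hd := hasDerivAt_c hϑ (hb t (hmem t ht)).1
    have h1 : HasDerivAt (fun t => (C.c t).re ^ 2 + (C.c t).im ^ 2)
        (2 * ((C.c t).re * (v t).re + (C.c t).im * (v t).im)) t := by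
      refine (((hasDerivAt_re hd).fun_pow 2).fun_add ((hasDerivAt_im hd).fun_pow 2)).congr_deriv ?_
      push_cast; ring
    have h2 : 0 < (C.c t).re ^ 2 + (C.c t).im ^ 2 := by
      rw [← norm_sq_re_im]
      exact pow_pos hpos 2
    have h3 := h1.sqrt h2.ne'
    simp only [← norm_eq_sqrt_re_im] at h3
    refine ⟨_, ?_, h3⟩
    rw [mul_div_mul_left _ _ two_ne_zero, le_div_iff₀ hpos]
    -- the component of `c` along the tangent
    have h4 : (C.c t).re * (v t).re + (C.c t).im * (v t).im =
        (t - t₀) + ((C.c t - ((t - t₀ : ℝ) : ℂ) * v t) * (starRingEnd ℂ) (v t)).re := by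
      have h5 := norm_sq_re_im (v t)
      rw [hv1] at h5
      simp
      linear_combination -(t - t₀) * h5
    have h6 := (abs_le.1 (Complex.abs_re_le_norm
      ((C.c t - ((t - t₀ : ℝ) : ℂ) * v t) * (starRingEnd ℂ) (v t)))).1
    rw [norm_mul, Complex.norm_conj, hv1, mul_one] at h6
    have h7 := hlin t (hmem t ht)
    rw [abs_of_pos (by linarith [ht.1])] at h7
    rw [h4]
    linarith [hup t ht, ht.1]
  have hrc : ContinuousOn r (Icc t₀ t₁) := fun t ht =>
    ((hasDerivAt_c hϑ (hb t (by
      rw [Metric.mem_ball, Real.dist_eq, abs_lt]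
      constructor <;> linarith [ht.1, ht.2])).1).continuousAt.norm).continuousWithinAt
  refine ⟨r t₁, lt_of_lt_of_le (by linarith) (hlow t₁ ⟨by linarith, le_rfl⟩),
    2 * (|deriv (deriv ϑ) t₀| + 1), fun s hs => ?_⟩
  obtain ⟨t, ht, hts⟩ := intermediate_value_Icc (show t₀ ≤ t₁ by linarith) hrc
    (show s ∈ Icc _ _ from ⟨by simp only [hr, h0, norm_zero]; exact hs.1.le, hs.2.le⟩)
  have ht' : t ∈ Ioc t₀ t₁ := by
    refine ⟨lt_of_le_of_ne ht.1 ?_, ht.2⟩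
    rintro rfl
    simp only [hr, h0, norm_zero] at hts
    exact hs.1.ne hts
  obtain ⟨d, hd, hrd'⟩ := hrd t ht'
  have htJ := (hb t (hmem t ht')).1
  have hfd : HasDerivAt (fun t => f (r t)) (deriv f s * d) t := by
    rw [← hts]
    exact HasDerivAt.comp t (hf.differentiableAt (by rw [hts]; exact hs.1)).hasDerivAt hrd'
  have hkd : HasDerivAt (deriv ϑ) (deriv f s * d) t := by
    refine hfd.congr_of_eventuallyEq ?_
    have hne : ∀ᶠ u in 𝓝 t, C.c u ≠ 0 := by
      refine (hasDerivAt_c hϑ htJ).continuousAt.eventually_ne ?_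
      rw [← norm_pos_iff]
      exact lt_of_lt_of_eq hs.1 hts.symm
    filter_upwards [hne, C.isOpen_J.mem_nhds htJ] with u hu huJ using hsol u huJ hu
  have h8 := (hb t (hmem t ht')).2.1
  rw [hkd.deriv, abs_mul] at h8
  have h9 : 1 / 2 ≤ |d| := hd.trans (le_abs_self d)
  nlinarith [abs_nonneg (deriv f s)]

end ArcCurve

/-- A description of all of the curve `𝒞` by an orbit, defined for all time, of the planar flow
of a tame curvature function `φ`; this function agrees with `f` at the radii on the curve, but
possibly not at the origin, where the value of `f` is irrelevant. The starting point of the orbit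
does not depend on the choice of a tangent angle of `𝒞`. -/
structure IsGlobalParam (f : ℝ → ℝ) (C : ArcCurve) (φ : ℝ → ℝ) (z : ℝ → ℂ) (ϑ : ℝ → ℝ) :
    Prop where
  tame : Tame φ
  flow : IsPlanarFlow φ z
  angle : ∀ t, HasDerivAt ϑ (φ ‖z t‖) t
  agree : ∀ t, z t ≠ 0 → φ ‖z t‖ = f ‖z t‖
  smooth : ContDiff ℝ ∞ z
  smooth_angle : ContDiff ℝ ∞ ϑ
  eqOn : EqOn (roll z ϑ) C.c C.J
  eqOn_angle : ∀ ϑ', IsTangentAngle C.c C.J ϑ' → z 0 = C.planar ϑ' 0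
  range_eq : range (roll z ϑ) = C.trace

/-- Off the origin, an orbit of the planar flow is as smooth as the curvature function. -/
lemma contDiffOn_flow {f φ : ℝ → ℝ} (hf : ContDiffOn ℝ ∞ f (Ioi 0)) {z : ℝ → ℂ} {ϑ : ℝ → ℝ}
    (hz : IsPlanarFlow φ z) (hϑ : ∀ t, HasDerivAt ϑ (φ ‖z t‖) t) {U : Set ℝ} (hU : IsOpen U)
    (h0 : ∀ t ∈ U, z t ≠ 0) (hφ : ∀ t ∈ U, φ ‖z t‖ = f ‖z t‖) :
    ContDiffOn ℝ ∞ z U ∧ ContDiffOn ℝ ∞ ϑ U := by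
  have hcomp : ∀ n : ℕ, ContDiffOn ℝ n z U → ContDiffOn ℝ n (fun t => f ‖z t‖) U := fun n hn =>
    ContDiffOn.comp (hf.of_le (by exact_mod_cast le_top)) (hn.norm ℝ h0)
      (fun t ht => norm_pos_iff.2 (h0 t ht))
  have hz' : ∀ n : ℕ, ContDiffOn ℝ n z U := by
    intro n
    induction n with
    | zero => exact contDiffOn_zero.2 hz.continuous.continuousOn
    | succ n ih =>
      push_cast
      rw [contDiffOn_succ_iff_deriv_of_isOpen hU]
      refine ⟨fun t _ => (hz t).differentiableAt.differentiableWithinAt, by simp, ?_⟩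
      have h1 : ContDiffOn ℝ n (fun t => Complex.I * z t * (f ‖z t‖ : ℂ) - Complex.I) U :=
        ((contDiffOn_const.mul ih).mul
          (Complex.ofRealCLM.contDiff.comp_contDiffOn (hcomp n ih))).sub contDiffOn_const
      refine h1.congr fun t ht => ?_
      rw [(hz t).deriv, field, hφ t ht]
  have hz'' : ContDiffOn ℝ ∞ z U := contDiffOn_infty.2 hz'
  refine ⟨hz'', ?_⟩
  rw [contDiffOn_infty_iff_deriv_of_isOpen hU]
  refine ⟨fun t _ => (hϑ t).differentiableAt.differentiableWithinAt, ?_⟩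
  refine (contDiffOn_infty.2 fun n => hcomp n (hz' n)).congr fun t ht => ?_
  rw [(hϑ t).deriv, hφ t ht]

/-- A closed maximal solution is parametrized by all of an orbit of the planar flow: the part of
the orbit at admissible radii is a solution, so it has the same points as the given curve, by
compactness its radii do not approach the boundary of the admissible set, and hence it is all of
the orbit. If the curve passes through the origin, it does so smoothly, and all such passages look
alike. -/
theorem exists_globalParam_of_tame {f φ : ℝ → ℝ} (hf : PosCurv f) (hφ : Tame φ) {C : ArcCurve}
    (hC : C.IsMaximalSolution f) (hcl : C.IsClosedCurve) {Ω : Set ℝ} (hΩ : IsOpen Ω)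
    (hCΩ : ∀ t ∈ C.J, ‖C.c t‖ ∈ Ω) (hφf : ∀ s ∈ Ω, 0 < s → φ s = f s)
    (hΩ0 : (0 : ℝ) ∈ Ω → ∃ t ∈ C.J, C.c t = 0) :
    ∃ z ϑ, IsGlobalParam f C φ z ϑ := by
  obtain ⟨⟨ϑC, hϑC, hsol⟩, hmax⟩ := hC
  obtain ⟨K, hK⟩ := hφ.lipschitz_field
  obtain ⟨z, hz0, hz⟩ := exists_integralCurve hK (C.planar ϑC 0)
  have hzflow : IsPlanarFlow φ z := hz
  have hzc := hzflow.continuous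
  have hkc : Continuous fun t => φ ‖z t‖ := hφ.continuous.comp hzc.norm
  set ϑ : ℝ → ℝ := fun t => ϑC 0 + ∫ s in (0 : ℝ)..t, φ ‖z s‖ with hϑdef
  have hϑ : ∀ t, HasDerivAt ϑ (φ ‖z t‖) t := fun t =>
    (intervalIntegral.integral_hasDerivAt_right (hkc.intervalIntegrable _ _)
      (hkc.stronglyMeasurableAtFilter _ _) hkc.continuousAt).const_add _
  have hφC : ∀ t ∈ C.J, C.c t ≠ 0 → φ ‖C.c t‖ = f ‖C.c t‖ := fun t ht h0 =>
    hφf _ (hCΩ t ht) (norm_pos_iff.2 h0)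
  have hzC : EqOn (C.planar ϑC) z C.J :=
    eqOn_of_integralCurves hK C.isOpen_J C.ordConnected_J
      (fun t ht => ArcCurve.hasDerivAt_planar_field hϑC hsol hφC ht) (fun t _ => hz t)
      C.zero_mem hz0.symm
  have hnorm : ∀ t ∈ C.J, ‖z t‖ = ‖C.c t‖ := fun t ht => by
    rw [← hzC ht, C.norm_planar]
  have hkC : ∀ t ∈ C.J, deriv ϑC t = φ ‖z t‖ := by
    intro t ht
    by_cases h0 : C.c t = 0
    · -- passages through the origin are isolated
      have h1 : ∀ᶠ u in 𝓝[≠] t, C.c u ≠ 0 := by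
        have := (ArcCurve.hasDerivAt_c hϑC ht).eventually_ne (c := 0) (Complex.exp_ne_zero _)
        exact this
      have h2 : ∀ᶠ u in 𝓝[≠] t, u ∈ C.J := mem_nhdsWithin_of_mem_nhds (C.isOpen_J.mem_nhds ht)
      have h3 : Tendsto (deriv ϑC) (𝓝[≠] t) (𝓝 (deriv ϑC t)) :=
        ((hϑC.1.continuousOn_deriv_of_isOpen C.isOpen_J (by simp)).continuousAt
          (C.isOpen_J.mem_nhds ht)).tendsto.mono_left nhdsWithin_le_nhds
      have h4 : Tendsto (fun u => φ ‖z u‖) (𝓝[≠] t) (𝓝 (φ ‖z t‖)) :=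
        hkc.continuousAt.tendsto.mono_left nhdsWithin_le_nhds
      refine tendsto_nhds_unique h3 (h4.congr' ?_)
      filter_upwards [h1, h2] with u hu huJ
      rw [hsol u huJ hu, hnorm u huJ, hφC u huJ hu]
    · rw [hsol t ht h0, hnorm t ht, hφC t ht h0]
  have hϑeq : EqOn ϑC ϑ C.J := by
    refine C.isOpen_J.eqOn_of_deriv_eq C.ordConnected_J.isPreconnected
      (fun t ht => (ArcCurve.hasDerivAt_angle hϑC ht).differentiableAt.differentiableWithinAt)
      (fun t _ => (hϑ t).differentiableAt.differentiableWithinAt)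
      (fun t ht => by rw [hkC t ht, (hϑ t).deriv]) C.zero_mem (by simp [hϑdef])
  have hroll : EqOn (roll z ϑ) C.c C.J := fun t ht => by
    rw [← C.roll_planar ϑC t, roll, roll, hzC ht, hϑeq ht]
  set W := connectedComponentIn {t | ‖z t‖ ∈ Ω} 0 with hW
  have hΩo : IsOpen {t | ‖z t‖ ∈ Ω} := hΩ.preimage hzc.norm
  have hWo : IsOpen W := hΩo.connectedComponentIn
  have hWpre : IsPreconnected W := isPreconnected_connectedComponentIn
  have hWsub : W ⊆ {t | ‖z t‖ ∈ Ω} := connectedComponentIn_subset _ _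
  have hJW : C.J ⊆ W := C.ordConnected_J.isPreconnected.subset_connectedComponentIn C.zero_mem
    fun t ht => by simp only [mem_ofPred_eq, hnorm t ht]; exact hCΩ t ht
  have hagree : ∀ t ∈ W, z t ≠ 0 → φ ‖z t‖ = f ‖z t‖ := fun t ht h0 =>
    hφf _ (hWsub ht) (norm_pos_iff.2 h0)
  have hsmooth : ∀ t ∈ W, ContDiffAt ℝ ∞ z t ∧ ContDiffAt ℝ ∞ ϑ t := by
    intro t ht
    by_cases h0 : z t = 0
    · obtain ⟨t₀, ht₀, hc0⟩ := hΩ0 (by have := hWsub ht; simpa [h0] using this)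
      have hJ := C.isOpen_J.mem_nhds ht₀
      have hz0' : z t₀ = 0 := by rw [← norm_eq_zero, hnorm t₀ ht₀, hc0, norm_zero]
      have hϑt₀ : ContDiffAt ℝ ∞ ϑ t₀ :=
        (hϑC.1.contDiffAt hJ).congr_of_eventuallyEq
          (by filter_upwards [hJ] with u hu using (hϑeq hu).symm)
      have hzt₀ : ContDiffAt ℝ ∞ z t₀ := by
        have h1 : ContDiffAt ℝ ∞ (C.planar ϑC) t₀ := by
          have hc := C.smooth.contDiffAt hJ
          have hϑc := hϑC.1.contDiffAt hJ
          exact (contDiffAt_const.mul (Complex.conjCLE.contDiff.contDiffAt.comp t₀ hc)).mul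
            (contDiffAt_const.mul (Complex.ofRealCLM.contDiff.contDiffAt.comp t₀ hϑc)).cexp
        exact h1.congr_of_eventuallyEq (by filter_upwards [hJ] with u hu using (hzC hu).symm)
      have hshift : z = fun s => z (s + (t₀ - t)) :=
        hzflow.eq_of_eq hφ (hzflow.shift (t₀ - t)) (t := t) (by simp [h0, hz0'])
      have hϑshift : ∀ s, ϑ s = ϑ (s + (t₀ - t)) + (ϑ t - ϑ t₀) := by
        have hd : ∀ s, HasDerivAt (fun s => ϑ s - ϑ (s + (t₀ - t))) 0 s := fun s => by
          refine ((hϑ s).fun_sub ((hϑ (s + (t₀ - t))).comp_add_const s (t₀ - t))).congr_deriv ?_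
          rw [← congrFun hshift s, sub_self]
        intro s
        have := is_const_of_deriv_eq_zero (fun t => (hd t).differentiableAt)
          (fun t => (hd t).deriv) s t
        simp only [add_sub_cancel] at this
        linarith
      have hsh : ContDiffAt ℝ ∞ (fun s : ℝ => s + (t₀ - t)) t := by fun_prop
      constructor
      · rw [hshift]
        exact ContDiffAt.comp t (by simpa using hzt₀) hsh
      · rw [show ϑ = fun s => ϑ (s + (t₀ - t)) + (ϑ t - ϑ t₀) from funext hϑshift]
        exact (ContDiffAt.comp (g := ϑ) t (by simpa using hϑt₀) hsh).add contDiffAt_const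
    · set U := W ∩ {t | z t ≠ 0} with hU
      have hUo : IsOpen U := hWo.inter (isOpen_ne_fun hzc continuous_const)
      obtain ⟨h1, h2⟩ := contDiffOn_flow hf.smooth hzflow hϑ hUo (fun t ht => ht.2)
        (fun t ht => hagree t ht.1 ht.2)
      exact ⟨h1.contDiffAt (hUo.mem_nhds ⟨ht, h0⟩), h2.contDiffAt (hUo.mem_nhds ⟨ht, h0⟩)⟩
  have hrd : ∀ t, HasDerivAt (roll z ϑ) (Complex.exp (Complex.I * ϑ t)) t := fun t =>
    hasDerivAt_roll (hz t) (hϑ t)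
  let E : ArcCurve :=
    { J := W
      isOpen_J := hWo
      ordConnected_J := hWpre.ordConnected
      zero_mem := hJW C.zero_mem
      c := roll z ϑ
      smooth := fun t ht => by
        obtain ⟨h1, h2⟩ := hsmooth t ht
        exact ((contDiffAt_const.mul (Complex.conjCLE.contDiff.contDiffAt.comp t h1)).mul
          (contDiffAt_const.mul
            (Complex.ofRealCLM.contDiff.contDiffAt.comp t h2)).cexp).contDiffWithinAt
      unit_speed := fun t _ => by rw [(hrd t).deriv, norm_exp_I_mul] }
  have hE : E.IsSolution f := by
    refine ⟨ϑ, ⟨fun t ht => (hsmooth t ht).2.contDiffWithinAt, fun t _ => (hrd t).deriv⟩, ?_⟩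
    intro t ht h0
    have h1 : ‖E.c t‖ = ‖z t‖ := norm_roll z ϑ t
    rw [(hϑ t).deriv, h1]
    exact hagree t ht (by rw [← norm_pos_iff, ← h1, norm_pos_iff]; exact h0)
  have htr : C.trace = E.trace := hmax E hE (by
    rintro _ ⟨t, ht, rfl⟩
    exact ⟨t, hJW ht, hroll ht⟩)
  -- the radii of `𝒞` form a compact subset of `Ω`
  have hN : IsClosed (norm '' C.trace) := (hcl.image continuous_norm).isClosed
  have hWcl : IsClosed W := by
    rw [← closure_subset_iff_isClosed]
    have h1 : closure W ⊆ {t | ‖z t‖ ∈ Ω} := by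
      have h2 : closure W ⊆ (fun t => ‖z t‖) ⁻¹' (norm '' C.trace) := by
        refine closure_minimal (fun t ht => ?_) (hN.preimage hzc.norm)
        exact ⟨roll z ϑ t, by rw [htr]; exact ⟨t, ht, rfl⟩, norm_roll z ϑ t⟩
      intro t ht
      obtain ⟨w, ⟨u, hu, rfl⟩, hw⟩ := h2 ht
      change ‖z t‖ ∈ Ω
      simp only at hw
      rw [← hw]
      exact hCΩ u hu
    exact hWpre.closure.subset_connectedComponentIn (subset_closure (hJW C.zero_mem)) h1
  have hWuniv : W = univ := by
    rcases isClopen_iff.1 ⟨hWcl, hWo⟩ with h | h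
    · exact absurd (hJW C.zero_mem) (by rw [h]; exact notMem_empty _)
    · exact h
  refine ⟨z, ϑ, hφ, hzflow, hϑ, fun t => hagree t (by rw [hWuniv]; trivial), ?_, ?_, hroll, ?_, ?_⟩
  · exact contDiff_iff_contDiffAt.2 fun t => (hsmooth t (by rw [hWuniv]; trivial)).1
  · exact contDiff_iff_contDiffAt.2 fun t => (hsmooth t (by rw [hWuniv]; trivial)).2
  · intro ϑ' hϑ'
    rw [hz0, ArcCurve.planar, ArcCurve.planar, ← hϑC.2 0 C.zero_mem, ← hϑ'.2 0 C.zero_mem]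
  · rw [htr]
    change range (roll z ϑ) = roll z ϑ '' W
    rw [hWuniv, image_univ]

/-- A closed maximal solution has bounded radii. They are also bounded away from `0` unless the
curve passes through the origin, in which case `f` is Lipschitz near `0`; so a tame function agrees
with `f` near all radii of the curve. -/
theorem exists_globalParam {f : ℝ → ℝ} (hf : PosCurv f) {C : ArcCurve}
    (hC : C.IsMaximalSolution f) (hcl : C.IsClosedCurve) :
    ∃ φ z ϑ, IsGlobalParam f C φ z ϑ := by
  obtain ⟨M, hM⟩ := hcl.isBounded.exists_norm_le
  set b := max M 0 + 1 with hb
  have hb0 : 0 < b := by have := le_max_right M 0; linarith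
  have hCb : ∀ t ∈ C.J, ‖C.c t‖ < b := fun t ht => by
    have := hM _ ⟨t, ht, rfl⟩
    have := le_max_left M 0
    linarith
  by_cases h0 : ∃ t ∈ C.J, C.c t = 0
  · obtain ⟨t₀, ht₀, hc0⟩ := h0
    obtain ⟨ϑ, hϑ, hsol⟩ := hC.1
    obtain ⟨K, hK⟩ := hf.exists_lipschitz (a := 0) (b := b)
      (Or.inr (ArcCurve.bounded_deriv_of_zero hf hϑ hsol ht₀ hc0))
    obtain ⟨φ, hφ, hφf⟩ := exists_tame hf.pos hf.strictMonoOn_mul le_rfl hb0 hK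
    obtain ⟨z, ϑ, h⟩ := exists_globalParam_of_tame hf hφ hC hcl (Ω := Iio b) isOpen_Iio hCb
      (fun s hs h => hφf ⟨⟨h.le, le_of_lt hs⟩, h⟩) (fun _ => ⟨t₀, ht₀, hc0⟩)
    exact ⟨φ, z, ϑ, h⟩
  · push Not at h0
    obtain ⟨w, ⟨t, ht, rfl⟩, hw⟩ := hcl.exists_isMinOn
      (⟨C.c 0, ⟨0, C.zero_mem, rfl⟩⟩ : C.trace.Nonempty) continuous_norm.continuousOn
    have hpos : 0 < ‖C.c t‖ := norm_pos_iff.2 (h0 t ht)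
    set a := ‖C.c t‖ / 2 with ha
    have hab : a < b := by have := hCb t ht; linarith
    obtain ⟨K, hK⟩ := hf.exists_lipschitz (a := a) (b := b)
      (Or.inl (by positivity))
    obtain ⟨φ, hφ, hφf⟩ := exists_tame hf.pos hf.strictMonoOn_mul (by positivity) hab hK
    obtain ⟨z, ϑ, h⟩ := exists_globalParam_of_tame hf hφ hC hcl (Ω := Ioo a b) isOpen_Ioo
      (fun u hu => ⟨by
        have := hw ⟨u, hu, rfl⟩
        simp only [mem_ofPred_eq] at this
        linarith, hCb u hu⟩)
      (fun s hs h => hφf ⟨⟨hs.1.le, hs.2.le⟩, h⟩)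
      (fun h => absurd h.1 (by have : 0 < a := by positivity
                               linarith))
    exact ⟨φ, z, ϑ, h⟩

/-! ### Closed orbits have a rational turn -/

namespace IsOrbit

variable {φ : ℝ → ℝ} {z : ℝ → ℂ} {ϑ : ℝ → ℝ} {p S : ℝ}

/-- If the curve has compact range, then it closes up: otherwise the turns per period would
generate a dense group of rotations, all points of a circle of maximal radius would lie on the
curve, but it meets this circle only countably often. -/
theorem exists_nat_turn (h : IsOrbit φ z p S) (hϑ : ∀ t, HasDerivAt ϑ (φ ‖z t‖) t)
    (hK : IsCompact (range (roll z ϑ))) :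
    ∃ N : ℕ, 0 < N ∧ Function.Periodic (roll z ϑ) (N * (2 * S)) := by
  have hpi := Real.pi_pos
  set α := 2 * (ϑ S - ϑ 0) with hα
  have hrot : ∀ x : ℝ, x ∈ AddSubgroup.closure {α, 2 * Real.pi} →
      Complex.exp (Complex.I * x) * roll z ϑ S ∈ range (roll z ϑ) := by
    intro x hx
    obtain ⟨m, n, rfl⟩ := AddSubgroup.mem_closure_pair.1 hx
    refine ⟨S + m * (2 * S), ?_⟩
    rw [h.roll_add_int hϑ]
    congr 1
    rw [Complex.exp_eq_exp_iff_exists_int]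
    refine ⟨-n, ?_⟩
    simp only [zsmul_eq_mul]
    push_cast [hα]
    ring
  have hrat : ¬ Irrational (α / (2 * Real.pi)) := by
    intro hirr
    have hd := dense_addSubgroupClosure_pair_iff.2 hirr
    have hcont : Continuous fun x : ℝ => Complex.exp (Complex.I * x) * roll z ϑ S := by fun_prop
    have hall : ∀ x : ℝ, Complex.exp (Complex.I * x) * roll z ϑ S ∈ range (roll z ϑ) := by
      have h1 : IsClosed {x : ℝ | Complex.exp (Complex.I * x) * roll z ϑ S ∈ range (roll z ϑ)} :=
        hK.isClosed.preimage hcont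
      intro x
      exact closure_minimal (fun x hx => hrot x hx) h1 (hd x)
    have hpos : roll z ϑ S ≠ 0 := by
      rw [← norm_pos_iff, norm_roll]
      refine lt_of_le_of_lt (norm_nonneg (z 0)) ?_
      exact h.strictMonoOn_norm ⟨le_rfl, h.pos.le⟩ ⟨h.pos.le, le_rfl⟩ h.pos
    have hcount : (Ioo (0 : ℝ) 1).Countable := by
      refine MapsTo.countable_of_injOn (t := range fun k : ℤ => roll z ϑ (S + k * (2 * S)))
        (f := fun x : ℝ => Complex.exp (Complex.I * x) * roll z ϑ S) ?_ ?_ (countable_range _)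
      · intro x _
        obtain ⟨t, ht⟩ := hall x
        have h1 : ‖z t‖ = ‖z S‖ := by
          rw [← norm_roll z ϑ t, ht, norm_mul, norm_exp_I_mul, one_mul, norm_roll]
        obtain ⟨k, rfl⟩ := h.exists_int_of_norm_eq h1
        exact ⟨k, ht⟩
      · intro x hx y hy hxy
        have h1 := mul_right_cancel₀ hpos hxy
        have h2 := Real.pi_gt_three
        have h3 := Complex.exp_inj_of_neg_pi_lt_of_le_pi (by simp; linarith [hx.1])
          (by simp; linarith [hx.2]) (by simp; linarith [hy.1]) (by simp; linarith [hy.2]) h1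
        exact Complex.ofReal_injective (mul_left_cancel₀ Complex.I_ne_zero h3)
    rw [Cardinal.Real.Ioo_countable_iff] at hcount
    linarith
  rw [Irrational, not_not] at hrat
  obtain ⟨q, hq⟩ := hrat
  refine ⟨q.den, q.den_pos, fun t => ?_⟩
  have h1 := h.roll_add_int hϑ (q.den : ℤ) t
  have h2 : ((q.den : ℤ) : ℝ) * α = q.num * (2 * Real.pi) := by
    have h3 : (q.den : ℝ) * q = q.num := by
      rw [mul_comm]; exact_mod_cast q.mul_den_eq_num
    rw [eq_div_iff (by positivity)] at hq
    rw [← hq, Int.cast_natCast, ← mul_assoc, h3]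
  rw [h2] at h1
  rw [Int.cast_natCast] at h1
  rw [h1, show Complex.I * ((q.num * (2 * Real.pi) : ℝ) : ℂ) = q.num * (2 * Real.pi * Complex.I) by
    push_cast; ring, Complex.exp_int_mul_two_pi_mul_I, one_mul]

end IsOrbit

/-! ### Rotations -/

namespace ArcCurve

/-- The curve rotated by the angle `β` about the origin. -/
noncomputable def rotate (C : ArcCurve) (β : ℝ) : ArcCurve where
  J := C.J
  isOpen_J := C.isOpen_J
  ordConnected_J := C.ordConnected_J
  zero_mem := C.zero_mem
  c t := Complex.exp (Complex.I * β) * C.c t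
  smooth := contDiffOn_const.mul C.smooth
  unit_speed t ht := by
    rw [deriv_const_mul_field, norm_mul, norm_exp_I_mul, one_mul, C.unit_speed t ht]

lemma trace_rotate (C : ArcCurve) (β : ℝ) :
    (C.rotate β).trace = (fun w => Complex.exp (Complex.I * β) * w) '' C.trace := by
  simp only [trace, rotate, image_image]

lemma exp_neg_mul_exp_mul (β : ℝ) (w : ℂ) :
    Complex.exp (Complex.I * ((-β : ℝ) : ℂ)) * (Complex.exp (Complex.I * β) * w) = w := by
  rw [← mul_assoc, ← Complex.exp_add]; simp

lemma image_rotate_neg (β : ℝ) (T : Set ℂ) :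
    (fun w => Complex.exp (Complex.I * ((-β : ℝ) : ℂ)) * w) ''
      ((fun w => Complex.exp (Complex.I * β) * w) '' T) = T := by
  simp only [image_image, exp_neg_mul_exp_mul, image_id']

lemma IsSolution.rotate {f : ℝ → ℝ} {C : ArcCurve} (hC : C.IsSolution f) (β : ℝ) :
    (C.rotate β).IsSolution f := by
  obtain ⟨ϑ, hϑ, hsol⟩ := hC
  refine ⟨fun t => ϑ t + β, ⟨hϑ.1.add contDiffOn_const, fun t ht => ?_⟩, fun t ht h0 => ?_⟩
  · simp only [ArcCurve.rotate]
    rw [deriv_const_mul_field, hϑ.2 t ht]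
    push_cast
    rw [mul_add, Complex.exp_add, mul_comm]
  · simp only [ArcCurve.rotate] at h0 ⊢
    rw [deriv_add_const, hsol t ht (right_ne_zero_of_mul h0), norm_mul, norm_exp_I_mul, one_mul]

/-- Maximality is a property of the set of points. -/
lemma IsMaximalSolution.of_trace_eq {f : ℝ → ℝ} {C D : ArcCurve} (hC : C.IsMaximalSolution f)
    (hD : D.IsSolution f) (h : D.trace = C.trace) : D.IsMaximalSolution f :=
  ⟨hD, fun E hE hDE => by rw [h] at hDE ⊢; exact hC.2 E hE hDE⟩

lemma IsMaximalSolution.rotate {f : ℝ → ℝ} {C : ArcCurve} (hC : C.IsMaximalSolution f) (β : ℝ) :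
    (C.rotate β).IsMaximalSolution f := by
  refine ⟨hC.1.rotate β, fun E hE hsub => ?_⟩
  have h1 := hC.2 (E.rotate (-β)) (hE.rotate _) (by
    rw [trace_rotate, ← image_rotate_neg β C.trace, ← trace_rotate C]
    exact image_mono hsub)
  rw [trace_rotate, h1, trace_rotate]
  simpa using image_rotate_neg (-β) E.trace

end ArcCurve

/-! ### Orientation of closed maximal solutions of positive curvature -/

namespace PosCurv

variable {f : ℝ → ℝ}

/-- On a compact range of positive radii a curvature function agrees with a tame one. -/
lemma exists_tame (hf : PosCurv f) {a b : ℝ} (ha : 0 < a) (hab : a < b) :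
    ∃ φ, Tame φ ∧ EqOn φ f (Icc a b) := by
  obtain ⟨K, hK⟩ := hf.exists_lipschitz (a := a) (b := b) (Or.inl ha)
  obtain ⟨φ, hφ, h⟩ := RadialCurvature.exists_tame hf.pos hf.strictMonoOn_mul ha.le hab hK
  exact ⟨φ, hφ, fun s hs => h ⟨hs, ha.trans_le hs.1⟩⟩

lemma flowLine_eq (hf : PosCurv f) {z w : ℝ → ℂ} (hz : IsFlowLine f z) (hw : IsFlowLine f w)
    (h0 : z 0 = w 0) : z = w := by
  have hzc : Continuous z := continuous_iff_continuousAt.2 fun t => (hz t).2.continuousAt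
  have hwc : Continuous w := continuous_iff_continuousAt.2 fun t => (hw t).2.continuousAt
  funext t
  set R := |t| + 1 with hR
  have ht : t ∈ Ioo (-R) R := by rw [mem_Ioo, ← abs_lt]; linarith
  have h0R : (0 : ℝ) ∈ Ioo (-R) R := by
    have := abs_nonneg t
    constructor <;> linarith
  have key : ∀ v : ℝ → ℂ, Continuous v → (∀ t, v t ≠ 0) →
      ∃ a b, 0 < a ∧ ∀ s ∈ Ioo (-R) R, a ≤ ‖v s‖ ∧ ‖v s‖ ≤ b := by
    intro v hv hv0
    obtain ⟨s₁, -, h1⟩ := isCompact_Icc.exists_isMinOn (nonempty_Icc.2 (h0R.1.trans h0R.2).le)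
      hv.norm.continuousOn
    obtain ⟨s₂, -, h2⟩ := isCompact_Icc.exists_isMaxOn (nonempty_Icc.2 (h0R.1.trans h0R.2).le)
      hv.norm.continuousOn
    exact ⟨‖v s₁‖, ‖v s₂‖, norm_pos_iff.2 (hv0 _),
      fun s hs => ⟨h1 (Ioo_subset_Icc_self hs), h2 (Ioo_subset_Icc_self hs)⟩⟩
  obtain ⟨a, b, ha, hab⟩ := key z hzc fun t => (hz t).1
  obtain ⟨a', b', ha', hab'⟩ := key w hwc fun t => (hw t).1
  have hlt : min a a' < max b b' + 1 := by
    have h1 := (hab 0 h0R).1.trans (hab 0 h0R).2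
    have h2 := min_le_left a a'
    have h3 := le_max_left b b'
    linarith
  obtain ⟨φ, hφ, hφf⟩ := hf.exists_tame (lt_min ha ha') hlt
  obtain ⟨K, hK⟩ := hφ.lipschitz_field
  refine eqOn_of_integralCurves hK isOpen_Ioo ordConnected_Ioo (fun s hs => ?_) (fun s hs => ?_)
    h0R h0 ht
  · have h1 := hφf (x := ‖z s‖) ⟨(min_le_left _ _).trans (hab s hs).1,
      (hab s hs).2.trans (by linarith [le_max_left b b'])⟩
    rw [field, h1]
    exact (hz s).2
  · have h1 := hφf (x := ‖w s‖) ⟨(min_le_right _ _).trans (hab' s hs).1,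
      (hab' s hs).2.trans (by linarith [le_max_right b b'])⟩
    rw [field, h1]
    exact (hw s).2

end PosCurv

namespace IsGlobalParam

variable {f φ : ℝ → ℝ} {C : ArcCurve} {z : ℝ → ℂ} {ϑ : ℝ → ℝ}

lemma hasDerivAt (G : IsGlobalParam f C φ z ϑ) (t : ℝ) :
    HasDerivAt (roll z ϑ) (Complex.exp (Complex.I * ϑ t)) t :=
  hasDerivAt_roll (G.flow t) (G.angle t)

lemma contDiff_roll (G : IsGlobalParam f C φ z ϑ) : ContDiff ℝ ∞ (roll z ϑ) :=
  (contDiff_const.mul (Complex.conjCLE.contDiff.comp G.smooth)).mul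
    (contDiff_const.mul (Complex.ofRealCLM.contDiff.comp G.smooth_angle)).cexp

lemma isTangentAngle (G : IsGlobalParam f C φ z ϑ) : IsTangentAngle (roll z ϑ) univ ϑ :=
  ⟨G.smooth_angle.contDiffOn, fun t _ => (G.hasDerivAt t).deriv⟩

lemma isClosedParam (G : IsGlobalParam f C φ z ϑ) {a : ℝ} (ha : 0 < a)
    (hper : Function.Periodic (roll z ϑ) a) : C.IsClosedParam (roll z ϑ) a where
  smooth := G.contDiff_roll
  unit_speed t := by rw [(G.hasDerivAt t).deriv, norm_exp_I_mul]
  pos := ha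
  periodic := hper
  extends_c := G.eqOn
  range_eq := G.range_eq

/-- The curve started at the time `τ` and rotated such that it has a vertical tangent there. -/
lemma normalize (G : IsGlobalParam f C φ z ϑ) (τ : ℝ) :
    (∀ t, HasDerivAt (fun t => ϑ (t + τ) + (Real.pi / 2 - ϑ τ)) (φ ‖z (t + τ)‖) t) ∧
    ∀ t, roll (fun t => z (t + τ)) (fun t => ϑ (t + τ) + (Real.pi / 2 - ϑ τ)) t =
      Complex.exp (Complex.I * ((Real.pi / 2 - ϑ τ : ℝ) : ℂ)) * roll z ϑ (t + τ) :=
  ⟨fun t => ((G.angle (t + τ)).comp_add_const t τ).add_const _,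
    fun t => roll_add_const (fun t => z (t + τ)) (fun t => ϑ (t + τ)) _ t⟩

lemma range_normalize (G : IsGlobalParam f C φ z ϑ) (τ : ℝ) :
    range (roll (fun t => z (t + τ)) (fun t => ϑ (t + τ) + (Real.pi / 2 - ϑ τ))) =
      (C.rotate (Real.pi / 2 - ϑ τ)).trace := by
  rw [C.trace_rotate, ← G.range_eq, ← range_comp]
  ext w
  constructor
  · rintro ⟨t, rfl⟩
    exact ⟨t + τ, ((G.normalize τ).2 t).symm⟩
  · rintro ⟨t, rfl⟩
    exact ⟨t - τ, by rw [(G.normalize τ).2, sub_add_cancel]; rfl⟩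

lemma periodic_normalize (G : IsGlobalParam f C φ z ϑ) (τ : ℝ) {a : ℝ} :
    Function.Periodic
      (roll (fun t => z (t + τ)) (fun t => ϑ (t + τ) + (Real.pi / 2 - ϑ τ))) a ↔
      Function.Periodic (roll z ϑ) a := by
  constructor
  · intro h t
    have h1 := h (t - τ)
    rw [(G.normalize τ).2, (G.normalize τ).2] at h1
    have h2 := mul_left_cancel₀ (Complex.exp_ne_zero _) h1
    rwa [sub_add_cancel, show t - τ + a + τ = t + a by ring] at h2
  · intro h t
    rw [(G.normalize τ).2, (G.normalize τ).2, show t + a + τ = t + τ + a by ring, h]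

lemma exists_nat_turn (G : IsGlobalParam f C φ z ϑ) (hcl : C.IsClosedCurve) {τ p S : ℝ}
    (h : IsOrbit φ (fun t => z (t + τ)) p S) :
    ∃ N : ℕ, 0 < N ∧ Function.Periodic (roll z ϑ) (N * (2 * S)) := by
  obtain ⟨N, hN, hper⟩ := h.exists_nat_turn (G.normalize τ).1 (by
    rw [G.range_normalize, C.trace_rotate]
    exact hcl.image (by fun_prop))
  exact ⟨N, hN, (G.periodic_normalize τ).1 hper⟩

/-- Along the half-orbit the curvature is strictly monotone. -/
lemma curvature_strict (G : IsGlobalParam f C φ z ϑ) (hf : PosCurv f) {τ p S : ℝ}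
    (h : IsOrbit φ (fun t => z (t + τ)) p S) :
    StrictMonoOn (fun t => φ ‖z (t + τ)‖) (Ioo 0 S) ∨
      StrictAntiOn (fun t => φ ‖z (t + τ)‖) (Ioo 0 S) := by
  have h1 : ∀ t ∈ Ioo 0 S, φ ‖z (t + τ)‖ = f ‖z (t + τ)‖ := fun t ht =>
    G.agree _ (norm_pos_iff.1 (h.pos_norm ht))
  have h2 := h.strictMonoOn_norm
  refine hf.strict.imp (fun hm s hs t ht hst => ?_) (fun hm s hs t ht hst => ?_)
  all_goals
    simp only [h1 s hs, h1 t ht]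
    exact hm (h.pos_norm hs) (h.pos_norm ht)
      (h2 (Ioo_subset_Icc_self hs) (Ioo_subset_Icc_self ht) hst)

/-- A simple closed orbit closes up after one turn, made in at least two periods of the planar
flow. -/
theorem exists_turn (G : IsGlobalParam f C φ z ϑ) (hf : PosCurv f) (hcl : C.IsClosedCurve)
    (hs : C.IsSimpleClosed) {τ p S : ℝ} (h : IsOrbit φ (fun t => z (t + τ)) p S) :
    0 < p ∧ ∃ k : ℕ, 2 ≤ k ∧ ϑ (S + τ) - ϑ τ = Real.pi / k := by
  obtain ⟨N, hN, hper⟩ := G.exists_nat_turn hcl h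
  obtain ⟨e⟩ := hs
  rw [← G.range_eq] at e
  have hexp : Continuous fun t => Complex.exp (Complex.I * ϑ t) := by
    have := G.smooth_angle.continuous
    fun_prop
  have hN' : (0 : ℝ) < N := by exact_mod_cast hN
  have hp := fun s t (hst : roll z ϑ s = roll z ϑ t) =>
    periodic_of_homeomorph_circle G.hasDerivAt hexp (fun t => norm_exp_I_mul _)
      (mul_pos hN' (mul_pos two_pos h.pos)) hper e hst
  obtain ⟨hp0, k, hk, hturn⟩ := h.exists_turn_of_simple (G.normalize τ).1 (by simp)
    (G.curvature_strict hf h) (fun s t hst => by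
      rw [(G.normalize τ).2, (G.normalize τ).2] at hst
      rw [G.periodic_normalize]
      have := hp _ _ (mul_left_cancel₀ (Complex.exp_ne_zero _) hst)
      rwa [add_sub_add_right_eq_sub] at this)
  refine ⟨hp0, k, hk, ?_⟩
  simp only [zero_add] at hturn
  linarith

lemma turn_add (G : IsGlobalParam f C φ z ϑ) {τ p S : ℝ}
    (h : IsOrbit φ (fun t => z (t + τ)) p S) (k : ℕ) (t : ℝ) :
    ϑ (t + k * (2 * S)) = ϑ t + k * (2 * (ϑ (S + τ) - ϑ τ)) := by
  have h1 := h.angle_add_int (G.normalize τ).1 (k : ℤ) (t - τ)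
  simp only [Int.cast_natCast, zero_add, sub_add_cancel] at h1
  rw [show t - τ + k * (2 * S) + τ = t + k * (2 * S) by ring] at h1
  linarith

lemma turn_pos (G : IsGlobalParam f C φ z ϑ) {τ p S : ℝ}
    (h : IsOrbit φ (fun t => z (t + τ)) p S) : 0 < ϑ (S + τ) - ϑ τ := by
  have := h.angle_lt (G.normalize τ).1
  simp only [zero_add] at this
  linarith

/-- A curve that makes one full turn in the time `a`, with the origin on its left, is
oriented counter-clockwise. -/
lemma orientedCCW_of_turn (G : IsGlobalParam f C φ z ϑ) {a : ℝ} (ha : 0 < a)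
    (hre : ∀ t, 0 < (z t).re) (hturn : ∀ t, ϑ (t + a) = ϑ t + 2 * Real.pi)
    (hper : Function.Periodic z a) : C.OrientedCCW := by
  have hper' : Function.Periodic (roll z ϑ) a := by
    intro t
    have : Complex.exp (Complex.I * ((ϑ t + 2 * Real.pi : ℝ) : ℂ)) =
        Complex.exp (Complex.I * ϑ t) := by
      rw [Complex.exp_eq_exp_iff_exists_int]
      exact ⟨1, by push_cast; ring⟩
    rw [roll, hper, hturn, this, roll]
  have hmono : StrictMono ϑ := strictMono_of_deriv_pos fun t => by
    rw [(G.angle t).deriv]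
    refine G.tame.pos _ (norm_pos_iff.2 fun h0 => ?_)
    have := hre t
    simp [h0] at this
  have hloop := isConvexLoop_of_turn G.hasDerivAt G.smooth_angle.continuous hmono ha hturn hper'
  refine ⟨roll z ϑ, a, ϑ, G.isClosedParam ha hper', G.isTangentAngle, hmono ha, fun _ =>
    ⟨hloop.injOn, hloop.loopCCW (q₀ := 0) fun t => ?_⟩⟩
  rw [roll_left]
  exact hre t

lemma angle_of_const (G : IsGlobalParam f C φ z ϑ) (h : ∀ t, z t = G.tame.radius) (t : ℝ) :
    ϑ t = ϑ 0 + t * φ G.tame.radius := by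
  have hd : ∀ t, HasDerivAt (fun t => ϑ t - t * φ G.tame.radius) 0 t := fun t => by
    have h1 := G.angle t
    rw [h t, norm_real_eq, abs_of_pos G.tame.radius_pos] at h1
    exact (h1.fun_sub ((hasDerivAt_id t).mul_const _)).congr_deriv (by simp)
  have := is_const_of_deriv_eq_zero (fun t => (hd t).differentiableAt) (fun t => (hd t).deriv) t 0
  simp only [zero_mul, sub_zero] at this
  linarith

theorem orientedCCW (G : IsGlobalParam f C φ z ϑ) (hf : PosCurv f) (hcl : C.IsClosedCurve) :
    C.OrientedCCW := by
  have hpi := Real.pi_pos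
  rcases G.flow.eq_const_or_isOrbit G.tame with h | ⟨τ, p, S, h⟩
  · have hr := G.tame.radius_pos
    refine G.orientedCCW_of_turn (a := 2 * Real.pi * G.tame.radius) (by positivity)
      (fun t => by rw [h t]; simpa using hr) (fun t => ?_) (fun t => by rw [h, h])
    rw [G.angle_of_const h, G.angle_of_const h t]
    linear_combination 2 * Real.pi * G.tame.radius_mul
  · have hS := h.pos
    by_cases hs : C.IsSimpleClosed
    · obtain ⟨hp, k, hk, hturn⟩ := G.exists_turn hf hcl hs h
      have hk' : (0 : ℝ) < k := by
        have : 0 < k := by omega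
        exact_mod_cast this
      refine G.orientedCCW_of_turn (a := k * (2 * S)) (by positivity) (fun t => ?_) (fun t => ?_)
        (fun t => ?_)
      · have := h.le_re (t - τ)
        rw [sub_add_cancel] at this
        exact hp.trans_le this
      · rw [G.turn_add h, hturn]
        field_simp
      · have := h.map_int k (t - τ)
        simp only [Int.cast_natCast, sub_add_cancel] at this
        rwa [show t - τ + k * (2 * S) + τ = t + k * (2 * S) by ring] at this
    · obtain ⟨N, hN, hper⟩ := G.exists_nat_turn hcl h
      have hN' : (0 : ℝ) < N := by exact_mod_cast hN
      refine ⟨roll z ϑ, N * (2 * S), ϑ, G.isClosedParam (by positivity) hper, G.isTangentAngle, ?_,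
        fun h => absurd h hs⟩
      have h1 := G.turn_add h N 0
      have h2 := G.turn_pos h
      rw [zero_add] at h1
      rw [h1]
      have : 0 < N * (2 * (ϑ (S + τ) - ϑ τ)) := by positivity
      linarith

end IsGlobalParam

/-! ### Jordan solutions of positive curvature -/

namespace PosCurv

variable {f : ℝ → ℝ} {r : ℝ}

lemma critRadius_eq (hf : PosCurv f) (he : eps f = 1) (hr : 0 < r) (hrf : r * f r = 1) :
    critRadius f = r := by
  have : {s : ℝ | 0 < s ∧ s * f s = eps f} = {r} := by
    ext s
    constructor
    · rintro ⟨hs, h⟩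
      exact hf.strictMonoOn_mul.injOn hs hr (by simp only [h, he, hrf])
    · rintro rfl
      exact ⟨hr, by rw [hrf, he]⟩
  rw [critRadius, this, csInf_singleton]

end PosCurv

namespace IsOrbit

variable {φ : ℝ → ℝ} {z : ℝ → ℂ} {ϑ : ℝ → ℝ} {p S : ℝ}

/-- The net winding of an orbit of the planar flow is its turn per period, in units of `2π`. -/
lemma integral_eq (h : IsOrbit φ z p S) (hϑ : ∀ t, HasDerivAt ϑ (φ ‖z t‖) t) {f : ℝ → ℝ}
    (hagree : ∀ t, φ ‖z t‖ = f ‖z t‖) :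
    ∫ t in (0 : ℝ)..2 * S, f ‖z t‖ = 2 * (ϑ S - ϑ 0) := by
  simp only [← hagree]
  rw [intervalIntegral.integral_eq_sub_of_hasDerivAt (fun t _ => hϑ t)
    ((h.tame.continuous.comp h.flow.continuous.norm).intervalIntegrable _ _)]
  have := h.angle_add_period hϑ 0
  rw [zero_add] at this
  rw [this]; ring

lemma isFlowLine (h : IsOrbit φ z p S) (hp : 0 < p) {f : ℝ → ℝ}
    (hagree : ∀ t, φ ‖z t‖ = f ‖z t‖) : IsFlowLine f z := by
  intro t
  constructor
  · rw [← norm_pos_iff]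
    exact (abs_pos.2 hp.ne').trans_le (h.abs_le_norm t)
  · rw [← hagree]
    exact h.flow t

lemma isLeast_period (h : IsOrbit φ z p S) : IsLeast {t : ℝ | 0 < t ∧ z t = p} (2 * S) := by
  have hS := h.pos
  refine ⟨⟨by linarith, by simpa [h.map_zero] using h.periodic 0⟩, ?_⟩
  rintro t ⟨ht, hz⟩
  obtain ⟨k, rfl⟩ := h.exists_int_of_eq hz
  have hk : 0 < k := by
    have := pos_of_mul_pos_left ht (by linarith : (0 : ℝ) ≤ 2 * S)
    exact_mod_cast this
  have hk' : (1 : ℝ) ≤ k := by exact_mod_cast hk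
  nlinarith

end IsOrbit

namespace IsGlobalParam

variable {f φ : ℝ → ℝ} {C : ArcCurve} {z : ℝ → ℂ} {ϑ : ℝ → ℝ} {p S : ℝ}

lemma agree_of_pos (G : IsGlobalParam f C φ z ϑ) {τ : ℝ}
    (h : IsOrbit φ (fun t => z (t + τ)) p S) (hp : 0 < p) (t : ℝ) : φ ‖z t‖ = f ‖z t‖ := by
  refine G.agree t (norm_pos_iff.1 ?_)
  have := h.abs_le_norm (t - τ)
  rw [sub_add_cancel] at this
  exact (abs_pos.2 hp.ne').trans_le this

/-- The starting point of the orbit is a closest point to the origin. -/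
lemma isLeast_norm (G : IsGlobalParam f C φ z ϑ) (h : IsOrbit φ z p S) (hp : 0 < p) :
    IsLeast (norm '' C.trace) p := by
  rw [← G.range_eq]
  constructor
  · exact ⟨_, ⟨0, rfl⟩, by rw [norm_roll, h.map_zero, norm_real_eq, abs_of_pos hp]⟩
  · rintro _ ⟨_, ⟨t, rfl⟩, rfl⟩
    rw [norm_roll, ← abs_of_pos hp]
    exact h.abs_le_norm t

end IsGlobalParam

namespace PosCurv

variable {f : ℝ → ℝ} {r : ℝ}

lemma exists_orbit_of_familyMember (hf : PosCurv f) (he : eps f = 1) (hr : 0 < r)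
    (hrf : r * f r = 1) {s : ℝ} (hs : 0 < s) (hsr : s < r) {D : ArcCurve}
    (hD : D.IsFamilyMember f s) (hcl : D.IsClosedCurve) :
    ∃ φ z ϑ S, IsGlobalParam f D φ z ϑ ∧ IsOrbit φ z s S := by
  obtain ⟨hmax, hc, ϑ', hϑ', h0⟩ := hD
  obtain ⟨φ, z, ϑ, G⟩ := exists_globalParam hf hmax hcl
  have hz0 : z 0 = s := by
    rw [G.eqOn_angle ϑ' hϑ', ArcCurve.planar, hc, he, h0, one_mul, Complex.conj_ofReal]
    have := exp_I_mul_pi_div_two_add 0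
    rw [add_zero] at this
    rw [this]
    simp
    linear_combination (-(s : ℂ)) * Complex.I_mul_I
  have hφs : φ s = f s := by
    have := G.agree 0 (by rw [hz0]; exact_mod_cast hs.ne')
    rwa [hz0, norm_real_eq, abs_of_pos hs] at this
  have hlt : s < G.tame.radius := by
    have h1 : s * f s < 1 := hrf ▸ hf.strictMonoOn_mul hs hr hsr
    have h2 := G.tame.strictMonoOn.lt_iff_lt (a := s) (b := G.tame.radius) hs.le
      G.tame.radius_pos.le
    simp only [G.tame.radius_mul, hφs] at h2
    exact h2.1 h1
  obtain ⟨S, hS⟩ := G.flow.isOrbit G.tame hlt hz0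
  exact ⟨φ, z, ϑ, S, G, hS⟩

lemma isClosedCurve_of_rotate {C D : ArcCurve} (hcl : C.IsClosedCurve) {β : ℝ}
    (h : C.trace = (fun w => Complex.exp (Complex.I * β) * w) '' D.trace) :
    D.IsClosedCurve := by
  rw [ArcCurve.IsClosedCurve, ← ArcCurve.image_rotate_neg β D.trace, ← h]
  exact hcl.image (by fun_prop)

lemma norm_image_rotate (β : ℝ) (T : Set ℂ) :
    norm '' ((fun w => Complex.exp (Complex.I * β) * w) '' T) = norm '' T := by
  simp only [image_image, norm_mul, norm_exp_I_mul, one_mul]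

/-- The net winding determines the turn of the curve during a period of the planar flow. -/
lemma turn_of_hasNetWinding (hf : PosCurv f) {φ : ℝ → ℝ} {z : ℝ → ℂ} {ϑ : ℝ → ℝ} {p S : ℝ}
    (h : IsOrbit φ z p S) (hp : 0 < p) (hϑ : ∀ t, HasDerivAt ϑ (φ ‖z t‖) t)
    (hagree : ∀ t, φ ‖z t‖ = f ‖z t‖) {n : ℕ} (hn : 0 < n)
    (hw : HasNetWinding f p (1 / n)) : ϑ S - ϑ 0 = Real.pi / n := by
  have hpi := Real.pi_pos
  have hn' : (0 : ℝ) < n := by exact_mod_cast hn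
  obtain ⟨w, T, hw, hw0, -, hT, hcases⟩ := hw
  have hwz : w = z := hf.flowLine_eq hw (h.isFlowLine hp hagree) (by rw [hw0, h.map_zero])
  subst hwz
  rw [h.isLeast_period.csInf_eq] at hT
  subst hT
  rw [h.integral_eq hϑ hagree] at hcases
  have h1 := h.angle_lt hϑ
  have h2 : 0 < 1 / (n : ℝ) := by positivity
  have h3 : 0 < (2 * Real.pi)⁻¹ * (2 * (ϑ S - ϑ 0)) :=
    mul_pos (by positivity) (by linarith)
  rcases hcases with ⟨-, h0⟩ | ⟨-, -, h0⟩ | ⟨-, -, h0⟩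
  · linarith
  · field_simp at h0 ⊢
    linarith
  · linarith

lemma hasNetWinding_of_turn {φ : ℝ → ℝ} {z : ℝ → ℂ} {ϑ : ℝ → ℝ} {p S : ℝ}
    (h : IsOrbit φ z p S) (hp : 0 < p) (hϑ : ∀ t, HasDerivAt ϑ (φ ‖z t‖) t)
    (hagree : ∀ t, φ ‖z t‖ = f ‖z t‖) {n : ℕ} (hturn : ϑ S - ϑ 0 = Real.pi / n) :
    HasNetWinding f p (1 / n) := by
  refine ⟨z, 2 * S, h.isFlowLine hp hagree, h.map_zero, h.isLeast_period.nonempty,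
    h.isLeast_period.csInf_eq.symm,
    Or.inr (Or.inl ⟨by linarith [h.pos], h.loopCCW, ?_⟩)⟩
  rw [h.integral_eq hϑ hagree, hturn]
  have hpi := Real.pi_ne_zero
  field_simp

/-- A Jordan solution is a circle or a rotated member of the family. -/
theorem exists_familyMember (hf : PosCurv f) (he : eps f = 1) (hr : 0 < r) (hrf : r * f r = 1)
    {C : ArcCurve} (hC : C.IsMaximalSolution f) (hcl : C.IsClosedCurve) (hs : C.IsSimpleClosed) :
    C.trace = Metric.sphere 0 r ∨
      ∃ s ∈ OSet f, ∃ (D : ArcCurve) (β : ℝ), D.IsFamilyMember f s ∧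
        C.trace = (fun w => Complex.exp (Complex.I * β) * w) '' D.trace := by
  obtain ⟨φ, z, ϑ, G⟩ := exists_globalParam hf hC hcl
  rcases G.flow.eq_const_or_isOrbit G.tame with h | ⟨τ, p, S, h⟩
  · left
    have hρ := G.tame.radius_pos
    have hagree := G.agree 0 (by rw [h]; exact_mod_cast hρ.ne')
    rw [h, norm_real_eq, abs_of_pos hρ] at hagree
    have hrad : G.tame.radius = r := hf.strictMonoOn_mul.injOn hρ hr (by
      simp only [hrf, ← hagree, G.tame.radius_mul])
    rw [← G.range_eq]
    ext w
    rw [mem_sphere_zero_iff_norm]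
    constructor
    · rintro ⟨t, rfl⟩
      rw [norm_roll, h, norm_real_eq, abs_of_pos hρ, hrad]
    · intro hw
      -- the point of argument `arg w` is reached when the tangent angle is `arg w + π / 2`
      refine ⟨(Real.pi / 2 + w.arg - ϑ 0) * r, ?_⟩
      have h1 : ϑ ((Real.pi / 2 + w.arg - ϑ 0) * r) = Real.pi / 2 + w.arg := by
        rw [G.angle_of_const h, hagree, hrad]
        linear_combination (Real.pi / 2 + w.arg - ϑ 0) * hrf
      have h2 := Complex.norm_mul_exp_arg_mul_I w
      rw [hw] at h2
      rw [roll, h, h1, exp_I_mul_pi_div_two_add, Complex.conj_ofReal, hrad, mul_comm Complex.I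
        (w.arg : ℂ)]
      linear_combination h2 - r * Complex.exp (w.arg * Complex.I) * Complex.I_mul_I
  · right
    obtain ⟨hp, k, hk, hturn⟩ := G.exists_turn hf hcl hs h
    have hagree := G.agree_of_pos h hp
    have hϑ := (G.normalize τ).1
    have hplt : p < r := by
      have h1 := h.tame.strictMonoOn hp.le h.tame.radius_pos.le h.lt_radius
      have h2 := hagree (0 + τ)
      have h3 := h.map_zero
      rw [h3, norm_real_eq, abs_of_pos hp] at h2
      simp only [h.tame.radius_mul, h2] at h1
      rw [← hrf] at h1
      exact (hf.strictMonoOn_mul.lt_iff_lt hp hr).1 h1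
    have hsm : ContDiff ℝ ∞ fun t : ℝ => t + τ := by fun_prop
    have hϑs : ContDiff ℝ ∞ fun t => ϑ (t + τ) + (Real.pi / 2 - ϑ τ) :=
      (G.smooth_angle.comp hsm).add contDiff_const
    have hzs : ContDiff ℝ ∞ fun t => z (t + τ) := G.smooth.comp hsm
    have hd := h.hasDerivAt_roll hϑ
    let D : ArcCurve :=
      { J := univ
        isOpen_J := isOpen_univ
        ordConnected_J := ordConnected_univ
        zero_mem := mem_univ _
        c := roll (fun t => z (t + τ)) (fun t => ϑ (t + τ) + (Real.pi / 2 - ϑ τ))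
        smooth := ((contDiff_const.mul (Complex.conjCLE.contDiff.comp hzs)).mul
          (contDiff_const.mul (Complex.ofRealCLM.contDiff.comp hϑs)).cexp).contDiffOn
        unit_speed := fun t _ => by rw [(hd t).deriv, norm_exp_I_mul] }
    have htan : IsTangentAngle D.c D.J fun t => ϑ (t + τ) + (Real.pi / 2 - ϑ τ) :=
      ⟨hϑs.contDiffOn, fun t _ => (hd t).deriv⟩
    have hDs : D.IsSolution f := by
      refine ⟨_, htan, fun t _ _ => ?_⟩
      have h3 : ‖D.c t‖ = ‖z (t + τ)‖ := norm_roll _ _ t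
      rw [(hϑ t).deriv, hagree, h3]
    have htr : D.trace = (C.rotate (Real.pi / 2 - ϑ τ)).trace := by
      rw [← G.range_normalize τ]
      exact image_univ
    refine ⟨p, ⟨hp, ?_, k, hk, ?_⟩, D, -(Real.pi / 2 - ϑ τ),
      ⟨(hC.rotate _).of_trace_eq hDs htr, ?_, _, htan, by simp⟩, ?_⟩
    · rwa [hf.critRadius_eq he hr hrf]
    · rw [he, one_mul]
      exact hasNetWinding_of_turn h hp hϑ (fun t => hagree (t + τ)) (by
        simp only [zero_add]; linarith)
    · have h3 := h.map_zero
      have h4 := exp_I_mul_pi_div_two_add 0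
      rw [add_zero] at h4
      change roll (fun t => z (t + τ)) (fun t => ϑ (t + τ) + (Real.pi / 2 - ϑ τ)) 0 = _
      rw [roll, h3, he, one_mul, Complex.conj_ofReal, zero_add, add_sub_cancel, h4]
      simp
      linear_combination (-(p : ℂ)) * Complex.I_mul_I
    · rw [htr, C.trace_rotate, ArcCurve.image_rotate_neg]

/-- Circles about the origin are simple closed. -/
lemma isSimpleClosed_of_sphere (hr : 0 < r) {C : ArcCurve} (h : C.trace = Metric.sphere 0 r) :
    C.IsSimpleClosed := by
  have hpi := Real.pi_pos
  have hrange : range (fun t : ℝ => (r : ℂ) * Complex.exp (t * Complex.I)) = C.trace := by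
    rw [h]
    ext w
    rw [mem_sphere_zero_iff_norm]
    constructor
    · rintro ⟨t, rfl⟩
      simp [Complex.norm_exp_ofReal_mul_I, abs_of_pos hr]
    · intro hw
      exact ⟨w.arg, by rw [← hw]; exact Complex.norm_mul_exp_arg_mul_I w⟩
  rw [ArcCurve.IsSimpleClosed, ← hrange]
  refine nonempty_homeomorph_circle (by fun_prop) Real.two_pi_pos (fun t => ?_) ?_
  · rw [Complex.ofReal_add, add_mul, Complex.exp_add]
    push_cast
    rw [Complex.exp_two_pi_mul_I, mul_one]
  · intro s hs t ht hst
    have h1 := mul_left_cancel₀ (by exact_mod_cast hr.ne') hst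
    obtain ⟨n, hn⟩ := Complex.exp_eq_exp_iff_exists_int.1 h1
    have h2 : s = t + n * (2 * Real.pi) := by
      have : (s : ℂ) = ((t + n * (2 * Real.pi) : ℝ) : ℂ) := by
        apply mul_right_cancel₀ Complex.I_ne_zero
        rw [hn]; push_cast; ring
      exact_mod_cast this
    have h3 : n = 0 := by
      have h4 : -1 < (n : ℝ) := by nlinarith [hs.1, ht.2]
      have h5 : (n : ℝ) < 1 := by nlinarith [hs.2, ht.1]
      have h6 : -1 < n := by exact_mod_cast h4
      have h7 : n < 1 := by exact_mod_cast h5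
      omega
    simpa [h3] using h2

theorem isSimpleClosed_of_familyMember (hf : PosCurv f) (he : eps f = 1) (hr : 0 < r)
    (hrf : r * f r = 1) {C D : ArcCurve} (hcl : C.IsClosedCurve) {s β : ℝ} (hs : s ∈ OSet f)
    (hD : D.IsFamilyMember f s)
    (htr : C.trace = (fun w => Complex.exp (Complex.I * β) * w) '' D.trace) :
    C.IsSimpleClosed := by
  obtain ⟨hs0, hsr, n, hn, hw⟩ := hs
  rw [hf.critRadius_eq he hr hrf] at hsr
  rw [he, one_mul] at hw
  obtain ⟨φ, z, ϑ, S, G, h⟩ :=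
    hf.exists_orbit_of_familyMember he hr hrf hs0 hsr hD (isClosedCurve_of_rotate hcl htr)
  have hagree := G.agree_of_pos (τ := 0) (by simpa using h) hs0
  have hturn := hf.turn_of_hasNetWinding h hs0 G.angle hagree (by omega) hw
  have hrange : range (roll z fun t => ϑ t + β) = C.trace := by
    rw [htr, ← G.range_eq, ← range_comp]
    exact congrArg range (funext fun t => roll_add_const z ϑ β t)
  have hϑ : ∀ t, HasDerivAt (fun t => ϑ t + β) (φ ‖z t‖) t := fun t => (G.angle t).add_const _
  have hloop := h.isConvexLoop_roll hϑ hs0 (n := n) (by omega) (by linarith)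
  rw [ArcCurve.IsSimpleClosed, ← hrange]
  exact nonempty_homeomorph_circle
    (continuous_iff_continuousAt.2 fun t => (hloop.hasDerivAt t).continuousAt)
    hloop.pos hloop.periodic hloop.injOn

/-- The parameter in the family is the distance of the curve from the origin. -/
lemma isLeast_of_familyMember (hf : PosCurv f) (he : eps f = 1) (hr : 0 < r)
    (hrf : r * f r = 1) {C D : ArcCurve} (hcl : C.IsClosedCurve) {s β : ℝ} (hs : s ∈ OSet f)
    (hD : D.IsFamilyMember f s)
    (htr : C.trace = (fun w => Complex.exp (Complex.I * β) * w) '' D.trace) :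
    IsLeast (norm '' C.trace) s := by
  obtain ⟨hs0, hsr, -⟩ := hs
  rw [hf.critRadius_eq he hr hrf] at hsr
  obtain ⟨φ, z, ϑ, S, G, h⟩ :=
    hf.exists_orbit_of_familyMember he hr hrf hs0 hsr hD (isClosedCurve_of_rotate hcl htr)
  rw [htr, norm_image_rotate]
  exact G.isLeast_norm h hs0

theorem isJordanSolution_iff (hf : PosCurv f) (he : eps f = 1) (hr : 0 < r) (hrf : r * f r = 1)
    {C : ArcCurve} (hC : C.IsMaximalSolution f) (hcl : C.IsClosedCurve) :
    C.IsJordanSolution f ↔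
      (C.trace = Metric.sphere (0 : ℂ) (critRadius f) ∨
       ∃! s : ℝ, s ∈ OSet f ∧ ∃ (D : ArcCurve) (β : ℝ), D.IsFamilyMember f s ∧
         C.trace = (fun w : ℂ => Complex.exp (Complex.I * (β : ℂ)) * w) '' D.trace) := by
  rw [hf.critRadius_eq he hr hrf]
  constructor
  · rintro ⟨-, hs⟩
    refine (hf.exists_familyMember he hr hrf hC hcl hs).imp_right ?_
    rintro ⟨s, hsO, D, β, hD, htr⟩
    refine ⟨s, ⟨hsO, D, β, hD, htr⟩, ?_⟩
    rintro s' ⟨hsO', D', β', hD', htr'⟩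
    exact (hf.isLeast_of_familyMember he hr hrf hcl hsO' hD' htr').unique
      (hf.isLeast_of_familyMember he hr hrf hcl hsO hD htr)
  · rintro (h | ⟨s, ⟨hsO, D, β, hD, htr⟩, -⟩)
    · exact ⟨hC, isSimpleClosed_of_sphere hr h⟩
    · exact ⟨hC, hf.isSimpleClosed_of_familyMember he hr hrf hcl hsO hD htr⟩

end PosCurv

/-! ### Reflection: from positive to negative curvature -/

/-- The path `γ` rotated by a half-turn and traversed backwards. -/
def reflectPath (γ : ℝ → ℂ) (t : ℝ) : ℂ := -γ (-t)

lemma deriv_reflectPath (γ : ℝ → ℂ) (t : ℝ) : deriv (reflectPath γ) t = deriv γ (-t) := by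
  have : reflectPath γ = -fun t => γ (-t) := rfl
  rw [this, deriv.neg, deriv_comp_neg, neg_neg]

lemma range_reflectPath (γ : ℝ → ℂ) : range (reflectPath γ) = -range γ := by
  ext w
  rw [Set.mem_neg]
  constructor
  · rintro ⟨t, rfl⟩
    exact ⟨-t, by simp [reflectPath]⟩
  · rintro ⟨t, ht⟩
    exact ⟨-t, by simp [reflectPath, ht]⟩

lemma periodic_reflectPath {γ : ℝ → ℂ} {a : ℝ} (h : Function.Periodic γ a) :
    Function.Periodic (reflectPath γ) a := by
  intro t
  rw [reflectPath, reflectPath, neg_add, ← sub_eq_add_neg, h.sub_eq]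

lemma InteriorTo.neg {T : Set ℂ} {q : ℂ} (h : InteriorTo T q) : InteriorTo (-T) (-q) := by
  refine ⟨by simpa using h.1, ?_⟩
  have h1 := (Homeomorph.neg ℂ).image_connectedComponentIn h.1
  have h2 : (Homeomorph.neg ℂ) '' Tᶜ = (-T)ᶜ := by
    rw [Homeomorph.coe_neg, image_neg_eq_neg, compl_neg]
  rw [h2] at h1
  change _ = connectedComponentIn (-T)ᶜ (-q) at h1
  rw [← h1, Homeomorph.coe_neg, image_neg_eq_neg]
  exact h.2.neg

lemma integral_comp_neg_of_periodic {E : Type*} [NormedAddCommGroup E] [NormedSpace ℝ E]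
    {g : ℝ → E} {a : ℝ} (h : Function.Periodic g a) :
    ∫ t in (0 : ℝ)..a, g (-t) = ∫ t in (0 : ℝ)..a, g t := by
  rw [intervalIntegral.integral_comp_neg, neg_zero]
  have := h.intervalIntegral_add_eq (-a) 0
  rwa [neg_add_cancel, zero_add] at this

lemma winding_reflectPath {γ : ℝ → ℂ} {a : ℝ} (h : Function.Periodic γ a) (q : ℂ) :
    winding (reflectPath γ) a q = -winding γ a (-q) := by
  have hd : Function.Periodic (deriv γ) a := by
    intro t
    have := deriv_comp_add_const (f := γ) a t
    rw [← this]
    exact congrArg (fun g => deriv g t) (funext h)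
  have h1 : Function.Periodic (fun t => deriv γ t / (γ t - -q)) a := fun t => by
    simp only [h t, hd t]
  have h2 : ∀ t, deriv (reflectPath γ) t / (reflectPath γ t - q) =
      -(fun t => deriv γ t / (γ t - -q)) (-t) := by
    intro t
    rw [deriv_reflectPath, reflectPath, ← div_neg]
    congr 1; ring
  rw [winding, winding]
  simp only [h2]
  rw [intervalIntegral.integral_neg, mul_neg]
  exact congrArg (fun x => -(_ * x)) (integral_comp_neg_of_periodic h1)

lemma LoopCCW.reflect {γ : ℝ → ℂ} {a : ℝ} (h : Function.Periodic γ a) (hl : LoopCCW γ a) :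
    LoopCW (reflectPath γ) a := by
  obtain ⟨⟨q, hq⟩, hw⟩ := hl
  refine ⟨⟨-q, by rw [range_reflectPath]; exact hq.neg⟩, fun q hq => ?_⟩
  rw [range_reflectPath] at hq
  rw [winding_reflectPath h, hw _ (by simpa using hq.neg)]

lemma LoopCW.reflect {γ : ℝ → ℂ} {a : ℝ} (h : Function.Periodic γ a) (hl : LoopCW γ a) :
    LoopCCW (reflectPath γ) a := by
  obtain ⟨⟨q, hq⟩, hw⟩ := hl
  refine ⟨⟨-q, by rw [range_reflectPath]; exact hq.neg⟩, fun q hq => ?_⟩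
  rw [range_reflectPath] at hq
  rw [winding_reflectPath h, hw _ (by simpa using hq.neg), neg_neg]

lemma IsFlowLine.reflect {f : ℝ → ℝ} {z : ℝ → ℂ} (hz : IsFlowLine f z) :
    IsFlowLine (-f) (reflectPath z) := by
  intro t
  refine ⟨neg_ne_zero.2 (hz (-t)).1, ?_⟩
  have h1 : HasDerivAt (fun t => -z (-t)) _ t := ((hz (-t)).2.scomp t (hasDerivAt_neg t)).fun_neg
  refine h1.congr_deriv ?_
  simp [reflectPath]

lemma IsFlowLine.shift {f : ℝ → ℝ} {z : ℝ → ℂ} (hz : IsFlowLine f z) (τ : ℝ) :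
    IsFlowLine f (fun t => z (t + τ)) :=
  fun t => ⟨(hz (t + τ)).1, (hz (t + τ)).2.comp_add_const t τ⟩

/-- Recurrence implies periodicity, by uniqueness of solutions. -/
lemma IsFlowLine.periodic {f : ℝ → ℝ} (hf : PosCurv f ∨ PosCurv (-f)) {z : ℝ → ℂ}
    (hz : IsFlowLine f z) {τ : ℝ} (h : z τ = z 0) : Function.Periodic z τ := by
  rcases hf with hf | hf
  · exact congrFun (hf.flowLine_eq (hz.shift τ) hz (by simpa using h))
  · have h1 := hf.flowLine_eq (hz.shift τ).reflect hz.reflect (by simpa [reflectPath] using h)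
    intro t
    simpa [reflectPath] using congrFun h1 (-t)

lemma HasNetWinding.reflect {f : ℝ → ℝ} (hf : PosCurv f ∨ PosCurv (-f)) {p : ℂ} {w : ℝ}
    (h : HasNetWinding f p w) : HasNetWinding (-f) (-p) w := by
  obtain ⟨z, T, hz, rfl, hne, hT, hcases⟩ := h
  have hper : ∀ {τ}, z τ = z 0 → Function.Periodic z τ := fun h => hz.periodic hf h
  have hset : {t : ℝ | 0 < t ∧ reflectPath z t = -z 0} = {t : ℝ | 0 < t ∧ z t = z 0} := by
    ext t
    simp only [mem_ofPred_eq, reflectPath, neg_inj]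
    refine and_congr_right fun _ => ⟨fun h => ?_, fun h => ?_⟩
    · have := hper h 0
      have := hper h t
      rw [add_neg_cancel] at this
      exact this.symm
    · have := hper h (-t)
      rw [neg_add_cancel] at this
      exact this.symm
  have hTper : 0 < T → Function.Periodic z T := by
    intro h0
    have hzc : Continuous z := continuous_iff_continuousAt.2 fun t => (hz t).2.continuousAt
    refine hper ?_
    have hcl : closure {t : ℝ | 0 < t ∧ z t = z 0} ⊆ {t | z t = z 0} :=
      closure_minimal (fun t ht => ht.2) (isClosed_eq hzc continuous_const)
    rw [hT]
    exact hcl (csInf_mem_closure hne ⟨0, fun t ht => ht.1.le⟩)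
  have hint : 0 < T → ∫ t in (0 : ℝ)..T, (-f) ‖reflectPath z t‖ = -∫ t in (0 : ℝ)..T, f ‖z t‖ := by
    intro h0
    have h1 : Function.Periodic (fun t => f ‖z t‖) T := fun t => by simp only [hTper h0 t]
    have h2 : ∀ t, (-f) ‖reflectPath z t‖ = -(fun t => f ‖z t‖) (-t) := fun t => by
      simp [reflectPath]
    simp only [h2]
    rw [intervalIntegral.integral_neg]
    exact congrArg Neg.neg (integral_comp_neg_of_periodic h1)
  refine ⟨reflectPath z, T, hz.reflect, by simp [reflectPath], by rwa [hset], by rwa [hset], ?_⟩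
  rcases hcases with h | ⟨h0, hl, hw⟩ | ⟨h0, hl, hw⟩
  · exact Or.inl h
  · exact Or.inr (Or.inr ⟨h0, hl.reflect (hTper h0), by rw [hint h0, mul_neg, neg_neg]; exact hw⟩)
  · exact Or.inr (Or.inl ⟨h0, hl.reflect (hTper h0), by rw [hint h0, mul_neg]; exact hw⟩)

/-! #### Reflected curves -/

namespace ArcCurve

/-- The curve rotated by a half-turn and traversed backwards. -/
def reflect (C : ArcCurve) : ArcCurve where
  J := Neg.neg ⁻¹' C.J
  isOpen_J := C.isOpen_J.preimage continuous_neg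
  ordConnected_J := ⟨fun x hx y hy t ht => C.ordConnected_J.out hy hx
    ⟨neg_le_neg ht.2, neg_le_neg ht.1⟩⟩
  zero_mem := by simpa using C.zero_mem
  c := reflectPath C.c
  smooth := (C.smooth.comp contDiff_neg.contDiffOn fun _ h => h).neg
  unit_speed t ht := by rw [deriv_reflectPath]; exact C.unit_speed (-t) ht

lemma trace_reflect (C : ArcCurve) : C.reflect.trace = -C.trace := by
  ext w
  rw [Set.mem_neg]
  constructor
  · rintro ⟨t, ht, rfl⟩
    exact ⟨-t, ht, by simp [reflect, reflectPath]⟩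
  · rintro ⟨t, ht, h⟩
    exact ⟨-t, by simpa [reflect] using ht, by simp [reflect, reflectPath, h]⟩

lemma isTangentAngle_reflect {c : ℝ → ℂ} {J : Set ℝ} {ϑ : ℝ → ℝ} (h : IsTangentAngle c J ϑ) :
    IsTangentAngle (reflectPath c) (Neg.neg ⁻¹' J) (fun t => ϑ (-t)) :=
  ⟨h.1.comp contDiff_neg.contDiffOn fun _ h => h, fun t ht => by
    rw [deriv_reflectPath]; exact h.2 (-t) ht⟩

lemma IsSolution.reflect {f : ℝ → ℝ} {C : ArcCurve} (hC : C.IsSolution f) :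
    C.reflect.IsSolution (-f) := by
  obtain ⟨ϑ, hϑ, hsol⟩ := hC
  refine ⟨fun t => ϑ (-t), isTangentAngle_reflect hϑ, fun t ht h0 => ?_⟩
  have h1 : C.c (-t) ≠ 0 := neg_ne_zero.1 h0
  have h2 : ‖C.reflect.c t‖ = ‖C.c (-t)‖ := norm_neg _
  rw [deriv_comp_neg, hsol (-t) ht h1, h2, Pi.neg_apply]

lemma IsMaximalSolution.reflect {f : ℝ → ℝ} {C : ArcCurve} (hC : C.IsMaximalSolution f) :
    C.reflect.IsMaximalSolution (-f) := by
  refine ⟨hC.1.reflect, fun E hE hsub => ?_⟩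
  have h1 := hE.reflect
  rw [neg_neg] at h1
  have h2 := hC.2 E.reflect h1 (by
    rw [trace_reflect] at hsub ⊢
    exact Set.neg_subset.1 hsub)
  rw [trace_reflect, h2, trace_reflect, neg_neg]

lemma IsFamilyMember.reflect {f : ℝ → ℝ} (he : eps (-f) = -eps f) {s : ℝ} {D : ArcCurve}
    (hD : D.IsFamilyMember f s) : D.reflect.IsFamilyMember (-f) s := by
  obtain ⟨hmax, hc, ϑ, hϑ, h0⟩ := hD
  refine ⟨hmax.reflect, ?_, _, isTangentAngle_reflect hϑ, by simpa using h0⟩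
  change -D.c (-0) = _
  rw [neg_zero, hc, he]
  push_cast
  ring

lemma IsClosedCurve.reflect {C : ArcCurve} (hC : C.IsClosedCurve) : C.reflect.IsClosedCurve := by
  rw [IsClosedCurve, trace_reflect]
  exact hC.neg

lemma isSimpleClosed_reflect {C : ArcCurve} : C.reflect.IsSimpleClosed ↔ C.IsSimpleClosed := by
  rw [IsSimpleClosed, IsSimpleClosed, trace_reflect, ← image_neg_eq_neg]
  let e : C.trace ≃ₜ Neg.neg '' C.trace := (Homeomorph.neg ℂ).image C.trace
  exact ⟨fun ⟨g⟩ => ⟨e.trans g⟩, fun ⟨g⟩ => ⟨e.symm.trans g⟩⟩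

/-- Over one period the tangent angle of the reversed path is that of the path, read backwards. -/
lemma OrientedCCW.of_reflect {C : ArcCurve} (h : C.reflect.OrientedCCW) : C.OrientedCW := by
  obtain ⟨γ, a, ϑ, hγ, hϑ, hlt, hs⟩ := h
  have hper := hγ.periodic
  have hder : Function.Periodic (deriv γ) a := by
    intro t
    rw [← deriv_comp_add_const (f := γ) a t]
    exact congrArg (fun g => deriv g t) (funext hper)
  refine ⟨reflectPath γ, a, fun t => ϑ (a - t),
    ⟨(hγ.smooth.comp contDiff_neg).neg, fun t => by rw [deriv_reflectPath]; exact hγ.unit_speed _,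
      hγ.pos, periodic_reflectPath hper, fun t ht => ?_, ?_⟩, ⟨?_, fun t _ => ?_⟩,
    by simpa using hlt, fun hC => ?_⟩
  · have h1 := hγ.extends_c (x := -t) (by simpa [reflect] using ht)
    rw [reflectPath, h1]
    simp [reflect, reflectPath]
  · rw [range_reflectPath, hγ.range_eq, trace_reflect, neg_neg]
  · exact hϑ.1.comp (contDiff_const.sub contDiff_id).contDiffOn fun _ _ => mem_univ _
  · rw [deriv_reflectPath, ← hϑ.2 _ (mem_univ _), sub_eq_neg_add, hder]
  · obtain ⟨hinj, hl⟩ := hs (isSimpleClosed_reflect.2 hC)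
    refine ⟨fun s hs t ht hst => ?_, hl.reflect hper⟩
    -- the times `-s` and `-t` are shifted into the period `[0, a)`
    have key : ∀ s ∈ Ico 0 a, ∃ u ∈ Ico 0 a,
        γ u = γ (-s) ∧ (s = 0 ∧ u = 0 ∨ 0 < s ∧ u = a - s) := by
      intro s hs
      rcases hs.1.eq_or_lt with h | h
      · exact ⟨0, ⟨le_rfl, hγ.pos⟩, by simp [← h], Or.inl ⟨h.symm, rfl⟩⟩
      · exact ⟨a - s, ⟨by linarith [hs.2], by linarith⟩, by rw [sub_eq_neg_add, hper],
          Or.inr ⟨h, rfl⟩⟩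
    obtain ⟨u, hu, hu1, hu2⟩ := key s hs
    obtain ⟨v, hv, hv1, hv2⟩ := key t ht
    have huv : u = v := hinj hu hv (by rw [hu1, hv1]; exact neg_injective hst)
    rcases hu2 with ⟨h1, h2⟩ | ⟨h1, h2⟩ <;> rcases hv2 with ⟨h3, h4⟩ | ⟨h3, h4⟩ <;>
      linarith [hs.2, ht.2]

end ArcCurve

lemma critRadius_neg {f : ℝ → ℝ} (he : eps (-f) = -eps f) : critRadius (-f) = critRadius f := by
  simp only [critRadius, he, Pi.neg_apply, mul_neg, neg_inj]

lemma mem_OSet_neg {f : ℝ → ℝ} (hf : PosCurv f ∨ PosCurv (-f)) (he : eps (-f) = -eps f) {s : ℝ}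
    (hs : s ∈ OSet f) : s ∈ OSet (-f) := by
  obtain ⟨h0, h1, n, hn, hw⟩ := hs
  refine ⟨h0, by rwa [critRadius_neg he], n, hn, ?_⟩
  have := hw.reflect hf
  rw [he]
  simpa using this

/-- The set of family parameters and angles describing a curve is unchanged by reflection. -/
lemma familyMember_reflect {f : ℝ → ℝ} (hf : PosCurv f ∨ PosCurv (-f)) (he : eps (-f) = -eps f)
    {C : ArcCurve} {s : ℝ}
    (h : s ∈ OSet f ∧ ∃ (D : ArcCurve) (β : ℝ), D.IsFamilyMember f s ∧
      C.trace = (fun w : ℂ => Complex.exp (Complex.I * (β : ℂ)) * w) '' D.trace) :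
    s ∈ OSet (-f) ∧ ∃ (D : ArcCurve) (β : ℝ), D.IsFamilyMember (-f) s ∧
      C.reflect.trace = (fun w : ℂ => Complex.exp (Complex.I * (β : ℂ)) * w) '' D.trace := by
  obtain ⟨hs, D, β, hD, htr⟩ := h
  refine ⟨mem_OSet_neg hf he hs, D.reflect, β, hD.reflect he, ?_⟩
  rw [C.trace_reflect, D.trace_reflect, htr, ← image_neg_eq_neg, ← image_neg_eq_neg, image_image,
    image_image]
  simp only [mul_neg]

/-! ### The class of curvature functions -/

/-- A continuous function without zeros on `ℝ⁺` has a constant sign. -/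
lemma pos_or_neg_of_ne_zero {g : ℝ → ℝ} (hg : ContinuousOn g (Ioi 0)) (h0 : ∀ s, 0 < s → g s ≠ 0) :
    (∀ s, 0 < s → 0 < g s) ∨ ∀ s, 0 < s → g s < 0 := by
  have hint : ∀ s t, 0 < s → 0 < t → g s < 0 → 0 < g t → False := by
    intro s t hs ht h1 h2
    obtain ⟨u, hu, h3⟩ := isPreconnected_Ioi.intermediate_value (mem_Ioi.2 hs) (mem_Ioi.2 ht) hg
      (show (0 : ℝ) ∈ Icc (g s) (g t) from ⟨h1.le, h2.le⟩)
    exact h0 u hu h3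
  rcases (h0 1 one_pos).lt_or_gt with h | h
  · exact Or.inr fun s hs => lt_of_not_ge fun h1 => hint 1 s one_pos hs h
      (lt_of_le_of_ne h1 (h0 s hs).symm)
  · exact Or.inl fun s hs => lt_of_not_ge fun h1 => hint s 1 hs one_pos
      (lt_of_le_of_ne h1 (h0 s hs)) h

namespace MemF

variable {f : ℝ → ℝ}

lemma secondF_neg (f : ℝ → ℝ) (s : ℝ) : secondF (-f) s = -secondF f s := by
  rw [secondF, secondF, deriv_sub_const, deriv_sub_const, ← deriv.neg]
  congr 1
  funext u
  simp

lemma pos_or_neg (hf : MemF f) : (∀ s, 0 < s → 0 < f s) ∨ ∀ s, 0 < s → f s < 0 :=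
  pos_or_neg_of_ne_zero hf.smooth.continuousOn fun s hs h => hf.ne_zero s hs (by simp [h])

lemma deriv_pos_or_neg (hf : MemF f) :
    (∀ s, 0 < s → 0 < deriv f s) ∨ ∀ s, 0 < s → deriv f s < 0 :=
  pos_or_neg_of_ne_zero (hf.smooth.continuousOn_deriv_of_isOpen isOpen_Ioi (by simp))
    fun s hs h => hf.ne_zero s hs (by simp [h])

lemma secondF_pos_or_neg (hf : MemF f) :
    (∀ s, 0 < s → 0 < secondF f s) ∨ ∀ s, 0 < s → secondF f s < 0 :=
  pos_or_neg_of_ne_zero (((contDiffOn_id.mul hf.smooth).sub contDiffOn_const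
    ).continuousOn_deriv_of_isOpen isOpen_Ioi (by simp))
    fun s hs h => hf.ne_zero s hs (by simp [h])

lemma eps_of_pos (h : ∀ s, 0 < s → 0 < secondF f s) : eps f = 1 := if_pos h

lemma eps_of_neg (h : ∀ s, 0 < s → secondF f s < 0) : eps f = -1 :=
  if_neg fun h' => (h 1 one_pos).not_gt (h' 1 one_pos)

lemma eps_neg (hf : MemF f) : eps (-f) = -eps f := by
  rcases hf.secondF_pos_or_neg with h | h
  · rw [eps_of_pos h, eps_of_neg fun s hs => by rw [secondF_neg]; linarith [h s hs]]
  · rw [eps_of_neg h, eps_of_pos fun s hs => by rw [secondF_neg]; linarith [h s hs], neg_neg]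

end MemF

namespace MemFStar

variable {f : ℝ → ℝ}

lemma neg (hf : MemFStar f) : MemFStar (-f) where
  smooth := hf.smooth.neg
  ne_zero s hs := by
    rw [MemF.secondF_neg, deriv.neg, Pi.neg_apply]
    simpa using hf.ne_zero s hs
  one_mem := by
    have h : ∀ s, eps (-f) * (s * (-f) s) = eps f * (s * f s) := fun s => by
      rw [hf.toMemF.eps_neg, Pi.neg_apply]; ring
    simpa only [h] using hf.one_mem

lemma eps_eq_one (hf : MemFStar f) (hpos : ∀ s, 0 < s → 0 < f s) :
    (∀ s, 0 < s → 0 < secondF f s) ∧ eps f = 1 := by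
  rcases hf.toMemF.secondF_pos_or_neg with h | h
  · exact ⟨h, MemF.eps_of_pos h⟩
  · -- otherwise the limit at infinity would not be positive
    obtain ⟨a, b, -, hb, -, hb1⟩ := hf.one_mem
    exfalso
    have h1 : b ≤ 0 := by
      refine le_of_tendsto hb ?_
      filter_upwards [eventually_gt_atTop 0] with s hs
      rw [MemF.eps_of_neg h]
      have := mul_pos hs (hpos s hs)
      have h2 : -1 * (s * f s) ≤ 0 := by linarith
      exact_mod_cast h2
    exact absurd (hb1.trans_le h1) (by norm_num)

lemma posCurv (hf : MemFStar f) (hpos : ∀ s, 0 < s → 0 < f s) : PosCurv f where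
  smooth := hf.smooth
  pos := hpos
  strictMonoOn_mul := by
    refine strictMonoOn_of_deriv_pos (convex_Ioi 0)
      (continuousOn_id.mul hf.smooth.continuousOn) fun s hs => ?_
    rw [interior_Ioi] at hs
    have := (hf.eps_eq_one hpos).1 s hs
    rwa [secondF, deriv_sub_const] at this
  strict := hf.toMemF.deriv_pos_or_neg.imp
    (fun h => strictMonoOn_of_deriv_pos (convex_Ioi 0) hf.smooth.continuousOn fun s hs =>
      h s (by rwa [interior_Ioi] at hs))
    (fun h => strictAntiOn_of_deriv_neg (convex_Ioi 0) hf.smooth.continuousOn fun s hs =>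
      h s (by rwa [interior_Ioi] at hs))

lemma exists_radius (hf : MemFStar f) (hpos : ∀ s, 0 < s → 0 < f s) :
    ∃ r, 0 < r ∧ r * f r = 1 := by
  obtain ⟨a, b, ha, hb, ha1, hb1⟩ := hf.one_mem
  rw [(hf.eps_eq_one hpos).2] at ha hb
  simp only [one_mul] at ha hb
  obtain ⟨s, hs, hs0⟩ := ((ha.eventually_lt_const ha1).and self_mem_nhdsWithin).exists
  obtain ⟨t, ht, ht0⟩ := ((hb.eventually_const_lt hb1).and (eventually_gt_atTop 0)).exists
  have hs' : s * f s < 1 := by exact_mod_cast hs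
  have ht' : 1 < t * f t := by exact_mod_cast ht
  obtain ⟨r, hr, h⟩ := isPreconnected_Ioi.intermediate_value hs0 (mem_Ioi.2 ht0)
    (f := fun s => s * f s) (continuousOn_id.mul hf.smooth.continuousOn)
    (show (1 : ℝ) ∈ Icc _ _ from ⟨hs'.le, ht'.le⟩)
  exact ⟨r, hr, h⟩

end MemFStar

end RadialCurvature

theorem mainTheorem4 (f : ℝ → ℝ) (hf : RadialCurvature.MemFStar f)
    (C : RadialCurvature.ArcCurve) (hC : C.IsMaximalSolution f) (hclosed : C.IsClosedCurve) :
    ((∀ s : ℝ, 0 < s → 0 < f s) → C.OrientedCCW) ∧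
    ((∀ s : ℝ, 0 < s → f s < 0) → C.OrientedCW) ∧
    (C.IsJordanSolution f ↔
      (C.trace = Metric.sphere (0 : ℂ) (RadialCurvature.critRadius f) ∨
       ∃! s : ℝ, s ∈ RadialCurvature.OSet f ∧
         ∃ (D : RadialCurvature.ArcCurve) (ϑ : ℝ), D.IsFamilyMember f s ∧
           C.trace = (fun z : ℂ => Complex.exp (Complex.I * (ϑ : ℂ)) * z) '' D.trace)) := by
  open RadialCurvature in
  have hneg : (∀ s : ℝ, 0 < s → f s < 0) → ∀ s : ℝ, 0 < s → 0 < (-f) s := fun h s hs =>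
    neg_pos.2 (h s hs)
  refine ⟨fun hpos => ?_, fun h => ?_, ?_⟩
  · have hP := hf.posCurv hpos
    obtain ⟨φ, z, ϑ, G⟩ := exists_globalParam hP hC hclosed
    exact G.orientedCCW hP hclosed
  · have hP := hf.neg.posCurv (hneg h)
    obtain ⟨φ, z, ϑ, G⟩ := exists_globalParam hP hC.reflect hclosed.reflect
    exact (G.orientedCCW hP hclosed.reflect).of_reflect
  · rcases hf.toMemF.pos_or_neg with hpos | h
    · obtain ⟨r, hr, hrf⟩ := hf.exists_radius hpos
      exact (hf.posCurv hpos).isJordanSolution_iff (hf.eps_eq_one hpos).2 hr hrf hC hclosed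
    · have hP := hf.neg.posCurv (hneg h)
      obtain ⟨r, hr, hrf⟩ := hf.neg.exists_radius (hneg h)
      have he := hf.toMemF.eps_neg
      have hiff := hP.isJordanSolution_iff (hf.neg.eps_eq_one (hneg h)).2 hr hrf hC.reflect
        hclosed.reflect
      have hJ : C.reflect.IsJordanSolution (-f) ↔ C.IsJordanSolution f := by
        rw [ArcCurve.IsJordanSolution, ArcCurve.IsJordanSolution, ArcCurve.isSimpleClosed_reflect]
        exact and_congr_left fun _ => ⟨fun _ => hC, fun _ => hC.reflect⟩
      rw [← hJ, hiff]
      refine or_congr ?_ (existsUnique_congr fun s => ⟨fun hs => ?_, fun hs => ?_⟩)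
      · rw [ArcCurve.trace_reflect, critRadius_neg he, neg_eq_iff_eq_neg]
        simp
      · have := familyMember_reflect (f := -f) (Or.inl hP) (by rw [neg_neg, he, neg_neg]) hs
        rw [neg_neg, ArcCurve.trace_reflect, ArcCurve.trace_reflect, neg_neg] at this
        exact this
      · exact familyMember_reflect (Or.inr hP) he hs
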